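/- **Setting.** For $n\ge 1$ let $\mathbf X\in\{\pm1\}^n$ follow the Curie–Weiss model $$\mathbb P_{\beta,\mathbf Q,\boldsymbol\mu}(\mathbf X=\mathbf x)=\frac1{Z(\beta,\mathbf Q,\boldsymbol\mu)}\exp\Big(\frac\beta2\mathbf x^\top\mathbf Q\mathbf x+\boldsymbol\mu^\top\mathbf x\Big),\qquad \mathbf Q_{ij}=\frac{\mathbf 1(i\ne j)}n .$$ Let $s=s_n$ be positive integers for large $n$, let $\mathcal C_s=\mathcal C_{s,n}$ be a class of subsets of $[n]=\{1,\dots,n\}$ of size $s$, and let $A=A_n\in\mathbb R$. We test $H_0:\boldsymbol\mu=\mathbf 0$ against $H_1:\boldsymbol\mu\in\Xi(\mathcal C_s,A)$, where $\Xi(\mathcal C_s,A)$ is the set of $\boldsymbol\mu\in[0,\infty)^n$ with $\mathrm{supp}(\boldsymbol\mu)\in\mathcal C_s$ and $\mu_i\ge A$ for all $i\in\mathrm{supp}(\boldsymbol\mu)$. A test is a map $T:\{\pm1\}^n\to\{0,1\}$, and its risk is $$\mathrm{Risk}(T)=\mathbb P_{\beta,\mathbf Q,\mathbf 0}(T(\mathbf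 X)=1)+\sup_{\boldsymbol\mu\in\Xi(\mathcal C_s,A)}\mathbb P_{\beta,\mathbf Q,\boldsymbol\mu}(T(\mathbf X)=0).$$ A sequence of tests $T_n$ is asymptotically powerful if $\limsup_n\mathrm{Risk}(T_n)=0$, asymptotically not powerful if $\liminf_n\mathrm{Risk}(T_n)>0$, and asymptotically powerless if $\liminf_n\mathrm{Risk}(T_n)\ge1$. For $S_1,S_2\subset[n]$ let $\gamma(S_1,S_2)=\sqrt2\big(1-|S_1\cap S_2|/\sqrt{|S_1||S_2|}\big)$, and let $|\mathcal N(\mathcal C_s,\gamma,\varepsilon)|$ be the $\varepsilon$-covering number of $\mathcal C_s$: the least cardinality of a subfamily of $\mathcal C_s$ such that every member of $\mathcal C_s$ is within $\gamma$-distance $\varepsilon$ of some member of the subfamily. We write $a_n\ll b_n$ if $a_n/b_n\to0$, and $a_n=\Theta(b_n)$ if $a_n/b_n$ is, for large $n$, bounded and bounded away from $0$. For $\beta>1$ the equation $m=\tanh(\beta m)$ has a unique positive root, denoted by $m$. **Theorem 1.** **i. (Upper bounds.)** Suppose that, for some sequence $\varepsilon_n\to0$, $$\Theta(\log n)=\log|\mathcal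 N(\mathcal C_s,\gamma,\varepsilon_n)|\ll s\ll n/\log|\mathcal N(\mathcal C_s,\gamma,\varepsilon_n)|,$$ and put $r_n=\sqrt s\,\tanh(A)\,(\log|\mathcal N(\mathcal C_s,\gamma,\varepsilon_n)|)^{-1/2}$. * a) If $\beta<1$, $s\ll n/\log n$ and $\liminf_n r_n>\sqrt2$, there is an asymptotically powerful sequence of tests. * b) If $\beta=1$, $s\ll\sqrt n/\log n$ and $\liminf_n r_n>\sqrt2$, there is an asymptotically powerful sequence of tests. * c) If $\beta>1$, $s\ll n/\log n$ and $\liminf_n r_n>\sqrt2\cosh(\beta m)$, there is an asymptotically powerful sequence of tests. **ii. (Lower bounds.)** Suppose that there are subclasses $\tilde{\mathcal C}_s\subset\mathcal C_s$ consisting of pairwise disjoint sets with $$\Theta(\log n)=\log|\tilde{\mathcal C}_s|\ll s\ll n/\log|\tilde{\mathcal C}_s|,$$ and put $\tilde r_n=\sqrt s\,\tanh(A)\,(\log|\tilde{\mathcal C}_s|)^{-1/2}$. * a) Let $\beta<1$ and $s\ll n/\log n$. If $\liminf_n\tilde r_n<\sqrt2$, no sequence of tests is asymptotically powerful; if $\limsup_n\tilde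 r_n<\sqrt2$, every sequence of tests is asymptotically powerless. * b) For $\beta=1$ both conclusions of a) hold if $s\ll\sqrt n/\log n$. * c) Let $\beta>1$ and $s\ll n/\log n$. If $\liminf_n\tilde r_n<\sqrt2\cosh(\beta m)$, no sequence of tests is asymptotically powerful; if $\limsup_n\tilde r_n<\sqrt2\cosh(\beta m)$, every sequence of tests is asymptotically not powerful. -/

import Mathlib

open Filter Asymptotics Topology

noncomputable section

namespace CWDetect

/-- The configuration space `{±1}ⁿ`. -/
abbrev Config (n : ℕ) : Type := Fin n → ℤˣ

/-- A configuration read as a vector of real numbers. -/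
def spin {n : ℕ} (x : Config n) : Fin n → ℝ := fun i => ((x i : ℤ) : ℝ)

/-- The unnormalised Ising weight `exp (β/2 · xᵀ Q x + μᵀ x)`. -/
def weight {n : ℕ} (β : ℝ) (Q : Matrix (Fin n) (Fin n) ℝ) (μ : Fin n → ℝ) (x : Config n) : ℝ :=
  Real.exp (β / 2 * (spin x ⬝ᵥ Q.mulVec (spin x)) + μ ⬝ᵥ spin x)

/-- The normalising constant `Z(β, Q, μ)`. -/
def partitionFunction {n : ℕ} (β : ℝ) (Q : Matrix (Fin n) (Fin n) ℝ) (μ : Fin n → ℝ) : ℝ :=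
  ∑ x : Config n, weight β Q μ x

open Classical in
/-- The probability of the event `E` under the Ising model `P_{β, Q, μ}`. -/
def isingProb {n : ℕ} (β : ℝ) (Q : Matrix (Fin n) (Fin n) ℝ) (μ : Fin n → ℝ)
    (E : Set (Config n)) : ℝ :=
  ∑ x : Config n, if x ∈ E then weight β Q μ x / partitionFunction β Q μ else 0

/-- The Curie–Weiss interaction matrix `Q i j = 1(i ≠ j) / n`. -/
def curieWeiss (n : ℕ) : Matrix (Fin n) (Fin n) ℝ :=
  Matrix.of fun i j => if i ≠ j then 1 / (n : ℝ) else 0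

/-- The support of a vector. -/
def supp {n : ℕ} (μ : Fin n → ℝ) : Finset (Fin n) := Finset.univ.filter fun i => μ i ≠ 0

/-- The alternative `Ξ(C, A)`: nonnegative vectors whose support lies in the class `C` and whose
nonzero entries are at least `A`. -/
def alternatives {n : ℕ} (C : Finset (Finset (Fin n))) (A : ℝ) : Set (Fin n → ℝ) :=
  {μ | (∀ i, 0 ≤ μ i) ∧ supp μ ∈ C ∧ ∀ i ∈ supp μ, A ≤ μ i}

/-- A (nonrandomised) test: `1` means that the null hypothesis is rejected. -/
abbrev Test (n : ℕ) : Type := Config n → Fin 2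

/-- Worst case risk of a test of `μ = 0` against `μ ∈ Ξ(C, A)`: probability of type I error plus
supremum of the probabilities of type II error. -/
def risk {n : ℕ} (T : Test n) (C : Finset (Finset (Fin n))) (A β : ℝ)
    (Q : Matrix (Fin n) (Fin n) ℝ) : ℝ :=
  isingProb β Q 0 {x | T x = 1} + ⨆ μ : alternatives C A, isingProb β Q μ.1 {x | T x = 0}

/-- The risks of a sequence of tests in the Curie–Weiss model. -/
def cwRisk (T : ∀ n, Test n) (C : ∀ n, Finset (Finset (Fin n))) (A : ℕ → ℝ) (β : ℝ) (n : ℕ) : ℝ :=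
  risk (T n) (C n) (A n) β (curieWeiss n)

/-- The sequence of tests is asymptotically powerful. -/
def Powerful (T : ∀ n, Test n) (C : ∀ n, Finset (Finset (Fin n))) (A : ℕ → ℝ) (β : ℝ) : Prop :=
  limsup (cwRisk T C A β) atTop = 0

/-- The sequence of tests is asymptotically not powerful. -/
def NotPowerful (T : ∀ n, Test n) (C : ∀ n, Finset (Finset (Fin n))) (A : ℕ → ℝ) (β : ℝ) : Prop :=
  0 < liminf (cwRisk T C A β) atTop

/-- The sequence of tests is asymptotically powerless: asymptotically no better than the trivial
tests, whose risk is at most `1`. -/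
def Powerless (T : ∀ n, Test n) (C : ∀ n, Finset (Finset (Fin n))) (A : ℕ → ℝ) (β : ℝ) : Prop :=
  1 ≤ liminf (cwRisk T C A β) atTop

/-- The weighted Hamming-type distance `γ(S₁, S₂) = √2 (1 - |S₁ ∩ S₂| / √(|S₁| |S₂|))`. -/
def gam {n : ℕ} (S₁ S₂ : Finset (Fin n)) : ℝ :=
  √2 * (1 - ((S₁ ∩ S₂).card : ℝ) / √((S₁.card : ℝ) * (S₂.card : ℝ)))

/-- The `ε`-covering number of the class `C` with respect to `γ`: the least cardinality of a
subfamily of `C` such that every member of `C` is within `γ`-distance `ε` of the subfamily. -/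
def coveringNumber {n : ℕ} (C : Finset (Finset (Fin n))) (ε : ℝ) : ℕ :=
  sInf {k | ∃ N ⊆ C, N.card = k ∧ ∀ S ∈ C, ∃ S' ∈ N, gam S' S ≤ ε}

/-- The complexity condition `Θ(log n) = L n ≪ s n ≪ n / L n` on a log-cardinality `L`. -/
def ComplexityCond (s : ℕ → ℕ) (L : ℕ → ℝ) : Prop :=
  (L =Θ[atTop] fun n : ℕ => Real.log n) ∧
  (L =o[atTop] fun n : ℕ => (s n : ℝ)) ∧
  ((fun n : ℕ => (s n : ℝ)) =o[atTop] fun n : ℕ => (n : ℝ) / L n)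

/-- `s ≪ n / log n`. -/
def SparseLog (s : ℕ → ℕ) : Prop :=
  (fun n : ℕ => (s n : ℝ)) =o[atTop] fun n : ℕ => (n : ℝ) / Real.log n

/-- `s ≪ √n / log n`. -/
def SparseSqrtLog (s : ℕ → ℕ) : Prop :=
  (fun n : ℕ => (s n : ℝ)) =o[atTop] fun n : ℕ => √(n : ℝ) / Real.log n

/-- `√s · tanh A · L^{-1/2}`, taken in the extended reals so that its lower and upper limits are
meaningful also when it is unbounded. -/
def signalRatio (s : ℕ → ℕ) (A L : ℕ → ℝ) (n : ℕ) : EReal :=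
  ((√(s n : ℝ) * Real.tanh (A n) / √(L n) : ℝ) : EReal)

/-- `m` is a positive root of `m = tanh (β m)`. -/
def IsPosRoot (β m : ℝ) : Prop := 0 < m ∧ m = Real.tanh (β * m)

end CWDetect

end

/-!
The proof compares two test problems, the one for the Curie–Weiss model and the one for independent
spins with a common field `z` close to `w = β m`, where `m` solves `m = tanh (β m)` (`m = 0` for
`β ≤ 1`, the positive root for `β > 1`). For independent spins with field `z`, a spin has variance
`1 - tanh (z)²`, so a shift of the field by `A` on a block of `s` coordinates moves the block sum by
`s A (1 - m²)` while its fluctuations are of order `√(s (1 - m²))`; against `exp L` competing blocks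
the threshold is `√s A = √(2 L / (1 - m²)) = √2 cosh (β m) √L`.

**Comparison.** For `β > 0` the Curie–Weiss model without field is a mixture over `z` of product
measures (`exists_cwSum_eq_integral`). The mixing density has the potential
`z² / (2 β) - log cosh z`, and a Laplace estimate shows that it sits within `O(1 / a n)` of `± w`,
with `a n = √n` for `β ≠ 1` and `a n = n^(1/4)` for `β = 1`, where the potential is only quartic
(`PhaseBounds`). The conditions on `s` say that `√(s L) ≪ a n`: the fluctuation of the mean field
shifts a block sum by less than the signal does (`Scaling.exists_window`). For `β ≤ 0` there is no
such mixture, but the model has a bounded density with respect to the uniform measure, and this is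
enough with `w = 0` and `a n = √n`. Both cases provide the same two properties, `NullControl` and
`LowerControl`, from which the bounds are derived.

**Upper bounds.** The test scans the block sums over an optimal net of the class. It accepts if, for
one of the signs `σ`, the magnetisation is close to `σ n m` and every block sum of the net is close
to or below `σ s m` (`acceptRegion`). Under the null hypothesis `NullControl` and Chernoff's bound
apply. Under an alternative the external field is arbitrary above the level `A`, and no information
about the law of the magnetisation is needed: for every `β` and every field, a block sum differs
from the sum of the conditional means `tanh (μ i + β (M - x i) / n)` by `O(√s)`
(`cwMean_sq_sum_sub_condMean_le`), because the conditional mean of a spin depends on any other spin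
only through a term of order `1 / n`. On the acceptance region `M / n` is close to `σ m`, which
forces the conditional means, hence the block sum, to be too large for acceptance.

**Lower bounds.** The worst case risk is at least the average over the blocks of the disjoint
subfamily, each carrying a field slightly larger than `A`. `LowerControl` reduces this average to
the product measures with field close to `w`, and there the truncated second moment of the averaged
likelihood ratio (`deficit_sq_le`) shows that testing is impossible. The reduction retains the part
of the mixture around the mode `w`. This is everything if `w = 0`, so that the risk is at least
`1 - o(1)`, and half of the mass by symmetry if `w > 0`, so that it is at least `1/2 - o(1)`.
-/

namespace CWDetect

/-! ### Expectations in the Curie–Weiss model -/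

section Expectations

variable {n : ℕ} {β : ℝ} {μ : Fin n → ℝ}

/-- The block sum `∑ i ∈ S, x i`. -/
noncomputable def blockSum (S : Finset (Fin n)) (x : Config n) : ℝ := ∑ i ∈ S, spin x i

/-- The total magnetisation. -/
noncomputable def mag (x : Config n) : ℝ := blockSum Finset.univ x

/-- The Curie–Weiss weight with the diagonal of the interaction included, so that it depends on the
configuration only through the magnetisation and the external field; the diagonal contributes a
constant factor. -/
noncomputable def cwWeight (β : ℝ) (μ : Fin n → ℝ) (x : Config n) : ℝ :=
  Real.exp (β / (2 * n) * mag x ^ 2 + ∑ i, μ i * spin x i)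

/-- The unnormalised expectation of `F`. For `β = 0` it belongs to a product measure. -/
noncomputable def cwSum (β : ℝ) (μ : Fin n → ℝ) (F : Config n → ℝ) : ℝ :=
  ∑ x, cwWeight β μ x * F x

/-- The expectation of `F` in the Curie–Weiss model with external field `μ`. For `β = 0` the spins
are independent with means `tanh (μ i)`. -/
noncomputable def cwMean (β : ℝ) (μ : Fin n → ℝ) (F : Config n → ℝ) : ℝ :=
  cwSum β μ F / cwSum β μ fun _ => 1

/-- The probability of `E` in the Curie–Weiss model with external field `μ`. -/
noncomputable def cwProb (β : ℝ) (μ : Fin n → ℝ) (E : Set (Config n)) : ℝ :=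
  cwMean β μ (E.indicator 1)

lemma cwWeight_pos (x : Config n) : 0 < cwWeight β μ x := Real.exp_pos _

lemma cwSum_one_pos : 0 < cwSum β μ fun _ => 1 := by
  unfold cwSum
  exact Finset.sum_pos (fun x _ => by simpa using cwWeight_pos x) ⟨1, Finset.mem_univ _⟩

lemma cwSum_mono {F G : Config n → ℝ} (h : ∀ x, F x ≤ G x) : cwSum β μ F ≤ cwSum β μ G :=
  Finset.sum_le_sum fun x _ => mul_le_mul_of_nonneg_left (h x) (cwWeight_pos x).le

lemma cwSum_nonneg {F : Config n → ℝ} (h : ∀ x, 0 ≤ F x) : 0 ≤ cwSum β μ F :=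
  Finset.sum_nonneg fun x _ => mul_nonneg (cwWeight_pos x).le (h x)

lemma cwSum_add (F G : Config n → ℝ) :
    cwSum β μ (fun x => F x + G x) = cwSum β μ F + cwSum β μ G := by
  simp [cwSum, mul_add, Finset.sum_add_distrib]

lemma cwSum_sub (F G : Config n → ℝ) :
    cwSum β μ (fun x => F x - G x) = cwSum β μ F - cwSum β μ G := by
  simp [cwSum, mul_sub, Finset.sum_sub_distrib]

lemma cwSum_const_mul (c : ℝ) (F : Config n → ℝ) :
    cwSum β μ (fun x => c * F x) = c * cwSum β μ F := by
  simp only [cwSum, Finset.mul_sum]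
  exact Finset.sum_congr rfl fun x _ => by ring

lemma cwSum_sum {ι : Type*} (s : Finset ι) (F : ι → Config n → ℝ) :
    cwSum β μ (fun x => ∑ i ∈ s, F i x) = ∑ i ∈ s, cwSum β μ (F i) := by
  simp only [cwSum, Finset.mul_sum]
  exact Finset.sum_comm

lemma cwMean_mono {F G : Config n → ℝ} (h : ∀ x, F x ≤ G x) : cwMean β μ F ≤ cwMean β μ G :=
  div_le_div_of_nonneg_right (cwSum_mono h) cwSum_one_pos.le

lemma cwMean_nonneg {F : Config n → ℝ} (h : ∀ x, 0 ≤ F x) : 0 ≤ cwMean β μ F :=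
  div_nonneg (cwSum_nonneg h) cwSum_one_pos.le

lemma cwMean_add (F G : Config n → ℝ) :
    cwMean β μ (fun x => F x + G x) = cwMean β μ F + cwMean β μ G := by
  simp [cwMean, cwSum_add, add_div]

lemma cwMean_sub (F G : Config n → ℝ) :
    cwMean β μ (fun x => F x - G x) = cwMean β μ F - cwMean β μ G := by
  simp [cwMean, cwSum_sub, sub_div]

lemma cwMean_const_mul (c : ℝ) (F : Config n → ℝ) :
    cwMean β μ (fun x => c * F x) = c * cwMean β μ F := by
  simp [cwMean, cwSum_const_mul, mul_div_assoc]

lemma cwMean_sum {ι : Type*} (s : Finset ι) (F : ι → Config n → ℝ) :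
    cwMean β μ (fun x => ∑ i ∈ s, F i x) = ∑ i ∈ s, cwMean β μ (F i) := by
  simp [cwMean, cwSum_sum, Finset.sum_div]

lemma cwMean_const (c : ℝ) : cwMean β μ (fun _ => c) = c := by
  have h := cwMean_const_mul (β := β) (μ := μ) c fun _ => 1
  simp only [mul_one] at h
  rw [h, cwMean, div_self cwSum_one_pos.ne', mul_one]

lemma cwSum_eq_mul_cwMean (F : Config n → ℝ) :
    cwSum β μ F = (cwSum β μ fun _ => 1) * cwMean β μ F := by
  rw [cwMean, mul_div_cancel₀ _ cwSum_one_pos.ne']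

lemma cwProb_nonneg (E : Set (Config n)) : 0 ≤ cwProb β μ E :=
  cwMean_nonneg fun x => Set.indicator_nonneg (fun _ _ => zero_le_one) x

lemma cwProb_mono {E E' : Set (Config n)} (h : E ⊆ E') : cwProb β μ E ≤ cwProb β μ E' :=
  cwMean_mono fun x => Set.indicator_le_indicator_of_subset h (fun _ => zero_le_one) x

lemma cwProb_le_one (E : Set (Config n)) : cwProb β μ E ≤ 1 := by
  refine (cwMean_mono (G := fun _ => 1) fun x => ?_).trans (cwMean_const 1).le
  exact Set.indicator_le_self' (fun _ _ => zero_le_one) x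

lemma cwProb_union_le (E E' : Set (Config n)) :
    cwProb β μ (E ∪ E') ≤ cwProb β μ E + cwProb β μ E' := by
  classical
  unfold cwProb
  rw [← cwMean_add]
  refine cwMean_mono fun x => ?_
  simp only [Set.indicator_apply, Set.mem_union, Pi.one_apply]
  by_cases h : x ∈ E <;> by_cases h' : x ∈ E' <;> simp [h, h']

lemma cwProb_biUnion_le {ι : Type*} (s : Finset ι) (E : ι → Set (Config n)) :
    cwProb β μ (⋃ i ∈ s, E i) ≤ ∑ i ∈ s, cwProb β μ (E i) := by
  classical
  induction s using Finset.induction_on with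
  | empty => simpa [cwProb] using (cwMean_const (β := β) (μ := μ) 0).le
  | insert i s hi ih =>
    rw [Finset.set_biUnion_insert, Finset.sum_insert hi]
    exact (cwProb_union_le _ _).trans (by gcongr)

/-- Markov's inequality. -/
lemma cwProb_le_of_indicator_le {E : Set (Config n)} {F : Config n → ℝ} (h0 : ∀ x, 0 ≤ F x)
    (h : ∀ x ∈ E, 1 ≤ F x) : cwProb β μ E ≤ cwMean β μ F := by
  classical
  refine cwMean_mono fun x => ?_
  by_cases hx : x ∈ E
  · simpa [hx] using h x hx
  · simpa [hx] using h0 x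

lemma sq_cwMean_le (F : Config n → ℝ) : cwMean β μ F ^ 2 ≤ cwMean β μ fun x => F x ^ 2 := by
  have h : 0 ≤ cwMean β μ fun x => (F x - cwMean β μ F) ^ 2 := cwMean_nonneg fun x => sq_nonneg _
  have e : (fun x => (F x - cwMean β μ F) ^ 2) =
      fun x => (F x ^ 2 - (2 * cwMean β μ F) * F x) + cwMean β μ F ^ 2 := by
    funext x; ring
  rw [e, cwMean_add, cwMean_sub, cwMean_const_mul, cwMean_const] at h
  nlinarith

lemma spin_sq (x : Config n) (i : Fin n) : spin x i ^ 2 = 1 := by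
  unfold spin
  rcases Int.units_eq_one_or (x i) with h | h <;> simp [h]

lemma spin_eq (x : Config n) (i : Fin n) : spin x i = 1 ∨ spin x i = -1 := by
  unfold spin
  rcases Int.units_eq_one_or (x i) with h | h <;> simp [h]

lemma abs_spin (x : Config n) (i : Fin n) : |spin x i| = 1 := by
  rcases spin_eq x i with h | h <;> simp [h]

/-- Including the diagonal of the interaction matrix changes the weights by a constant factor. -/
lemma weight_curieWeiss (hn : 1 ≤ n) (β : ℝ) (μ : Fin n → ℝ) (x : Config n) :
    weight β (curieWeiss n) μ x = Real.exp (-(β / 2)) * cwWeight β μ x := by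
  have hn' : (n : ℝ) ≠ 0 := by positivity
  have hQ : spin x ⬝ᵥ (curieWeiss n).mulVec (spin x) = (mag x ^ 2 - n) / n := by
    have h1 : ∀ i, (curieWeiss n).mulVec (spin x) i = (mag x - spin x i) / n := by
      intro i
      simp only [Matrix.mulVec, dotProduct, curieWeiss, Matrix.of_apply, mag, blockSum]
      rw [← Finset.sum_erase_eq_sub (Finset.mem_univ i), Finset.sum_div,
        ← Finset.add_sum_erase _ _ (Finset.mem_univ i)]
      simp only [ne_eq, not_true_eq_false, if_false, zero_mul, zero_add]
      refine Finset.sum_congr rfl fun j hj => ?_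
      rw [if_pos (Finset.ne_of_mem_erase hj).symm]
      ring
    simp only [dotProduct, h1]
    have h2 : ∀ i, spin x i * ((mag x - spin x i) / n) = spin x i * (mag x / n) - 1 / n := by
      intro i
      have := spin_sq x i
      field_simp
      linarith
    simp only [h2, Finset.sum_sub_distrib, ← Finset.sum_mul]
    rw [show ∑ i, spin x i = mag x from rfl]
    simp
    field_simp
  unfold weight cwWeight
  rw [hQ, ← Real.exp_add]
  congr 1
  simp only [dotProduct]
  field_simp
  ring

lemma isingProb_curieWeiss (hn : 1 ≤ n) (β : ℝ) (μ : Fin n → ℝ) (E : Set (Config n)) :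
    isingProb β (curieWeiss n) μ E = cwProb β μ E := by
  classical
  have hZ : partitionFunction β (curieWeiss n) μ =
      Real.exp (-(β / 2)) * cwSum β μ fun _ => 1 := by
    simp [partitionFunction, weight_curieWeiss hn, cwSum, Finset.mul_sum]
  unfold isingProb cwProb cwMean
  rw [hZ, show cwSum β μ (E.indicator 1) = ∑ x, cwWeight β μ x * E.indicator 1 x from rfl,
    Finset.sum_div]
  refine Finset.sum_congr rfl fun x _ => ?_
  by_cases hx : x ∈ E
  · rw [if_pos hx, weight_curieWeiss hn, Set.indicator_of_mem hx,
      mul_div_mul_left _ _ (Real.exp_pos _).ne']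
    simp
  · simp [hx]

/-- Adding a field is the same as tilting by the corresponding exponential. -/
lemma cwSum_add_field (ν : Fin n → ℝ) (F : Config n → ℝ) :
    cwSum β (fun i => μ i + ν i) F =
      cwSum β μ fun x => Real.exp (∑ i, ν i * spin x i) * F x := by
  unfold cwSum cwWeight
  refine Finset.sum_congr rfl fun x _ => ?_
  rw [← mul_assoc, ← Real.exp_add]
  simp only [add_mul, Finset.sum_add_distrib, add_assoc]

/-- The partition function of a product measure. -/
lemma cwSum_zero_one (ν : Fin n → ℝ) :
    (cwSum 0 ν fun _ => 1) = ∏ i, (2 * Real.cosh (ν i)) := by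
  have h : ∀ i, 2 * Real.cosh (ν i) = ∑ u : ℤˣ, Real.exp (ν i * ((u : ℤ) : ℝ)) := by
    intro i
    rw [show (Finset.univ : Finset ℤˣ) = {1, -1} from rfl, Finset.sum_pair (by decide)]
    simp [Real.cosh_eq]
    ring
  simp only [h, Finset.prod_univ_sum, Fintype.piFinset_univ]
  unfold cwSum cwWeight
  refine Finset.sum_congr rfl fun x _ => ?_
  simp [Real.exp_sum, spin]

lemma cwMean_zero_exp (μ ν : Fin n → ℝ) :
    cwMean 0 μ (fun x => Real.exp (∑ i, ν i * spin x i)) =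
      ∏ i, (Real.cosh (μ i + ν i) / Real.cosh (μ i)) := by
  have h := cwSum_add_field (β := 0) (μ := μ) ν fun _ => 1
  simp only [mul_one] at h
  rw [cwMean, ← h, cwSum_zero_one, cwSum_zero_one, ← Finset.prod_div_distrib]
  exact Finset.prod_congr rfl fun i _ => mul_div_mul_left _ _ two_ne_zero

end Expectations

/-! ### Conditional means given the other spins -/

section Conditional

variable {n : ℕ} {β : ℝ} {μ : Fin n → ℝ}

/-- The configuration with the spin at `i` reversed. -/
def flipAt (i : Fin n) (x : Config n) : Config n := Function.update x i (-x i)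

lemma spin_flipAt_self (i : Fin n) (x : Config n) : spin (flipAt i x) i = -spin x i := by
  simp [spin, flipAt]

lemma spin_flipAt_of_ne {i j : Fin n} (h : j ≠ i) (x : Config n) :
    spin (flipAt i x) j = spin x j := by
  simp [spin, flipAt, h]

lemma flipAt_flipAt (i : Fin n) (x : Config n) : flipAt i (flipAt i x) = x := by
  simp [flipAt]

lemma sum_flipAt (i : Fin n) (F : Config n → ℝ) : ∑ x, F (flipAt i x) = ∑ x, F x :=
  Equiv.sum_comp (Function.Involutive.toPerm (flipAt i) (flipAt_flipAt i)) F

lemma mag_flipAt (i : Fin n) (x : Config n) : mag (flipAt i x) = mag x - 2 * spin x i := by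
  unfold mag blockSum
  rw [← Finset.add_sum_erase _ _ (Finset.mem_univ i),
    ← Finset.add_sum_erase _ (fun j => spin x j) (Finset.mem_univ i), spin_flipAt_self]
  rw [Finset.sum_congr rfl fun j hj => spin_flipAt_of_ne (Finset.ne_of_mem_erase hj) x]
  ring

/-- The conditional mean of the spin at `i` given all other spins. -/
noncomputable def condMean (β : ℝ) (μ : Fin n → ℝ) (i : Fin n) (x : Config n) : ℝ :=
  Real.tanh (μ i + β / n * (mag x - spin x i))

/-- The difference of a spin and its conditional mean is orthogonal to every function of the other
spins. -/
lemma cwSum_sub_condMean_mul (i : Fin n) (F : Config n → ℝ) (hF : ∀ x, F (flipAt i x) = F x) :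
    cwSum β μ (fun x => (spin x i - condMean β μ i x) * F x) = 0 := by
  set f : Config n → ℝ := fun x => cwWeight β μ x * ((spin x i - condMean β μ i x) * F x) with hf
  have key : ∀ x, f x + f (flipAt i x) = 0 := by
    intro x
    have hm : mag (flipAt i x) - spin (flipAt i x) i = mag x - spin x i := by
      rw [mag_flipAt, spin_flipAt_self]; ring
    have hc : condMean β μ i (flipAt i x) = condMean β μ i x := by
      unfold condMean; rw [hm]
    set h := μ i + β / n * (mag x - spin x i) with hh
    set K := β / (2 * n) * (1 + (mag x - spin x i) ^ 2) +
      ∑ j ∈ Finset.univ.erase i, μ j * spin x j with hK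
    have w1 : cwWeight β μ x = Real.exp (K + h * spin x i) := by
      unfold cwWeight
      congr 1
      rw [← Finset.add_sum_erase _ _ (Finset.mem_univ i), hK, hh]
      have := spin_sq x i
      rcases eq_or_ne (n : ℝ) 0 with hn | hn
      · simp [hn]
      · field_simp
        linear_combination β * this
    have w2 : cwWeight β μ (flipAt i x) = Real.exp (K - h * spin x i) := by
      unfold cwWeight
      congr 1
      rw [← Finset.add_sum_erase _ _ (Finset.mem_univ i), spin_flipAt_self, mag_flipAt,
        Finset.sum_congr rfl fun j hj => by
          rw [spin_flipAt_of_ne (Finset.ne_of_mem_erase hj)], hK, hh]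
      have := spin_sq x i
      rcases eq_or_ne (n : ℝ) 0 with hn | hn
      · simp [hn]; try ring
      · field_simp
        linear_combination β * this
    simp only [hf]
    rw [hF, hc, spin_flipAt_self, show condMean β μ i x = Real.tanh h from rfl,
      Real.tanh_eq_sinh_div_cosh]
    have hcp := (Real.cosh_pos h).ne'
    clear_value h K
    rw [Real.exp_add] at w1
    rw [sub_eq_add_neg, Real.exp_add] at w2
    rw [w1, w2]
    have e1 := (Real.cosh_add_sinh h).symm
    have e2 := (Real.cosh_sub_sinh h).symm
    rcases spin_eq x i with hs | hs <;> rw [hs] <;> simp only [mul_one, mul_neg, neg_neg, e1, e2] <;>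
      field_simp <;> ring
  have h2 : ∑ x, f x + ∑ x, f (flipAt i x) = 0 := by
    rw [← Finset.sum_add_distrib]
    exact Finset.sum_eq_zero fun x _ => key x
  rw [sum_flipAt] at h2
  show ∑ x, f x = 0
  linarith

end Conditional

/-! ### Hyperbolic functions -/

section Hyperbolic

lemma hasDerivAt_tanh (x : ℝ) : HasDerivAt Real.tanh (1 - Real.tanh x ^ 2) x := by
  have h := (Real.hasDerivAt_sinh x).div (Real.hasDerivAt_cosh x) (Real.cosh_pos x).ne'
  have e : (Real.sinh / Real.cosh) = Real.tanh := by
    funext y; simp [Real.tanh_eq_sinh_div_cosh]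
  rw [e] at h
  refine h.congr_deriv ?_
  have := (Real.cosh_pos x).ne'
  rw [Real.tanh_eq_sinh_div_cosh]
  field_simp

lemma tanh_sq_lt_one (x : ℝ) : Real.tanh x ^ 2 < 1 := by
  have hc := Real.cosh_pos x
  rw [Real.tanh_eq_sinh_div_cosh, div_pow, div_lt_one (by positivity)]
  linarith [Real.cosh_sq x]

lemma tanh_strictMono : StrictMono Real.tanh :=
  strictMono_of_deriv_pos fun x => by
    rw [(hasDerivAt_tanh x).deriv]; linarith [tanh_sq_lt_one x]

lemma abs_tanh_sub_tanh_le (x y : ℝ) : |Real.tanh x - Real.tanh y| ≤ |x - y| := by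
  have h := Convex.norm_image_sub_le_of_norm_hasDerivWithin_le (f := Real.tanh)
    (f' := fun x => 1 - Real.tanh x ^ 2) (C := 1) (s := Set.univ) (x := y) (y := x)
    (fun z _ => (hasDerivAt_tanh z).hasDerivWithinAt)
    (fun z _ => by
      rw [Real.norm_eq_abs, abs_of_nonneg (by linarith [tanh_sq_lt_one z])]
      linarith [sq_nonneg (Real.tanh z)]) convex_univ (Set.mem_univ _) (Set.mem_univ _)
  simpa using h

lemma abs_tanh_le (x : ℝ) : |Real.tanh x| ≤ |x| := by
  simpa using abs_tanh_sub_tanh_le x 0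

lemma abs_tanh_sq_sub_tanh_sq_le (x y : ℝ) :
    |Real.tanh x ^ 2 - Real.tanh y ^ 2| ≤ 2 * |x - y| := by
  rw [show Real.tanh x ^ 2 - Real.tanh y ^ 2 =
    (Real.tanh x + Real.tanh y) * (Real.tanh x - Real.tanh y) by ring, abs_mul]
  have h1 : |Real.tanh x + Real.tanh y| ≤ 2 :=
    (abs_add_le _ _).trans (by linarith [Real.abs_tanh_lt_one x, Real.abs_tanh_lt_one y])
  exact mul_le_mul h1 (abs_tanh_sub_tanh_le x y) (abs_nonneg _) zero_le_two

lemma le_of_hasDerivAt_nonneg {f f' : ℝ → ℝ} {a b : ℝ} (hab : a ≤ b)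
    (hf : ∀ x, HasDerivAt f (f' x) x) (h : ∀ x, a < x → x < b → 0 ≤ f' x) : f a ≤ f b := by
  have hm : MonotoneOn f (Set.Icc a b) := by
    refine monotoneOn_of_deriv_nonneg (convex_Icc a b)
      (fun x _ => (hf x).continuousAt.continuousWithinAt)
      (fun x _ => (hf x).differentiableAt.differentiableWithinAt) fun x hx => ?_
    rw [interior_Icc] at hx
    rw [(hf x).deriv]
    exact h x hx.1 hx.2
  exact hm (Set.left_mem_Icc.2 hab) (Set.right_mem_Icc.2 hab) hab

lemma le_tanh_add {u : ℝ} (hu : 0 ≤ u) (z : ℝ) :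
    Real.tanh z + u * (1 - Real.tanh z ^ 2 - 2 * u) ≤ Real.tanh (z + u) := by
  have h := le_of_hasDerivAt_nonneg (f := fun v => Real.tanh (z + v) -
      (1 - Real.tanh z ^ 2 - 2 * u) * v) (f' := fun v => (1 - Real.tanh (z + v) ^ 2) -
      (1 - Real.tanh z ^ 2 - 2 * u)) hu
    (fun v => by
      have h1 := (hasDerivAt_tanh (z + v)).comp_const_add z v
      have h2 := (hasDerivAt_id v).const_mul (1 - Real.tanh z ^ 2 - 2 * u)
      exact (h1.fun_sub h2).congr_deriv (by simp))
    (fun v hv hvu => by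
      have := (abs_le.1 (abs_tanh_sq_sub_tanh_sq_le (z + v) z)).2
      rw [show z + v - z = v by ring, abs_of_pos hv] at this
      linarith)
  simp only [add_zero, mul_zero, sub_zero] at h
  linarith

lemma tanh_add_le {u : ℝ} (hu : 0 ≤ u) (z : ℝ) :
    Real.tanh (z + u) ≤ Real.tanh z + u * (1 - Real.tanh z ^ 2 + 2 * u) := by
  have h := le_of_hasDerivAt_nonneg (f := fun v => (1 - Real.tanh z ^ 2 + 2 * u) * v -
      Real.tanh (z + v)) (f' := fun v => (1 - Real.tanh z ^ 2 + 2 * u) -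
      (1 - Real.tanh (z + v) ^ 2)) hu
    (fun v => by
      have h1 := (hasDerivAt_tanh (z + v)).comp_const_add z v
      have h2 := (hasDerivAt_id v).const_mul (1 - Real.tanh z ^ 2 + 2 * u)
      exact (h2.fun_sub h1).congr_deriv (by simp))
    (fun v hv hvu => by
      have := (abs_le.1 (abs_tanh_sq_sub_tanh_sq_le (z + v) z)).1
      rw [show z + v - z = v by ring, abs_of_pos hv] at this
      linarith)
  simp only [add_zero, mul_zero] at h
  linarith

/-- The cumulant generating function of a symmetric sign. -/
noncomputable def logCosh (z : ℝ) : ℝ := Real.log (Real.cosh z)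

lemma exp_logCosh (z : ℝ) : Real.exp (logCosh z) = Real.cosh z := Real.exp_log (Real.cosh_pos z)

lemma logCosh_neg (z : ℝ) : logCosh (-z) = logCosh z := by simp [logCosh]

lemma logCosh_abs (z : ℝ) : logCosh |z| = logCosh z := by simp [logCosh]

lemma hasDerivAt_logCosh (z : ℝ) : HasDerivAt logCosh (Real.tanh z) z := by
  have h := (Real.hasDerivAt_cosh z).log (Real.cosh_pos z).ne'
  rwa [← Real.tanh_eq_sinh_div_cosh] at h

/-- Second order expansion of `log cosh`, with the error term of third order explicit. -/
lemma logCosh_add_le (z u : ℝ) :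
    logCosh (z + u) ≤
      logCosh z + u * Real.tanh z + u ^ 2 / 2 * (1 - Real.tanh z ^ 2 + 2 * |u|) := by
  have main : ∀ z u : ℝ, 0 ≤ u → logCosh (z + u) ≤
      logCosh z + u * Real.tanh z + u ^ 2 / 2 * (1 - Real.tanh z ^ 2 + 2 * u) := by
    intro z u hu
    have h := le_of_hasDerivAt_nonneg
      (f := fun v => v * Real.tanh z + v ^ 2 / 2 * (1 - Real.tanh z ^ 2 + 2 * u) -
        logCosh (z + v))
      (f' := fun v => (Real.tanh z + v * (1 - Real.tanh z ^ 2 + 2 * u)) - Real.tanh (z + v)) hu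
      (fun v => by
        have h1 := (hasDerivAt_logCosh (z + v)).comp_const_add z v
        have h2 := ((hasDerivAt_id v).mul_const (Real.tanh z)).fun_add
          ((((hasDerivAt_id v).fun_pow 2).div_const 2).mul_const (1 - Real.tanh z ^ 2 + 2 * u))
        exact (h2.fun_sub h1).congr_deriv (by simp))
      (fun v hv hvu => by
        have := tanh_add_le hv.le z
        nlinarith)
    simp only [add_zero, zero_mul] at h
    norm_num at h
    linarith
  rcases le_total 0 u with hu | hu
  · simpa [abs_of_nonneg hu] using main z u hu
  · have h := main (-z) (-u) (by linarith)
    rw [show -z + -u = -(z + u) by ring, logCosh_neg, logCosh_neg, Real.tanh_neg] at h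
    rw [abs_of_nonpos hu]
    simpa using h

/-- `log cosh` lies above its tangents. -/
lemma le_logCosh_add (z u : ℝ) : logCosh z + u * Real.tanh z ≤ logCosh (z + u) := by
  have main : ∀ z u : ℝ, 0 ≤ u → logCosh z + u * Real.tanh z ≤ logCosh (z + u) := by
    intro z u hu
    have h := le_of_hasDerivAt_nonneg (f := fun v => logCosh (z + v) - v * Real.tanh z)
      (f' := fun v => Real.tanh (z + v) - Real.tanh z) hu
      (fun v => by
        have h1 := (hasDerivAt_logCosh (z + v)).comp_const_add z v
        have h2 := (hasDerivAt_id v).mul_const (Real.tanh z)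
        exact (h1.fun_sub h2).congr_deriv (by simp))
      (fun v hv _ => by
        have := tanh_strictMono.monotone (show z ≤ z + v by linarith)
        linarith)
    simp only [add_zero, zero_mul] at h
    linarith
  rcases le_total 0 u with hu | hu
  · exact main z u hu
  · have h := main (-z) (-u) (by linarith)
    rw [show -z + -u = -(z + u) by ring, logCosh_neg, logCosh_neg, Real.tanh_neg] at h
    linarith

lemma logCosh_le_half_sq (z : ℝ) : logCosh z ≤ z ^ 2 / 2 :=
  (Real.log_le_iff_le_exp (Real.cosh_pos z)).2 (Real.cosh_le_exp_half_sq z)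

lemma logCosh_nonneg (z : ℝ) : 0 ≤ logCosh z := Real.log_nonneg (Real.one_le_cosh z)

end Hyperbolic

/-! ### The mean-field equation -/

section MeanField

lemma exists_one_sub_tanh_sq_eq {β a b : ℝ} (hab : a < b) (ha : Real.tanh a = a / β)
    (hb : Real.tanh b = b / β) : ∃ c ∈ Set.Ioo a b, 1 - Real.tanh c ^ 2 = 1 / β := by
  obtain ⟨c, hc, h⟩ := exists_hasDerivAt_eq_zero (f := fun z => Real.tanh z - z / β)
    (f' := fun z => (1 - Real.tanh z ^ 2) - 1 / β) hab
    (fun z _ => ((hasDerivAt_tanh z).sub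
      ((hasDerivAt_id z).div_const β)).continuousAt.continuousWithinAt)
    (by simp [ha, hb]) (fun z _ => (hasDerivAt_tanh z).sub ((hasDerivAt_id z).div_const β))
  exact ⟨c, hc, by linarith⟩

lemma tanh_sq_lt_tanh_sq {a b : ℝ} (ha : 0 ≤ a) (hab : a < b) :
    Real.tanh a ^ 2 < Real.tanh b ^ 2 := by
  have h := tanh_strictMono hab
  have h0 : 0 ≤ Real.tanh a := by simpa using tanh_strictMono.monotone ha
  nlinarith

lemma IsPosRoot.tanh_eq {β m : ℝ} (h : IsPosRoot β m) : Real.tanh (β * m) = m := h.2.symm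

/-- At a positive root the effective inverse temperature `β (1 - m²)` is less than `1`. -/
lemma IsPosRoot.one_sub_sq_lt {β m : ℝ} (hβ : 1 < β) (h : IsPosRoot β m) : 1 - m ^ 2 < 1 / β := by
  have hb : 0 < β * m := mul_pos (by linarith) h.1
  obtain ⟨c, hc, e⟩ := exists_one_sub_tanh_sq_eq (β := β) hb (by simp) (by
    rw [h.tanh_eq]; field_simp)
  rw [← e]
  have := tanh_sq_lt_tanh_sq hc.1.le hc.2
  rw [h.tanh_eq] at this
  linarith

theorem existsUnique_isPosRoot {β : ℝ} (hβ : 1 < β) : ∃! m : ℝ, IsPosRoot β m := by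
  have hβ0 : 0 < β := by linarith
  have hd : 0 < 1 - 1 / β := by rw [sub_pos, div_lt_one hβ0]; exact hβ
  have hd1 : 1 - 1 / β < 1 := by linarith [one_div_pos.2 hβ0]
  set z₀ := (1 - 1 / β) / 4 with hz
  have hz0 : 0 < z₀ := by positivity
  have hcont : ContinuousOn (fun z => Real.tanh z - z / β) (Set.Icc z₀ β) := fun z _ =>
    ((hasDerivAt_tanh z).sub ((hasDerivAt_id z).div_const β)).continuousAt.continuousWithinAt
  have h1 : 0 ≤ Real.tanh z₀ - z₀ / β := by
    have := le_tanh_add hz0.le 0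
    simp only [Real.tanh_zero, zero_add] at this
    have e : z₀ / β = z₀ * (1 / β) := by ring
    nlinarith
  have h2 : Real.tanh β - β / β ≤ 0 := by
    rw [div_self hβ0.ne']
    linarith [(abs_lt.1 (Real.abs_tanh_lt_one β)).2]
  obtain ⟨z, hz, h⟩ := intermediate_value_Icc' (by linarith) hcont ⟨h2, h1⟩
  have hzp : 0 < z := hz0.trans_le hz.1
  refine ⟨z / β, ⟨by positivity, ?_⟩, fun m hm => ?_⟩
  · rw [mul_div_cancel₀ _ hβ0.ne']
    simp only at h
    linarith
  · by_contra hne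
    have hm' : Real.tanh (β * m) = β * m / β := by rw [hm.tanh_eq]; field_simp
    have hz' : Real.tanh z = z / β := by simp only at h; linarith
    have hbm : 0 < β * m := mul_pos hβ0 hm.1
    have key : ∀ a b : ℝ, 0 < a → a < b → Real.tanh a = a / β → Real.tanh b = b / β → False := by
      intro a b ha hab ea eb
      obtain ⟨c, hc, e⟩ := exists_one_sub_tanh_sq_eq (β := β) ha (by simp) ea
      obtain ⟨d, hd, e'⟩ := exists_one_sub_tanh_sq_eq hab ea eb
      have := tanh_sq_lt_tanh_sq hc.1.le (hc.2.trans hd.1)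
      linarith
    rcases lt_trichotomy (β * m) z with hlt | heq | hgt
    · exact key _ _ hbm hlt hm' hz'
    · exact hne (by rw [← heq]; field_simp)
    · exact key _ _ hzp hgt hz' hm'

end MeanField

/-! ### Concentration around conditional means -/

section Concentration

variable {n : ℕ} {β : ℝ} {μ : Fin n → ℝ}

lemma abs_spin_sub_condMean_le (i : Fin n) (x : Config n) : |spin x i - condMean β μ i x| ≤ 2 := by
  refine (abs_sub _ _).trans ?_
  rw [abs_spin]
  unfold condMean
  linarith [Real.abs_tanh_lt_one (μ i + β / n * (mag x - spin x i))]

/-- The sum of `x i - E[x i | x j, j ≠ i]` over a block has second moment of the order of the block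
size, for every temperature and every external field. -/
theorem cwMean_sq_sum_sub_condMean_le (hn : 1 ≤ n) (S : Finset (Fin n)) :
    cwMean β μ (fun x => (∑ i ∈ S, (spin x i - condMean β μ i x)) ^ 2) ≤
      (4 + 2 * |β|) * S.card := by
  have hn' : (0 : ℝ) < n := by positivity
  have off : ∀ i j : Fin n, i ≠ j → cwMean β μ (fun x =>
      (spin x i - condMean β μ i x) * (spin x j - condMean β μ j x)) ≤ 2 * (|β| / n) := by
    intro i j hij
    -- the centred spin at `j` is replaced by a version that does not depend on the spin at `i`
    set G : Config n → ℝ := fun x =>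
      spin x j - Real.tanh (μ j + β / n * (mag x - spin x j - spin x i)) with hG
    have hGf : ∀ x, G (flipAt i x) = G x := by
      intro x
      simp only [hG, mag_flipAt, spin_flipAt_self, spin_flipAt_of_ne hij.symm]
      ring_nf
    have h0 : cwMean β μ (fun x => (spin x i - condMean β μ i x) * G x) = 0 := by
      rw [cwMean, cwSum_sub_condMean_mul i G hGf, zero_div]
    rw [← sub_zero (cwMean β μ fun x => (spin x i - condMean β μ i x) *
      (spin x j - condMean β μ j x)), ← h0, ← cwMean_sub]
    refine (cwMean_mono (G := fun _ => 2 * (|β| / n)) fun x => ?_).trans (cwMean_const _).le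
    rw [← mul_sub]
    refine (le_abs_self _).trans ?_
    rw [abs_mul]
    refine mul_le_mul (abs_spin_sub_condMean_le i x) ?_ (abs_nonneg _) zero_le_two
    simp only [hG, condMean]
    rw [show ∀ a b c : ℝ, a - b - (a - c) = c - b by intros; ring]
    refine (abs_tanh_sub_tanh_le _ _).trans ?_
    rw [show μ j + β / n * (mag x - spin x j - spin x i) - (μ j + β / n * (mag x - spin x j)) =
      -(β / n * spin x i) by ring, abs_neg, abs_mul, abs_spin, abs_div, mul_one,
      abs_of_pos hn']
  have diag : ∀ i : Fin n, cwMean β μ (fun x =>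
      (spin x i - condMean β μ i x) * (spin x i - condMean β μ i x)) ≤ 4 := by
    intro i
    refine (cwMean_mono (G := fun _ => 4) fun x => ?_).trans (cwMean_const _).le
    have := abs_le.1 (abs_spin_sub_condMean_le (β := β) (μ := μ) i x)
    nlinarith
  simp only [sq, Finset.sum_mul_sum, cwMean_sum]
  calc ∑ i ∈ S, ∑ j ∈ S, cwMean β μ (fun x =>
        (spin x i - condMean β μ i x) * (spin x j - condMean β μ j x))
      ≤ ∑ i ∈ S, ∑ j ∈ S, ((if i = j then 4 else 0) + 2 * (|β| / n)) := by
        refine Finset.sum_le_sum fun i _ => Finset.sum_le_sum fun j _ => ?_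
        have hb : 0 ≤ 2 * (|β| / n) := by positivity
        split_ifs with h
        · subst h; linarith [diag i]
        · linarith [off i j h]
    _ = 4 * S.card + 2 * |β| * S.card * (S.card / n) := by
        simp only [Finset.sum_add_distrib, Finset.sum_ite_eq, Finset.sum_const, nsmul_eq_mul]
        simp
        field_simp
    _ ≤ (4 + 2 * |β|) * S.card := by
        have h1 : (S.card : ℝ) / n ≤ 1 := by
          rw [div_le_one hn']
          exact_mod_cast (Finset.card_le_univ S).trans (by simp)
        have h2 : 0 ≤ 2 * |β| * S.card := by positivity
        nlinarith

lemma cwProb_abs_sum_sub_condMean_ge_le (hn : 1 ≤ n) (S : Finset (Fin n)) {t : ℝ} (ht : 0 < t) :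
    cwProb β μ {x | t ≤ |∑ i ∈ S, (spin x i - condMean β μ i x)|} ≤
      (4 + 2 * |β|) * S.card / t ^ 2 := by
  have h := cwProb_le_of_indicator_le (β := β) (μ := μ)
    (E := {x | t ≤ |∑ i ∈ S, (spin x i - condMean β μ i x)|})
    (F := fun x => (t ^ 2)⁻¹ * (∑ i ∈ S, (spin x i - condMean β μ i x)) ^ 2)
    (fun x => by positivity) (fun x hx => by
      rw [inv_mul_eq_div, one_le_div (by positivity), ← sq_abs (∑ i ∈ S, _)]
      exact pow_le_pow_left₀ ht.le hx 2)
  rw [cwMean_const_mul] at h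
  refine h.trans ?_
  rw [inv_mul_eq_div]
  exact div_le_div_of_nonneg_right (cwMean_sq_sum_sub_condMean_le hn S) (by positivity)

/-- Chebyshev's inequality for block sums of independent spins. -/
lemma cwProb_zero_abs_blockSum_ge_le (hn : 1 ≤ n) (S : Finset (Fin n)) {t : ℝ} (ht : 0 < t) :
    cwProb 0 μ {x | t ≤ |blockSum S x - ∑ i ∈ S, Real.tanh (μ i)|} ≤ 4 * S.card / t ^ 2 := by
  have h := cwProb_abs_sum_sub_condMean_ge_le (β := 0) (μ := μ) hn S ht
  simpa [condMean, blockSum, Finset.sum_sub_distrib] using h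

end Concentration

/-! ### Block sums of independent spins -/

section Product

variable {n : ℕ} {β : ℝ}

/-- The external field of strength `A` on the block `S`. -/
noncomputable def blockField (A : ℝ) (S : Finset (Fin n)) : Fin n → ℝ :=
  fun i => if i ∈ S then A else 0

lemma sum_blockField_mul (A : ℝ) (S : Finset (Fin n)) (x : Config n) :
    ∑ i, blockField A S i * spin x i = A * blockSum S x := by
  simp [blockField, blockSum, Finset.mul_sum, Finset.sum_ite_mem]

lemma cwSum_add_blockField (μ : Fin n → ℝ) (A : ℝ) (S : Finset (Fin n)) (F : Config n → ℝ) :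
    cwSum β (fun i => μ i + blockField A S i) F =
      cwSum β μ fun x => Real.exp (A * blockSum S x) * F x := by
  simp only [cwSum_add_field, sum_blockField_mul]

/-- The factor by which a field `A` on one spin changes the partition function of a spin with
field `z`. -/
noncomputable def tiltRatio (A z : ℝ) : ℝ := Real.cosh (z + A) / Real.cosh z

lemma tiltRatio_pos (A z : ℝ) : 0 < tiltRatio A z := div_pos (Real.cosh_pos _) (Real.cosh_pos _)

lemma tiltRatio_eq_exp (A z : ℝ) : tiltRatio A z = Real.exp (logCosh (z + A) - logCosh z) := by
  rw [Real.exp_sub, exp_logCosh, exp_logCosh, tiltRatio]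

lemma tiltRatio_pow_eq_exp (A z : ℝ) (s : ℕ) :
    tiltRatio A z ^ s = Real.exp (s * (logCosh (z + A) - logCosh z)) := by
  rw [tiltRatio_eq_exp, ← Real.exp_nat_mul]

lemma cwMean_zero_exp_blockSum (z A : ℝ) (S : Finset (Fin n)) :
    cwMean 0 (fun _ => z) (fun x => Real.exp (A * blockSum S x)) = tiltRatio A z ^ S.card := by
  have h := cwMean_zero_exp (fun _ => z) (blockField A S)
  simp only [sum_blockField_mul] at h
  rw [h, ← Finset.prod_subset (Finset.subset_univ S), Finset.prod_congr rfl
    (g := fun _ => tiltRatio A z), Finset.prod_const]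
  · intro i hi
    simp [blockField, hi, tiltRatio]
  · intro i _ hi
    simp [blockField, hi, (Real.cosh_pos z).ne']

/-- Chernoff's bound. -/
lemma cwProb_zero_blockSum_ge_le (z a : ℝ) {u : ℝ} (hu : 0 ≤ u) (S : Finset (Fin n)) :
    cwProb 0 (fun _ => z) {x | a ≤ blockSum S x} ≤
      Real.exp (-u * a + S.card * (logCosh (z + u) - logCosh z)) := by
  have h := cwProb_le_of_indicator_le (β := 0) (μ := fun _ : Fin n => z)
    (E := {x | a ≤ blockSum S x})
    (F := fun x => Real.exp (-u * a) * Real.exp (u * blockSum S x))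
    (fun x => by positivity) (fun x hx => by
      rw [← Real.exp_add]
      refine Real.one_le_exp ?_
      have : u * a ≤ u * blockSum S x := mul_le_mul_of_nonneg_left hx hu
      linarith)
  rwa [cwMean_const_mul, cwMean_zero_exp_blockSum, tiltRatio_pow_eq_exp, ← Real.exp_add] at h

lemma cwMean_zero_tilt (z A : ℝ) (S : Finset (Fin n)) (F : Config n → ℝ) :
    cwMean 0 (fun _ => z) (fun x => Real.exp (A * blockSum S x) * F x) =
      tiltRatio A z ^ S.card * cwMean 0 (fun i => z + blockField A S i) F := by
  rw [← cwMean_zero_exp_blockSum, cwMean, cwMean, cwMean, cwSum_add_blockField,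
    cwSum_add_blockField]
  simp only [mul_one]
  have h1 := (cwSum_one_pos (β := 0) (μ := fun _ : Fin n => z)).ne'
  have h2 : (cwSum 0 (fun _ : Fin n => z) fun x => Real.exp (A * blockSum S x)) ≠ 0 := by
    have := (cwSum_one_pos (β := 0) (μ := fun i : Fin n => z + blockField A S i)).ne'
    rw [cwSum_add_blockField] at this
    simpa using this
  field_simp

/-- The average over the blocks `S` in a family of the likelihood ratios between spins with field
`z + A` on `S`, `z` elsewhere, and spins with field `z`; the blocks have size `s`. -/
noncomputable def avgLR (C : Finset (Finset (Fin n))) (s : ℕ) (A z : ℝ) (x : Config n) : ℝ :=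
  (∑ S ∈ C, Real.exp (A * blockSum S x)) / (C.card * tiltRatio A z ^ s)

/-- The mean of `(1 - L)⁺` under the product measure with field `z`, where `L` is the averaged
likelihood ratio. For a nonempty family of blocks of size `s` it is the total variation distance
between this product measure and the mixture of the alternatives. -/
noncomputable def deficit (C : Finset (Finset (Fin n))) (s : ℕ) (A z : ℝ) : ℝ :=
  cwMean 0 (fun _ => z) fun x => max 0 (1 - avgLR C s A z x)

lemma deficit_nonneg (C : Finset (Finset (Fin n))) (s : ℕ) (A z : ℝ) : 0 ≤ deficit C s A z :=
  cwMean_nonneg fun _ => le_max_left _ _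

lemma avgLR_nonneg (C : Finset (Finset (Fin n))) (s : ℕ) (A z : ℝ) (x : Config n) :
    0 ≤ avgLR C s A z x := by
  have := tiltRatio_pos A z
  unfold avgLR
  positivity

/-- Truncated second moment bound. The likelihood ratio of each block is cut off where the block
sum exceeds its mean under the alternative by `d`. Disjoint blocks are independent, so that only the
diagonal of the second moment contributes beyond the square of the mean. -/
theorem deficit_sq_le (hn : 1 ≤ n) {C : Finset (Finset (Fin n))} {s : ℕ} {A d : ℝ} (z : ℝ)
    (hC : C.Nonempty) (hcard : ∀ S ∈ C, S.card = s)
    (hdisj : (C : Set (Finset (Fin n))).PairwiseDisjoint id) (hA : 0 ≤ A) (hd : 0 < d) :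
    deficit C s A z ^ 2 ≤ 8 * s / d ^ 2 + Real.exp (-Real.log C.card + A * d +
      s * (A ^ 2 / 2 * (1 - Real.tanh (z + A) ^ 2 + 2 * A))) := by
  classical
  set a := tiltRatio A z ^ s with ha
  have ha0 : 0 < a := pow_pos (tiltRatio_pos A z) s
  set T := s * Real.tanh (z + A) + d with hT
  set E : (Config n → ℝ) → ℝ := cwMean 0 (fun _ => z) with hE
  set X : Finset (Fin n) → Config n → ℝ := fun S x =>
    a⁻¹ * (Real.exp (A * blockSum S x) * Set.indicator {x | blockSum S x ≤ T} 1 x) with hX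
  have hN : (0 : ℝ) < C.card := by exact_mod_cast hC.card_pos
  have hind : ∀ S x, 0 ≤ Set.indicator {x : Config n | blockSum S x ≤ T} (1 : Config n → ℝ) x ∧
      Set.indicator {x : Config n | blockSum S x ≤ T} (1 : Config n → ℝ) x ≤ 1 := by
    intro S x
    by_cases h : blockSum S x ≤ T <;> simp [h]
  have hX0 : ∀ S x, 0 ≤ X S x := fun S x =>
    mul_nonneg (inv_nonneg.2 ha0.le) (mul_nonneg (Real.exp_pos _).le (hind S x).1)
  have hXle : ∀ S x, X S x ≤ a⁻¹ * Real.exp (A * blockSum S x) := fun S x =>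
    mul_le_mul_of_nonneg_left (mul_le_of_le_one_right (Real.exp_pos _).le (hind S x).2)
      (inv_nonneg.2 ha0.le)
  set Y : Config n → ℝ := fun x => (C.card : ℝ)⁻¹ * ∑ S ∈ C, X S x with hY
  have hYle : ∀ x, Y x ≤ avgLR C s A z x := by
    intro x
    have h1 : ∑ S ∈ C, X S x ≤ a⁻¹ * ∑ S ∈ C, Real.exp (A * blockSum S x) := by
      rw [Finset.mul_sum]
      exact Finset.sum_le_sum fun S _ => hXle S x
    calc Y x ≤ (C.card : ℝ)⁻¹ * (a⁻¹ * ∑ S ∈ C, Real.exp (A * blockSum S x)) :=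
          mul_le_mul_of_nonneg_left h1 (inv_nonneg.2 hN.le)
      _ = avgLR C s A z x := by
          unfold avgLR
          rw [← ha]
          field_simp
  -- first moments
  have hEX : ∀ S ∈ C, 1 - 4 * s / d ^ 2 ≤ E (X S) := by
    intro S hS
    have h1 : E (X S) = cwProb 0 (fun i => z + blockField A S i) {x | blockSum S x ≤ T} := by
      simp only [hE, hX, cwMean_const_mul, cwMean_zero_tilt, hcard S hS]
      rw [← ha, inv_mul_cancel_left₀ ha0.ne']
      rfl
    have h2 := cwProb_zero_abs_blockSum_ge_le (μ := fun i => z + blockField A S i) hn S hd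
    have h3 : ∑ i ∈ S, Real.tanh (z + blockField A S i) = s * Real.tanh (z + A) := by
      rw [Finset.sum_congr rfl (g := fun _ => Real.tanh (z + A)) fun i hi => by
        simp [blockField, hi], Finset.sum_const, hcard S hS, nsmul_eq_mul]
    rw [h3, hcard S hS] at h2
    have h4 := cwProb_union_le (β := 0) (μ := fun i => z + blockField A S i)
      {x | blockSum S x ≤ T} {x | d ≤ |blockSum S x - s * Real.tanh (z + A)|}
    have h5 : {x | blockSum S x ≤ T} ∪ {x | d ≤ |blockSum S x - s * Real.tanh (z + A)|} =
        Set.univ := by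
      refine Set.eq_univ_of_forall fun x => ?_
      rcases le_or_gt (blockSum S x) T with h | h
      · exact Or.inl h
      · exact Or.inr (show d ≤ _ from le_trans (by rw [hT] at h; linarith) (le_abs_self _))
    have h6 : cwProb 0 (fun i => z + blockField A S i) (Set.univ : Set (Config n)) = 1 := by
      rw [cwProb, Set.indicator_univ]
      exact cwMean_const 1
    rw [h5, h6] at h4
    linarith
  have hEY : 1 - 4 * s / d ^ 2 ≤ E Y := by
    have h1 : E Y = (C.card : ℝ)⁻¹ * ∑ S ∈ C, E (X S) := by
      simp only [hE, hY, cwMean_const_mul, cwMean_sum]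
    have h2 := Finset.sum_le_sum hEX
    rw [Finset.sum_const, nsmul_eq_mul] at h2
    rw [h1, inv_mul_eq_div, le_div_iff₀ hN]
    linarith
  -- second moments
  set B := Real.exp (A * T) * a⁻¹ with hB
  have hdiag : ∀ S ∈ C, E (fun x => X S x * X S x) ≤ B := by
    intro S hS
    have h1 : ∀ x, X S x * X S x ≤ B * (a⁻¹ * Real.exp (A * blockSum S x)) := by
      intro x
      by_cases h : blockSum S x ≤ T
      · refine mul_le_mul ?_ (hXle S x) (hX0 S x) (by positivity)
        rw [hB, mul_comm]
        refine (hXle S x).trans (mul_le_mul_of_nonneg_left ?_ (inv_nonneg.2 ha0.le))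
        exact Real.exp_le_exp.2 (mul_le_mul_of_nonneg_left h hA)
      · have : X S x = 0 := by simp [hX, h]
        rw [this, zero_mul]
        positivity
    refine (cwMean_mono h1).trans ?_
    rw [cwMean_const_mul, cwMean_const_mul, cwMean_zero_exp_blockSum, hcard S hS, ← ha,
      inv_mul_cancel₀ ha0.ne', mul_one]
  have hoff : ∀ S ∈ C, ∀ S' ∈ C, S ≠ S' → E (fun x => X S x * X S' x) ≤ 1 := by
    intro S hS S' hS' hne
    have hd' : Disjoint S S' := hdisj hS hS' hne
    have h1 : ∀ x, X S x * X S' x ≤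
        (a⁻¹ * a⁻¹) * Real.exp (A * blockSum (S ∪ S') x) := by
      intro x
      refine (mul_le_mul (hXle S x) (hXle S' x) (hX0 S' x) (by positivity)).trans ?_
      rw [show blockSum (S ∪ S') x = blockSum S x + blockSum S' x from
        Finset.sum_union hd', mul_add, Real.exp_add]
      exact le_of_eq (by ring)
    refine (cwMean_mono h1).trans ?_
    rw [cwMean_const_mul, cwMean_zero_exp_blockSum, Finset.card_union_of_disjoint hd', hcard S hS,
      hcard S' hS', pow_add, ← ha]
    exact le_of_eq (by field_simp)
  have hB0 : 0 < B := by positivity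
  have hEY2 : E (fun x => Y x ^ 2) ≤ B / C.card + 1 := by
    have h1 : E (fun x => Y x ^ 2) =
        ((C.card : ℝ)⁻¹ * (C.card : ℝ)⁻¹) *
          ∑ S ∈ C, ∑ S' ∈ C, E (fun x => X S x * X S' x) := by
      simp only [hE, hY, ← cwMean_sum, ← cwMean_const_mul, ← Finset.sum_mul_sum]
      congr 1
      funext x
      ring
    have h2 : ∑ S ∈ C, ∑ S' ∈ C, E (fun x => X S x * X S' x) ≤
        ∑ S ∈ C, ∑ S' ∈ C, ((if S = S' then B else 0) + 1) := by
      refine Finset.sum_le_sum fun S hS => Finset.sum_le_sum fun S' hS' => ?_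
      split_ifs with h
      · subst h; linarith [hdiag S hS]
      · linarith [hoff S hS S' hS' h]
    have h3 : ∑ S ∈ C, ∑ S' ∈ C, ((if S = S' then B else 0) + 1) =
        C.card * B + (C.card : ℝ) * C.card := by
      simp [Finset.sum_add_distrib]
    rw [h1]
    refine (mul_le_mul_of_nonneg_left (h2.trans h3.le) (by positivity)).trans
      (le_of_eq (by field_simp))
  have hBN : B / C.card ≤ Real.exp (-Real.log C.card + A * d +
      s * (A ^ 2 / 2 * (1 - Real.tanh (z + A) ^ 2 + 2 * A))) := by
    have h1 : B / C.card = Real.exp (-Real.log C.card +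
        (A * T - s * (logCosh (z + A) - logCosh z))) := by
      rw [hB, ha, tiltRatio_pow_eq_exp, Real.exp_add, Real.exp_neg, Real.exp_log hN, Real.exp_sub]
      ring
    rw [h1]
    refine Real.exp_le_exp.2 ?_
    have h2 := logCosh_add_le (z + A) (-A)
    rw [show z + A + -A = z by ring, abs_neg, abs_of_nonneg hA] at h2
    have h3 := mul_le_mul_of_nonneg_left h2 (Nat.cast_nonneg (α := ℝ) s)
    rw [hT]
    nlinarith
  calc deficit C s A z ^ 2 ≤ (E fun x => |1 - Y x|) ^ 2 := by
        refine pow_le_pow_left₀ (deficit_nonneg _ _ _ _) (cwMean_mono fun x => ?_) 2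
        exact max_le (abs_nonneg _) ((by linarith [hYle x] : _ ≤ 1 - Y x).trans (le_abs_self _))
    _ ≤ E fun x => |1 - Y x| ^ 2 := sq_cwMean_le _
    _ = 1 - 2 * E Y + E fun x => Y x ^ 2 := by
        have e : (fun x => |1 - Y x| ^ 2) = fun x => (1 - 2 * Y x) + Y x ^ 2 := by
          funext x; rw [sq_abs]; ring
        simp only [hE, e, cwMean_add, cwMean_sub, cwMean_const, cwMean_const_mul]
    _ ≤ _ := by
        have e : 8 * (s : ℝ) / d ^ 2 = 2 * (4 * s / d ^ 2) := by ring
        rw [e]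
        linarith

end Product
end CWDetect

namespace CWDetect

open MeasureTheory

/-! ### The Curie–Weiss model as a mixture of product measures -/

section Mixture

variable {n : ℕ} {β : ℝ}

/-- The unnormalised mixing density: for `β > 0` the Curie–Weiss model without external field is
the mixture over `z` of the product measures with field `z`. -/
noncomputable def mixWeight (β : ℝ) (n : ℕ) (z : ℝ) : ℝ :=
  Real.exp (-(n / (2 * β)) * z ^ 2) * (2 * Real.cosh z) ^ n

lemma mixWeight_pos (z : ℝ) : 0 < mixWeight β n z :=
  mul_pos (Real.exp_pos _) (pow_pos (mul_pos two_pos (Real.cosh_pos z)) n)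

lemma continuous_mixWeight : Continuous (mixWeight β n) := by
  unfold mixWeight
  have := Real.continuous_cosh
  fun_prop

lemma mixWeight_neg (z : ℝ) : mixWeight β n (-z) = mixWeight β n z := by
  simp [mixWeight]

lemma integrable_exp_neg_mul_sq_add {a : ℝ} (ha : 0 < a) (M : ℝ) :
    Integrable (fun z : ℝ => Real.exp (-a * z ^ 2 + z * M)) ∧
    ∫ z : ℝ, Real.exp (-a * z ^ 2 + z * M) =
      Real.exp (M ^ 2 / (4 * a)) * √(Real.pi / a) := by
  have e : (fun z : ℝ => Real.exp (-a * z ^ 2 + z * M)) = fun z =>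
      Real.exp (M ^ 2 / (4 * a)) * (fun y => Real.exp (-a * y ^ 2)) (z - M / (2 * a)) := by
    funext z
    simp only
    rw [← Real.exp_add]
    congr 1
    field_simp
    ring
  rw [e]
  refine ⟨((integrable_exp_neg_mul_sq ha).comp_sub_right _).const_mul _, ?_⟩
  rw [integral_const_mul, integral_sub_right_eq_self (fun y => Real.exp (-a * y ^ 2)),
    integral_gaussian]

lemma mixWeight_mul_cwMean (z : ℝ) (F : Config n → ℝ) :
    mixWeight β n z * cwMean 0 (fun _ => z) F =
      ∑ x, Real.exp (-(n / (2 * β)) * z ^ 2 + z * mag x) * F x := by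
  have h1 : (cwSum 0 (fun _ : Fin n => z) fun _ => 1) = (2 * Real.cosh z) ^ n := by
    simp [cwSum_zero_one]
  rw [mixWeight, mul_assoc, ← h1, ← cwSum_eq_mul_cwMean, cwSum, Finset.mul_sum]
  refine Finset.sum_congr rfl fun x _ => ?_
  rw [← mul_assoc]
  unfold cwWeight
  rw [← Real.exp_add]
  simp only [← Finset.mul_sum, mag, blockSum]
  simp

lemma integrable_mixWeight_mul_cwMean (hn : 1 ≤ n) (hβ : 0 < β) (F : Config n → ℝ) :
    Integrable fun z => mixWeight β n z * cwMean 0 (fun _ => z) F := by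
  have hn' : (0 : ℝ) < n := by positivity
  simp only [mixWeight_mul_cwMean]
  exact integrable_finsetSum _ fun x _ =>
    ((integrable_exp_neg_mul_sq_add (by positivity) (mag x)).1).mul_const _

lemma integrable_mixWeight (hn : 1 ≤ n) (hβ : 0 < β) : Integrable (mixWeight β n) := by
  simpa [cwMean_const] using integrable_mixWeight_mul_cwMean hn hβ fun _ => 1

/-- The Hubbard–Stratonovich transformation. -/
theorem exists_cwSum_eq_integral (hn : 1 ≤ n) (hβ : 0 < β) : ∃ c : ℝ, 0 < c ∧
    ∀ F : Config n → ℝ, cwSum β 0 F = c * ∫ z, mixWeight β n z * cwMean 0 (fun _ => z) F := by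
  have hn' : (0 : ℝ) < n := by positivity
  have ha : 0 < n / (2 * β) := by positivity
  have hr : 0 < √(Real.pi / (n / (2 * β))) := Real.sqrt_pos.2 (div_pos Real.pi_pos ha)
  refine ⟨(√(Real.pi / (n / (2 * β))))⁻¹, inv_pos.2 hr, fun F => ?_⟩
  simp only [mixWeight_mul_cwMean]
  rw [integral_finsetSum _ fun x _ =>
    ((integrable_exp_neg_mul_sq_add ha (mag x)).1).mul_const _, Finset.mul_sum, cwSum]
  refine Finset.sum_congr rfl fun x _ => ?_
  rw [integral_mul_const, (integrable_exp_neg_mul_sq_add ha (mag x)).2, cwWeight]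
  simp only [Pi.zero_apply, zero_mul, Finset.sum_const_zero, add_zero]
  rw [show mag x ^ 2 / (4 * (n / (2 * β))) = β / (2 * n) * mag x ^ 2 by field_simp; ring]
  field_simp

lemma integral_mixWeight_pos (hn : 1 ≤ n) (hβ : 0 < β) : 0 < ∫ z, mixWeight β n z := by
  rw [integral_pos_iff_support_of_nonneg (fun z => (mixWeight_pos z).le)
    (integrable_mixWeight hn hβ)]
  have : Function.support (mixWeight β n) = Set.univ :=
    Set.eq_univ_of_forall fun z => (mixWeight_pos z).ne'
  simp [this]

end Mixture

/-! ### Laplace asymptotics of the mixing density -/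

section Laplace

variable {β : ℝ}

/-- The exponent of the mixing density. -/
noncomputable def potential (β z : ℝ) : ℝ := z ^ 2 / (2 * β) - logCosh z

lemma mixWeight_eq (n : ℕ) (z : ℝ) :
    mixWeight β n z = 2 ^ n * Real.exp (-(n * potential β z)) := by
  rw [mixWeight, mul_pow, ← exp_logCosh z, ← Real.exp_nat_mul, mul_left_comm, ← Real.exp_add]
  congr 2
  unfold potential
  ring

lemma potential_abs (z : ℝ) : potential β |z| = potential β z := by
  simp [potential, logCosh_abs]

/-- The potential has its minima at `±w`, and `n` times its excess over the minimum grows at least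
quadratically on the scale `1 / a n` around the minima, while it stays bounded in a one-sided
neighbourhood of `w` of that size. -/
def PhaseBounds (β w : ℝ) (a : ℕ → ℝ) : Prop :=
  0 ≤ w ∧ (∀ n, 1 ≤ n → 0 < a n ∧ a n ^ 2 ≤ n) ∧ ∃ V₀ c c' K : ℝ, 0 < c ∧ ∀ n : ℕ, 1 ≤ n →
    (∀ z, c * (a n * (|z| - w)) ^ 2 - c' ≤ n * (potential β z - V₀)) ∧
    ∀ z ∈ Set.Icc w (w + 1 / a n), n * (potential β z - V₀) ≤ K

lemma sqrt_scale (n : ℕ) (hn : 1 ≤ n) : 0 < √(n : ℝ) ∧ √(n : ℝ) ^ 2 ≤ n :=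
  ⟨Real.sqrt_pos.2 (by positivity), (Real.sq_sqrt (Nat.cast_nonneg n)).le⟩

lemma phaseBounds_of_lt_one (hβ0 : 0 < β) (hβ : β < 1) :
    PhaseBounds β 0 fun n => √(n : ℝ) := by
  have h1 : 1 < 1 / β := by rwa [lt_div_iff₀ hβ0, one_mul]
  refine ⟨le_rfl, sqrt_scale, 0, (1 / β - 1) / 2, 0, 1 / (2 * β), by linarith, fun n hn => ?_⟩
  have hn' : (0 : ℝ) < n := by positivity
  have hs := Real.sq_sqrt hn'.le
  refine ⟨fun z => ?_, fun z hz => ?_⟩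
  · have h2 := mul_le_mul_of_nonneg_left (logCosh_le_half_sq z) hn'.le
    rw [sub_zero, sub_zero, sub_zero, mul_pow, hs, sq_abs]
    have e : n * potential β z = n * (z ^ 2 * (1 / β) / 2) - n * logCosh z := by
      unfold potential; ring
    rw [e]
    linarith
  · rw [sub_zero]
    have h2 : potential β z ≤ z ^ 2 / (2 * β) := by
      unfold potential; linarith [logCosh_nonneg z]
    have h3 : z ^ 2 ≤ (1 / √(n : ℝ)) ^ 2 := pow_le_pow_left₀ hz.1 (by simpa using hz.2) 2
    rw [div_pow, hs, one_pow] at h3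
    have h4 : n * z ^ 2 ≤ 1 := by
      have := mul_le_mul_of_nonneg_left h3 hn'.le
      rwa [mul_one_div_cancel hn'.ne'] at this
    calc n * potential β z ≤ n * (z ^ 2 / (2 * β)) := mul_le_mul_of_nonneg_left h2 hn'.le
      _ = (n * z ^ 2) / (2 * β) := by ring
      _ ≤ 1 / (2 * β) := div_le_div_of_nonneg_right h4 (by positivity)

lemma cosh_add_le_exp_half_sq (z : ℝ) :
    Real.cosh z + z ^ 4 / 12 ≤ Real.exp (z ^ 2 / 2) := by
  have h1 := Real.hasSum_cosh z
  have h2 : HasSum (fun k : ℕ => (z ^ 2 / 2) ^ k / (k.factorial : ℝ)) (Real.exp (z ^ 2 / 2)) := by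
    rw [Real.exp_eq_exp_ℝ]
    exact NormedSpace.expSeries_div_hasSum_exp (z ^ 2 / 2)
  have h3 := le_hasSum (h2.sub h1) 2 fun k _ => by
    rw [sub_nonneg]
    simp only [div_pow, pow_mul, div_div]
    gcongr
    exact_mod_cast Nat.two_pow_mul_factorial_le_factorial_two_mul k
  norm_num [Nat.factorial] at h3
  linarith

lemma one_add_half_sq_le_cosh (z : ℝ) : 1 + z ^ 2 / 2 ≤ Real.cosh z := by
  have h := sum_le_hasSum (Finset.range 2) (fun k _ => by rw [pow_mul]; positivity)
    (Real.hasSum_cosh z)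
  simpa [Finset.sum_range_succ, Nat.factorial] using h

/-- At the critical temperature the potential grows like `z ^ 4`, which gives the scale `n ^ (1/4)`.
-/
lemma phaseBounds_one : PhaseBounds 1 0 fun n => √√(n : ℝ) := by
  set c : ℝ := Real.exp (-8) / 12 with hc
  have hc0 : 0 < c := by positivity
  have hc1 : c ≤ 1 / 4 := by
    have : Real.exp (-8) ≤ 1 := Real.exp_le_one_iff.2 (by norm_num)
    rw [hc]; linarith
  have hscale : ∀ n : ℕ, 1 ≤ n → 1 ≤ √(n : ℝ) := fun n hn =>
    Real.one_le_sqrt.2 (by exact_mod_cast hn)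
  refine ⟨le_rfl, fun n hn => ?_, 0, c, c, 1, hc0, fun n hn => ?_⟩
  · have h1 := hscale n hn
    refine ⟨Real.sqrt_pos.2 (by linarith), ?_⟩
    rw [Real.sq_sqrt (by linarith)]
    nlinarith [Real.sq_sqrt (Nat.cast_nonneg (α := ℝ) n)]
  have h1 := hscale n hn
  have hs := Real.sq_sqrt (Nat.cast_nonneg (α := ℝ) n)
  set r := √(n : ℝ) with hr
  have hrr : √r ^ 2 = r := Real.sq_sqrt (by linarith)
  refine ⟨fun z => ?_, fun z hz => ?_⟩
  · rw [sub_zero, sub_zero, mul_pow, hrr, sq_abs, ← hs]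
    unfold potential
    rw [mul_one]
    rcases le_total |z| 4 with hz | hz
    · have hz2 : z ^ 2 ≤ 16 := by
        have := pow_le_pow_left₀ (abs_nonneg z) hz 2
        rw [sq_abs] at this; linarith
      have h2 : logCosh z ≤ z ^ 2 / 2 - c * z ^ 4 := by
        unfold logCosh
        rw [Real.log_le_iff_le_exp (Real.cosh_pos z), sub_eq_add_neg, Real.exp_add]
        have h3 := cosh_add_le_exp_half_sq z
        have h4 := Real.add_one_le_exp (-(c * z ^ 4))
        have h5 : Real.exp (z ^ 2 / 2) * Real.exp (-8) ≤ 1 := by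
          rw [← Real.exp_add]; exact Real.exp_le_one_iff.2 (by linarith)
        have h6 := mul_le_mul_of_nonneg_left h4 (Real.exp_pos (z ^ 2 / 2)).le
        have h7 : 0 ≤ z ^ 4 := by positivity
        have h8 := mul_le_mul_of_nonneg_right h5 h7
        rw [hc] at h6 ⊢
        nlinarith
      have h3 : 0 ≤ r ^ 2 := sq_nonneg r
      have h4 : c * z ^ 4 ≤ z ^ 2 / 2 - logCosh z := by linarith
      have h5 := mul_le_mul_of_nonneg_left h4 h3
      have h6 : 0 ≤ c * ((r * z ^ 2 - 1) ^ 2 + r * z ^ 2) := by positivity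
      nlinarith
    · have h2 : logCosh z ≤ |z| := by
        rw [← logCosh_abs]
        unfold logCosh
        rw [Real.log_le_iff_le_exp (Real.cosh_pos _), Real.cosh_eq]
        have := Real.exp_le_exp.2 (show -|z| ≤ |z| by linarith [abs_nonneg z])
        linarith
      have h3 : |z| ≤ z ^ 2 / 4 := by rw [← sq_abs]; nlinarith
      have h4 : z ^ 2 / 4 ≤ z ^ 2 / 2 - logCosh z := by linarith
      have h5 := mul_le_mul_of_nonneg_left h4 (sq_nonneg r)
      have h6 : r ≤ r ^ 2 := by nlinarith
      have h7 : r * z ^ 2 ≤ r ^ 2 * z ^ 2 := mul_le_mul_of_nonneg_right h6 (sq_nonneg z)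
      have h8 : c * (r * z ^ 2) ≤ 1 / 4 * (r * z ^ 2) :=
        mul_le_mul_of_nonneg_right hc1 (by positivity)
      nlinarith
  · rw [sub_zero]
    have h2 : z ^ 2 / 2 - z ^ 4 / 8 ≤ logCosh z := by
      have h3 := Real.le_log_one_add_of_nonneg (x := z ^ 2 / 2) (by positivity)
      have h4 : Real.log (1 + z ^ 2 / 2) ≤ logCosh z :=
        Real.log_le_log (by positivity) (one_add_half_sq_le_cosh z)
      have h5 : z ^ 2 / 2 - z ^ 4 / 8 ≤ 2 * (z ^ 2 / 2) / (z ^ 2 / 2 + 2) := by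
        rw [le_div_iff₀ (by positivity)]
        have : 0 ≤ z ^ 6 := by positivity
        nlinarith
      linarith
    have h3 : z ^ 2 ≤ (1 / √r) ^ 2 := pow_le_pow_left₀ hz.1 (by simpa using hz.2) 2
    rw [div_pow, hrr, one_pow] at h3
    have h4 : r * z ^ 2 ≤ 1 := by
      have := mul_le_mul_of_nonneg_left h3 (show 0 ≤ r by linarith)
      rwa [mul_one_div_cancel (by linarith : r ≠ 0)] at this
    have h5 : (n : ℝ) * potential 1 z ≤ r ^ 2 * (z ^ 4 / 8) := by
      rw [← hs]
      refine mul_le_mul_of_nonneg_left ?_ (sq_nonneg r)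
      unfold potential
      linarith
    have h6 : 0 ≤ r * z ^ 2 := by positivity
    nlinarith

lemma tanh_add_le_of_nonneg {z u : ℝ} (hz : 0 ≤ z) (hu : 0 ≤ u) :
    Real.tanh (z + u) ≤ Real.tanh z + u * (1 - Real.tanh z ^ 2) := by
  have h := le_of_hasDerivAt_nonneg (f := fun v => (1 - Real.tanh z ^ 2) * v -
      Real.tanh (z + v)) (f' := fun v => (1 - Real.tanh z ^ 2) - (1 - Real.tanh (z + v) ^ 2)) hu
    (fun v => by
      have h1 := (hasDerivAt_tanh (z + v)).comp_const_add z v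
      have h2 := (hasDerivAt_id v).const_mul (1 - Real.tanh z ^ 2)
      exact (h2.fun_sub h1).congr_deriv (by simp))
    (fun v hv _ => by
      have := tanh_sq_lt_tanh_sq hz (show z < z + v by linarith)
      linarith)
  simp only [add_zero, mul_zero] at h
  linarith

lemma logCosh_add_le_of_nonneg {z u : ℝ} (hz : 0 ≤ z) (hu : 0 ≤ u) :
    logCosh (z + u) ≤ logCosh z + u * Real.tanh z + u ^ 2 / 2 * (1 - Real.tanh z ^ 2) := by
  have h := le_of_hasDerivAt_nonneg
    (f := fun v => v * Real.tanh z + v ^ 2 / 2 * (1 - Real.tanh z ^ 2) - logCosh (z + v))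
    (f' := fun v => (Real.tanh z + v * (1 - Real.tanh z ^ 2)) - Real.tanh (z + v)) hu
    (fun v => by
      have h1 := (hasDerivAt_logCosh (z + v)).comp_const_add z v
      have h2 := ((hasDerivAt_id v).mul_const (Real.tanh z)).fun_add
        ((((hasDerivAt_id v).fun_pow 2).div_const 2).mul_const (1 - Real.tanh z ^ 2))
      exact (h2.fun_sub h1).congr_deriv (by simp))
    (fun v hv _ => by
      have := tanh_add_le_of_nonneg hz hv.le
      linarith)
  simp only [add_zero, zero_mul] at h
  norm_num at h
  linarith

/-- Below the positive root the mean-field map increases the magnetisation. -/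
lemma div_le_tanh_of_le {z w : ℝ} (hz : 0 ≤ z) (hzw : z ≤ w) (hw : Real.tanh w = w / β) :
    z / β ≤ Real.tanh z := by
  have hder : ∀ v, HasDerivAt (fun v => Real.tanh v - v / β)
      ((1 - Real.tanh v ^ 2) - 1 / β) v := fun v =>
    (hasDerivAt_tanh v).fun_sub ((hasDerivAt_id v).div_const β)
  have hmono : ∀ a b : ℝ, 0 ≤ a → a ≤ b → Real.tanh a ^ 2 ≤ Real.tanh b ^ 2 := by
    intro a b ha hab
    rcases hab.eq_or_lt with rfl | h
    · exact le_rfl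
    · exact (tanh_sq_lt_tanh_sq ha h).le
  rcases le_total (1 / β) (1 - Real.tanh z ^ 2) with h | h
  · have := le_of_hasDerivAt_nonneg hz hder fun v hv hvz => by
      have := hmono v z hv.le hvz.le
      linarith
    simp at this
    linarith
  · have := le_of_hasDerivAt_nonneg hzw (fun v => (hder v).fun_neg) fun v hv hvz => by
      have := hmono z v hz hv.le
      linarith
    simp only [hw] at this
    linarith

lemma IsPosRoot.phaseBounds {m : ℝ} (hβ : 1 < β) (hm : IsPosRoot β m) :
    PhaseBounds β (β * m) fun n => √(n : ℝ) := by
  have hβ0 : 0 < β := by linarith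
  set w := β * m with hw
  have hw0 : 0 < w := mul_pos hβ0 hm.1
  have htw : Real.tanh w = m := hm.tanh_eq
  have hmw : m = w / β := by rw [hw]; field_simp
  set k := 1 / β - (1 - m ^ 2) with hk
  have hk0 : 0 < k := by linarith [hm.one_sub_sq_lt hβ]
  set δ := min (k / 4) w with hδ
  have hδ0 : 0 < δ := lt_min (by linarith) hw0
  have hδk : δ ≤ k / 4 := min_le_left _ _
  have hδw : δ ≤ w := min_le_right _ _
  set c := k * δ ^ 2 / (4 * w ^ 2) with hc
  have hc0 : 0 < c := by positivity
  have hck : c ≤ k / 4 := by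
    rw [hc, div_le_iff₀ (by positivity)]
    have : δ ^ 2 ≤ w ^ 2 := pow_le_pow_left₀ hδ0.le hδw 2
    nlinarith
  have hexp : ∀ u, potential β (w + u) - potential β w =
      u ^ 2 * (1 / β) / 2 + u * m - (logCosh (w + u) - logCosh w) := by
    intro u
    unfold potential
    rw [hmw]
    field_simp
    ring
  -- near the minimum
  have hnear : ∀ u, |u| ≤ k / 4 → k / 4 * u ^ 2 ≤ potential β (w + u) - potential β w := by
    intro u hu
    have h := logCosh_add_le w u
    rw [hexp, htw] at *
    have h2 : 0 ≤ u ^ 2 * (k / 4 - |u|) := mul_nonneg (sq_nonneg u) (by linarith)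
    rw [hk] at *
    nlinarith
  have hmain : ∀ z, 0 ≤ z → c * (z - w) ^ 2 ≤ potential β z - potential β w := by
    intro z hz
    rcases le_total w z with hwz | hwz
    · have h := logCosh_add_le_of_nonneg hw0.le (sub_nonneg.2 hwz)
      have h2 := hexp (z - w)
      rw [show w + (z - w) = z by ring] at h h2
      rw [h2]
      rw [htw] at h
      have h3 := mul_le_mul_of_nonneg_right hck (sq_nonneg (z - w))
      have h4 := mul_nonneg hk0.le (sq_nonneg (z - w))
      rw [hk] at h3 h4
      nlinarith
    · rcases le_total (w - z) δ with h | h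
      · have h2 := hnear (z - w) (by rw [abs_le]; constructor <;> linarith)
        rw [show w + (z - w) = z by ring] at h2
        exact (mul_le_mul_of_nonneg_right hck (sq_nonneg _)).trans h2
      · have h2 := hnear (-δ) (by rw [abs_neg, abs_of_pos hδ0]; exact hδk)
        have h3 : potential β (w + -δ) ≤ potential β z := by
          have := le_of_hasDerivAt_nonneg (f := fun v => logCosh v - v ^ 2 / (2 * β))
            (f' := fun v => Real.tanh v - v / β) (show z ≤ w + -δ by linarith)
            (fun v => by
              refine ((hasDerivAt_logCosh v).fun_sub
                (((hasDerivAt_id v).fun_pow 2).div_const (2 * β))).congr_deriv ?_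
              simp
              field_simp)
            (fun v hv hvw => by
              rw [sub_nonneg]
              exact div_le_tanh_of_le (w := w) (by linarith) (by linarith) (by rw [htw, hmw]))
          unfold potential
          linarith
        have h4 : c * (z - w) ^ 2 ≤ k / 4 * δ ^ 2 := by
          have h5 : (z - w) ^ 2 ≤ w ^ 2 := by nlinarith
          calc c * (z - w) ^ 2 ≤ c * w ^ 2 := mul_le_mul_of_nonneg_left h5 hc0.le
            _ = k / 4 * δ ^ 2 := by rw [hc]; field_simp
        rw [neg_sq] at h2
        linarith
  refine ⟨hw0.le, sqrt_scale, potential β w, c, 0, 1 / (2 * β), hc0, fun n hn => ?_⟩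
  have hn' : (0 : ℝ) < n := by positivity
  have hs := Real.sq_sqrt hn'.le
  refine ⟨fun z => ?_, fun z hz => ?_⟩
  · have h := mul_le_mul_of_nonneg_left (hmain |z| (abs_nonneg z)) hn'.le
    rw [potential_abs] at h
    rw [mul_pow, hs]
    linarith
  · have h := hexp (z - w)
    have h2 := le_logCosh_add w (z - w)
    rw [show w + (z - w) = z by ring] at h h2
    rw [htw] at h2
    have h3 : potential β z - potential β w ≤ (z - w) ^ 2 * (1 / β) / 2 := by linarith
    have h4 : (z - w) ^ 2 ≤ (1 / √(n : ℝ)) ^ 2 :=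
      pow_le_pow_left₀ (sub_nonneg.2 hz.1) (by linarith [hz.2]) 2
    rw [div_pow, hs, one_pow] at h4
    have h5 : n * (z - w) ^ 2 ≤ 1 := by
      have := mul_le_mul_of_nonneg_left h4 hn'.le
      rwa [mul_one_div_cancel hn'.ne'] at this
    calc n * (potential β z - potential β w) ≤ n * ((z - w) ^ 2 * (1 / β) / 2) :=
          mul_le_mul_of_nonneg_left h3 hn'.le
      _ = (n * (z - w) ^ 2) / (2 * β) := by ring
      _ ≤ 1 / (2 * β) := div_le_div_of_nonneg_right h5 (by positivity)

end Laplace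

section Phases

variable {β w : ℝ} {a : ℕ → ℝ}

/-- Exponential moments of the mixing density around its two modes. -/
theorem PhaseBounds.exists_integral_exp_le (h : PhaseBounds β w a) (hβ : 0 < β) :
    ∃ C : ℝ, 0 ≤ C ∧ ∀ n : ℕ, 1 ≤ n → ∀ η : ℝ, 0 ≤ η → η ≤ 1 →
      Integrable (fun z => mixWeight β n z * Real.exp (η * (a n * |(|z| - w)|))) ∧
      ∫ z, mixWeight β n z * Real.exp (η * (a n * |(|z| - w)|)) ≤
        (1 + C * η) * ∫ z, mixWeight β n z := by
  obtain ⟨hw, ha, V₀, c, c', K, hc, hb⟩ := h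
  refine ⟨2 * √(Real.pi / (c / 2)) * Real.exp (c' + 2 / c + K), by positivity,
    fun n hn η hη0 hη1 => ?_⟩
  obtain ⟨hlow, hup⟩ := hb n hn
  have han := (ha n hn).1
  have hint := integrable_mixWeight hn hβ
  set G : ℝ := 2 ^ n * Real.exp (-(n * V₀) + c' + 2 / c) with hG
  set b : ℝ := c / 2 * a n ^ 2 with hbdef
  have hb0 : 0 < b := by positivity
  set g : ℝ → ℝ := fun z => Real.exp (-b * (z - w) ^ 2) + Real.exp (-b * (z + w) ^ 2) with hg
  have hg1 : Integrable (fun z : ℝ => Real.exp (-b * (z - w) ^ 2)) :=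
    (integrable_exp_neg_mul_sq hb0).comp_sub_right w
  have hg2 : Integrable (fun z : ℝ => Real.exp (-b * (z + w) ^ 2)) :=
    (integrable_exp_neg_mul_sq hb0).comp_add_right w
  have hgint : Integrable g := hg1.add hg2
  have hgval : ∫ z, g z = 2 * √(Real.pi / b) := by
    rw [hg, integral_add hg1 hg2,
      integral_sub_right_eq_self (fun y => Real.exp (-b * y ^ 2)),
      integral_add_right_eq_self (fun y => Real.exp (-b * y ^ 2)), integral_gaussian]
    ring
  -- the increment of the exponential factor is absorbed by half of the quadratic growth
  have hpt : ∀ z, mixWeight β n z * (Real.exp (η * (a n * |(|z| - w)|)) - 1) ≤ η * G * g z := by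
    intro z
    set y := a n * |(|z| - w)| with hy
    have hy0 : 0 ≤ y := by positivity
    have hy2 : y ^ 2 = a n ^ 2 * (|z| - w) ^ 2 := by rw [hy, mul_pow, sq_abs]
    have h1 : mixWeight β n z ≤ 2 ^ n * Real.exp (-(n * V₀) + c' - c * y ^ 2) := by
      rw [mixWeight_eq]
      refine mul_le_mul_of_nonneg_left (Real.exp_le_exp.2 ?_) (by positivity)
      have := hlow z
      rw [hy2, ← mul_pow]
      linarith
    have h2 : Real.exp (η * y) - 1 ≤ η * Real.exp (c / 2 * y ^ 2 + 2 / c) := by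
      have e1 : Real.exp (η * y) - 1 ≤ η * y * Real.exp (η * y) := by
        have e2 := Real.add_one_le_exp (-(η * y))
        have e3 := mul_le_mul_of_nonneg_right e2 (Real.exp_pos (η * y)).le
        rw [← Real.exp_add, neg_add_cancel, Real.exp_zero] at e3
        linarith
      have e4 : y ≤ Real.exp y := by linarith [Real.add_one_le_exp y]
      have e5 : Real.exp (η * y) ≤ Real.exp y := Real.exp_le_exp.2 (by nlinarith)
      have e6 : y * Real.exp (η * y) ≤ Real.exp (c / 2 * y ^ 2 + 2 / c) := by
        refine (mul_le_mul e4 e5 (Real.exp_pos _).le (Real.exp_pos _).le).trans ?_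
        rw [← Real.exp_add]
        refine Real.exp_le_exp.2 ?_
        have : 0 ≤ c / 2 * (y - 2 / c) ^ 2 := by positivity
        have e7 : c / 2 * (y - 2 / c) ^ 2 = c / 2 * y ^ 2 + 2 / c - 2 * y := by
          field_simp; ring
        linarith
      calc Real.exp (η * y) - 1 ≤ η * (y * Real.exp (η * y)) := by linarith
        _ ≤ _ := mul_le_mul_of_nonneg_left e6 hη0
    have h3 : 0 ≤ Real.exp (η * y) - 1 := by
      have := Real.one_le_exp (show 0 ≤ η * y by positivity); linarith
    have h4 : Real.exp (-(c / 2) * y ^ 2) ≤ g z := by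
      have e : ∀ v : ℝ, -b * v ^ 2 = -(c / 2) * (a n ^ 2 * v ^ 2) := by intro v; rw [hbdef]; ring
      simp only [hg, e, hy2]
      rcases abs_cases z with ⟨hz, _⟩ | ⟨hz, _⟩ <;> rw [hz]
      · linarith [Real.exp_pos (-(c / 2) * (a n ^ 2 * (z + w) ^ 2))]
      · rw [show (-z - w) ^ 2 = (z + w) ^ 2 by ring]
        linarith [Real.exp_pos (-(c / 2) * (a n ^ 2 * (z - w) ^ 2))]
    calc mixWeight β n z * (Real.exp (η * y) - 1)
        ≤ (2 ^ n * Real.exp (-(n * V₀) + c' - c * y ^ 2)) *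
          (η * Real.exp (c / 2 * y ^ 2 + 2 / c)) := mul_le_mul h1 h2 h3 (by positivity)
      _ = η * G * Real.exp (-(c / 2) * y ^ 2) := by
          have : Real.exp (-(n * V₀) + c' - c * y ^ 2) * Real.exp (c / 2 * y ^ 2 + 2 / c) =
              Real.exp (-(n * V₀) + c' + 2 / c) * Real.exp (-(c / 2) * y ^ 2) := by
            rw [← Real.exp_add, ← Real.exp_add]; congr 1; ring
          rw [hG]
          linear_combination (2 ^ n * η) * this
      _ ≤ η * G * g z := mul_le_mul_of_nonneg_left h4 (by positivity)
  have hexp1 : ∀ z, 0 ≤ Real.exp (η * (a n * |(|z| - w)|)) - 1 := fun z => by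
    have := Real.one_le_exp (show 0 ≤ η * (a n * |(|z| - w)|) by positivity)
    linarith
  have hint2 : Integrable
      fun z => mixWeight β n z * (Real.exp (η * (a n * |(|z| - w)|)) - 1) := by
    refine (hgint.const_mul (η * G)).mono' ?_ (Eventually.of_forall fun z => ?_)
    · have := continuous_mixWeight (β := β) (n := n)
      exact Continuous.aestronglyMeasurable (by fun_prop)
    · rw [Real.norm_eq_abs, abs_of_nonneg (mul_nonneg (mixWeight_pos z).le (hexp1 z))]
      exact hpt z
  have hsplit : (fun z => mixWeight β n z * Real.exp (η * (a n * |(|z| - w)|))) = fun z =>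
      mixWeight β n z + mixWeight β n z * (Real.exp (η * (a n * |(|z| - w)|)) - 1) := by
    funext z; ring
  have hD : 2 ^ n * Real.exp (-(n * V₀) - K) / a n ≤ ∫ z, mixWeight β n z := by
    have h1 : ∫ z in Set.Icc w (w + 1 / a n), (2 ^ n * Real.exp (-(n * V₀) - K) : ℝ) ≤
        ∫ z in Set.Icc w (w + 1 / a n), mixWeight β n z := by
      refine setIntegral_mono_on continuous_const.integrableOn_Icc hint.integrableOn
        measurableSet_Icc fun z hz => ?_
      rw [mixWeight_eq]
      refine mul_le_mul_of_nonneg_left (Real.exp_le_exp.2 ?_) (by positivity)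
      have := hup z hz
      linarith
    rw [setIntegral_const, smul_eq_mul, measureReal_def, Real.volume_Icc,
      ENNReal.toReal_ofReal (by rw [add_sub_cancel_left]; positivity), add_sub_cancel_left,
      one_div_mul_eq_div] at h1
    exact h1.trans (setIntegral_le_integral hint
      (Eventually.of_forall fun z => (mixWeight_pos z).le))
  rw [hsplit]
  refine ⟨hint.add hint2, ?_⟩
  rw [integral_add hint hint2, add_mul, one_mul]
  refine add_le_add_right ?_ _
  have h1 : ∫ z, mixWeight β n z * (Real.exp (η * (a n * |(|z| - w)|)) - 1) ≤
      η * G * (2 * √(Real.pi / b)) := by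
    rw [← hgval, ← integral_const_mul]
    exact integral_mono hint2 (hgint.const_mul _) hpt
  have h2 : √(Real.pi / b) = √(Real.pi / (c / 2)) / a n := by
    rw [hbdef, ← div_div, Real.sqrt_div' _ (by positivity), Real.sqrt_sq han.le]
  have h3 : G = Real.exp (c' + 2 / c + K) * (2 ^ n * Real.exp (-(n * V₀) - K)) := by
    rw [hG, mul_left_comm, ← Real.exp_add]; congr 2; ring
  refine h1.trans ?_
  rw [h2, h3]
  calc η * (Real.exp (c' + 2 / c + K) * (2 ^ n * Real.exp (-(n * V₀) - K))) *
        (2 * (√(Real.pi / (c / 2)) / a n))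
      = 2 * √(Real.pi / (c / 2)) * Real.exp (c' + 2 / c + K) * η *
        (2 ^ n * Real.exp (-(n * V₀) - K) / a n) := by ring
    _ ≤ _ := mul_le_mul_of_nonneg_left hD (by positivity)

/-- The mixing density is concentrated around its two modes. -/
theorem PhaseBounds.exists_setIntegral_le (h : PhaseBounds β w a) (hβ : 0 < β) :
    ∃ C : ℝ, 0 ≤ C ∧ ∀ n : ℕ, 1 ≤ n → ∀ κ : ℝ,
      ∫ z in {z | κ < |(|z| - w)|}, mixWeight β n z ≤
        C * Real.exp (-(a n * κ)) * ∫ z, mixWeight β n z := by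
  obtain ⟨C, hC, hC'⟩ := h.exists_integral_exp_le hβ
  refine ⟨1 + C, by positivity, fun n hn κ => ?_⟩
  obtain ⟨hi, hle⟩ := hC' n hn 1 zero_le_one le_rfl
  have han := (h.2.1 n hn).1
  have hint := integrable_mixWeight hn hβ
  have hmeas : MeasurableSet {z : ℝ | κ < |(|z| - w)|} :=
    (isOpen_lt continuous_const (by fun_prop)).measurableSet
  have h1 : ∫ z in {z | κ < |(|z| - w)|}, mixWeight β n z ≤
      ∫ z in {z | κ < |(|z| - w)|}, Real.exp (-(a n * κ)) *
        (mixWeight β n z * Real.exp (1 * (a n * |(|z| - w)|))) := by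
    refine setIntegral_mono_on hint.integrableOn (hi.const_mul _).integrableOn hmeas
      fun z hz => ?_
    rw [mul_left_comm, ← Real.exp_add]
    refine le_mul_of_one_le_right (mixWeight_pos z).le (Real.one_le_exp ?_)
    have hz' : κ < |(|z| - w)| := hz
    have := mul_le_mul_of_nonneg_left hz'.le han.le
    linarith
  refine h1.trans ((setIntegral_le_integral (hi.const_mul _) (Eventually.of_forall fun z =>
    mul_nonneg (Real.exp_pos _).le (mul_nonneg (mixWeight_pos z).le (Real.exp_pos _).le))).trans ?_)
  rw [integral_const_mul]
  have := mul_le_mul_of_nonneg_left hle (Real.exp_pos (-(a n * κ))).le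
  rw [mul_one] at this
  linarith

/-! ### Reduction to product measures -/

/-- Probabilities under the null hypothesis are controlled by the product measures whose field is
close to `w` or `-w`, up to an error that is exponentially small on the scale `1 / a n`. -/
def NullControl (β w : ℝ) (a : ℕ → ℝ) : Prop :=
  ∃ C : ℝ, 0 ≤ C ∧ ∀ n : ℕ, 1 ≤ n → ∀ (E : Set (Config n)) (κ B : ℝ), 0 ≤ κ → 0 ≤ B →
    (∀ z : ℝ, |(|z| - w)| ≤ κ → cwProb 0 (fun _ => z) E ≤ B) →
    cwProb β 0 E ≤ C * B + C * Real.exp (-(a n * κ))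

/-- The sum of the errors of the test with rejection region `R`, averaged over the alternatives
`A 1_S` with `S ∈ F`, is bounded below by `b` up to errors that are governed by the `deficit` of the
product measures with field close to `w`. -/
def LowerControl (β w : ℝ) (a : ℕ → ℝ) (b : ℝ) : Prop :=
  ∃ C : ℝ, 0 ≤ C ∧ ∀ n : ℕ, 1 ≤ n → ∀ (F : Finset (Finset (Fin n))) (s : ℕ) (A κ ε : ℝ),
    F.Nonempty → (∀ S ∈ F, S.card = s) → 0 ≤ A → s * A ≤ a n → 0 ≤ κ → 0 ≤ ε → ε ≤ 1 →
    (∀ z : ℝ, |z - w| ≤ κ → deficit F s A z ≤ ε) → ∀ R : Set (Config n),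
    b * (Real.exp (-(s * A * κ)) / (1 + C * (s * A / a n)) *
        (1 - C * ε - C * Real.exp (-(a n * κ)))) ≤
      cwProb β 0 R + (∑ S ∈ F, cwProb β (blockField A S) Rᶜ) / F.card

theorem PhaseBounds.nullControl (h : PhaseBounds β w a) (hβ : 0 < β) : NullControl β w a := by
  obtain ⟨C, hC, hC'⟩ := h.exists_setIntegral_le hβ
  refine ⟨1 + C, by positivity, fun n hn E κ B hκ hB hE => ?_⟩
  obtain ⟨c, hc, hHS⟩ := exists_cwSum_eq_integral hn hβ
  have hint := integrable_mixWeight hn hβ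
  have hD := integral_mixWeight_pos hn hβ
  set D := ∫ z, mixWeight β n z with hDdef
  set U : Set ℝ := {z | κ < |(|z| - w)|} with hU
  have hmeas : MeasurableSet U := (isOpen_lt continuous_const (by fun_prop)).measurableSet
  have h1 : cwProb β 0 E = (∫ z, mixWeight β n z * cwProb 0 (fun _ : Fin n => z) E) / D := by
    rw [cwProb, cwMean, hHS, hHS]
    simp only [cwMean_const, mul_one]
    rw [mul_div_mul_left _ _ hc.ne']
    rfl
  have h2 : ∫ z, mixWeight β n z * cwProb 0 (fun _ : Fin n => z) E ≤
      ∫ z, (B * mixWeight β n z + U.indicator (mixWeight β n) z) := by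
    refine integral_mono (integrable_mixWeight_mul_cwMean hn hβ _)
      ((hint.const_mul B).add (hint.indicator hmeas)) fun z => ?_
    have hp := (mixWeight_pos (β := β) (n := n) z).le
    by_cases hz : z ∈ U
    · simp only [Set.indicator_of_mem hz]
      have := mul_le_mul_of_nonneg_left
        (cwProb_le_one (β := 0) (μ := fun _ : Fin n => z) E) hp
      have := mul_nonneg hB hp
      linarith
    · simp only [Set.indicator_of_notMem hz, add_zero]
      rw [mul_comm B]
      exact mul_le_mul_of_nonneg_left (hE z (not_lt.1 hz)) hp
  rw [integral_add (hint.const_mul B) (hint.indicator hmeas), integral_const_mul,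
    integral_indicator hmeas, ← hDdef] at h2
  have h3 := hC' n hn κ
  rw [h1, div_le_iff₀ hD]
  have h4 : 0 ≤ C * B * D := by positivity
  have h5 : 0 ≤ Real.exp (-(a n * κ)) * D := by positivity
  nlinarith

lemma abs_logCosh_increment_sub_le {A : ℝ} (hA : 0 ≤ A) (x y : ℝ) :
    |(logCosh (x + A) - logCosh x) - (logCosh (y + A) - logCosh y)| ≤ A * |x - y| := by
  have hd : ∀ z, HasDerivAt (fun z => logCosh (z + A) - logCosh z)
      (Real.tanh (z + A) - Real.tanh z) z := fun z =>
    ((hasDerivAt_logCosh (z + A)).comp_add_const z A).fun_sub (hasDerivAt_logCosh z)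
  have h := Convex.norm_image_sub_le_of_norm_hasDerivWithin_le (C := A) (s := Set.univ) (x := y)
    (y := x) (fun z _ => (hd z).hasDerivWithinAt)
    (fun z _ => by
      have := abs_tanh_sub_tanh_le (z + A) z
      rwa [add_sub_cancel_left, abs_of_nonneg hA] at this)
    convex_univ (Set.mem_univ _) (Set.mem_univ _)
  simpa using h

lemma logCosh_increment_mono {A : ℝ} (hA : 0 ≤ A) {x y : ℝ} (hxy : x ≤ y) :
    logCosh (x + A) - logCosh x ≤ logCosh (y + A) - logCosh y :=
  le_of_hasDerivAt_nonneg hxy (fun z =>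
    ((hasDerivAt_logCosh (z + A)).comp_add_const z A).fun_sub (hasDerivAt_logCosh z))
    fun z _ _ => sub_nonneg.2 (tanh_strictMono.monotone (by linarith))

lemma tiltRatio_pow_le {A w : ℝ} (hA : 0 ≤ A) (s : ℕ) (z : ℝ) :
    tiltRatio A z ^ s ≤ tiltRatio A w ^ s * Real.exp (s * A * |(|z| - w)|) := by
  rw [tiltRatio_pow_eq_exp, tiltRatio_pow_eq_exp, ← Real.exp_add]
  refine Real.exp_le_exp.2 ?_
  rw [mul_assoc, ← mul_add]
  refine mul_le_mul_of_nonneg_left ?_ (Nat.cast_nonneg s)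
  have h1 := logCosh_increment_mono hA (le_abs_self z)
  have h2 := (abs_le.1 (abs_logCosh_increment_sub_le hA |z| w)).2
  linarith

lemma le_tiltRatio_pow {A w : ℝ} (hA : 0 ≤ A) (s : ℕ) (z : ℝ) :
    tiltRatio A w ^ s * Real.exp (-(s * A * |z - w|)) ≤ tiltRatio A z ^ s := by
  rw [tiltRatio_pow_eq_exp, tiltRatio_pow_eq_exp, ← Real.exp_add]
  refine Real.exp_le_exp.2 ?_
  have h2 := (abs_le.1 (abs_logCosh_increment_sub_le hA z w)).1
  have := mul_le_mul_of_nonneg_left h2 (Nat.cast_nonneg (α := ℝ) s)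
  linarith

/-- For every test of a product measure against the mixture, the sum of the errors is at least one
minus the deficit. -/
lemma one_sub_deficit_le {n : ℕ} (F : Finset (Finset (Fin n))) (s : ℕ) (A z : ℝ)
    (R : Set (Config n)) :
    1 - deficit F s A z ≤ cwMean 0 (fun _ => z) (R.indicator 1) +
      cwMean 0 (fun _ => z) (fun x => avgLR F s A z x * Rᶜ.indicator 1 x) := by
  classical
  have e : 1 - deficit F s A z =
      cwMean 0 (fun _ => z) fun x => 1 - max 0 (1 - avgLR F s A z x) := by
    rw [cwMean_sub, cwMean_const, deficit]
  rw [← cwMean_add, e]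
  refine cwMean_mono fun x => ?_
  by_cases hx : x ∈ R
  · simp [hx]
  · simp only [hx, Set.mem_compl_iff, not_false_iff, Set.indicator_of_mem,
      Set.indicator_of_notMem, Pi.one_apply, mul_one, zero_add]
    linarith [le_max_right 0 (1 - avgLR F s A z x)]

lemma cwProb_blockField {n : ℕ} (A : ℝ) (S : Finset (Fin n)) (E : Set (Config n)) :
    cwProb β (blockField A S) E =
      cwSum β 0 (fun x => Real.exp (A * blockSum S x) * E.indicator 1 x) /
        cwSum β 0 (fun x => Real.exp (A * blockSum S x)) := by
  have h := fun F => cwSum_add_blockField (β := β) (0 : Fin n → ℝ) A S F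
  simp only [Pi.zero_apply, zero_add] at h
  rw [cwProb, cwMean, h, h]
  simp

/-- The lower control with the mass that the mixing density gives to the neighbourhood of one mode
as a parameter. -/
theorem PhaseBounds.lowerControl_of_mass (h : PhaseBounds β w a) (hβ : 0 < β) {b : ℝ}
    (hb : 0 ≤ b)
    (hmass : ∀ n : ℕ, 1 ≤ n → ∀ κ : ℝ,
      b * ((∫ z, mixWeight β n z) - ∫ z in {z | κ < |(|z| - w)|}, mixWeight β n z) ≤
        ∫ z in {z | |z - w| ≤ κ}, mixWeight β n z) :
    LowerControl β w a b := by
  obtain ⟨C₁, hC₁, hexp⟩ := h.exists_integral_exp_le hβ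
  obtain ⟨C₂, hC₂, htail⟩ := h.exists_setIntegral_le hβ
  refine ⟨1 + C₁ + C₂, by positivity,
    fun n hn F s A κ ε hF hcard hA hsA hκ hε0 hε1 hdef R => ?_⟩
  obtain ⟨c, hc, hHS⟩ := exists_cwSum_eq_integral hn hβ
  have hint := integrable_mixWeight hn hβ
  have hD := integral_mixWeight_pos hn hβ
  have han := (h.2.1 n hn).1
  have hm := hmass n hn κ
  have ht := htail n hn κ
  set D := ∫ z, mixWeight β n z with hDdef
  set η := s * A / a n with hη
  have hη0 : 0 ≤ η := by positivity
  have hη1 : η ≤ 1 := (div_le_one han).2 hsA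
  obtain ⟨hei, hele⟩ := hexp n hn η hη0 hη1
  rw [← hDdef] at hele
  have hN : (0 : ℝ) < F.card := by exact_mod_cast hF.card_pos
  set tw := tiltRatio A w ^ s with htw
  have htw0 : 0 < tw := pow_pos (tiltRatio_pos A w) s
  set g := Real.exp (-(s * A * κ)) with hg
  have hg0 : 0 < g := Real.exp_pos _
  have hg1 : g ≤ 1 := Real.exp_le_one_iff.2 (by rw [neg_nonpos]; positivity)
  have hZ : ∀ S ∈ F, cwSum β 0 (fun x => Real.exp (A * blockSum S x)) ≤
      c * (tw * ((1 + C₁ * η) * D)) := by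
    intro S hS
    rw [hHS]
    have hi := integrable_mixWeight_mul_cwMean hn hβ fun x => Real.exp (A * blockSum S x)
    simp only [cwMean_zero_exp_blockSum, hcard S hS] at hi ⊢
    refine mul_le_mul_of_nonneg_left ((integral_mono hi (hei.const_mul tw) fun z => ?_).trans ?_)
      hc.le
    · simp only
      rw [mul_left_comm]
      refine mul_le_mul_of_nonneg_left ((tiltRatio_pow_le (w := w) hA s z).trans (le_of_eq ?_))
        (mixWeight_pos z).le
      rw [hη]
      congr 2
      field_simp
    · rw [integral_const_mul]
      exact mul_le_mul_of_nonneg_left hele htw0.le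
  -- the errors of the test, weighted as in the mixture
  set Φ : Config n → ℝ := fun x => R.indicator 1 x +
    (F.card * tw)⁻¹ * ∑ S ∈ F, Real.exp (A * blockSum S x) * Rᶜ.indicator 1 x with hΦ
  have hind : ∀ (E : Set (Config n)) x, 0 ≤ E.indicator (1 : Config n → ℝ) x := fun E x =>
    Set.indicator_nonneg (fun _ _ => zero_le_one) x
  have hΦ0 : ∀ x, 0 ≤ Φ x := fun x => add_nonneg (hind R x) (mul_nonneg (by positivity)
    (Finset.sum_nonneg fun S _ => mul_nonneg (Real.exp_pos _).le (hind _ x)))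
  have hC₁η : 0 < 1 + C₁ * η := by positivity
  have hZ0 : (cwSum β (0 : Fin n → ℝ) fun _ => 1) = c * D := by
    rw [hHS]; simp only [cwMean_const, mul_one, hDdef]
  have hsum : (∫ z, mixWeight β n z * cwMean 0 (fun _ => z) Φ) / ((1 + C₁ * η) * D) ≤
      cwProb β 0 R + (∑ S ∈ F, cwProb β (blockField A S) Rᶜ) / F.card := by
    have e1 : (∫ z, mixWeight β n z * cwMean 0 (fun _ => z) Φ) / ((1 + C₁ * η) * D) =
        cwSum β 0 Φ / (c * ((1 + C₁ * η) * D)) := by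
      rw [hHS, mul_div_mul_left _ _ hc.ne']
    rw [e1, hΦ, cwSum_add, cwSum_const_mul, cwSum_sum, add_div]
    refine add_le_add ?_ ?_
    · rw [cwProb, cwMean, hZ0]
      refine div_le_div_of_nonneg_left (cwSum_nonneg (hind R)) (by positivity) ?_
      refine mul_le_mul_of_nonneg_left (le_mul_of_one_le_left hD.le ?_) hc.le
      linarith [mul_nonneg hC₁ hη0]
    · rw [le_div_iff₀ hN, Finset.mul_sum, Finset.sum_div, Finset.sum_mul]
      refine Finset.sum_le_sum fun S hS => ?_
      rw [cwProb_blockField]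
      have h0 : 0 < cwSum β (0 : Fin n → ℝ) fun x => Real.exp (A * blockSum S x) := by
        have := cwSum_one_pos (β := β) (μ := fun i : Fin n => (0 : Fin n → ℝ) i + blockField A S i)
        rw [cwSum_add_blockField] at this
        simpa using this
      have h1 := div_le_div_of_nonneg_left (cwSum_nonneg (β := β) (μ := (0 : Fin n → ℝ))
        fun x => mul_nonneg (Real.exp_pos (A * blockSum S x)).le (hind Rᶜ x)) h0 (hZ S hS)
      refine le_trans (le_of_eq ?_) h1
      field_simp
  have hpt : ∀ z, |z - w| ≤ κ → g * (1 - ε) ≤ cwMean 0 (fun _ => z) Φ := by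
    intro z hz
    have h1 := one_sub_deficit_le F s A z R
    have h2 := hdef z hz
    have e : cwMean 0 (fun _ => z) Φ = cwMean 0 (fun _ => z) (R.indicator 1) +
        tiltRatio A z ^ s / tw *
          cwMean 0 (fun _ => z) (fun x => avgLR F s A z x * Rᶜ.indicator 1 x) := by
      rw [hΦ, cwMean_add, ← cwMean_const_mul]
      congr 2
      funext x
      have := (pow_pos (tiltRatio_pos A z) s).ne'
      rw [avgLR, ← Finset.sum_mul]
      field_simp
    have h3 : g ≤ tiltRatio A z ^ s / tw := by
      rw [le_div_iff₀ htw0, mul_comm]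
      refine le_trans (mul_le_mul_of_nonneg_left ?_ htw0.le) (le_tiltRatio_pow (w := w) hA s z)
      exact Real.exp_le_exp.2 (neg_le_neg (mul_le_mul_of_nonneg_left hz (by positivity)))
    have h4 : 0 ≤ cwMean 0 (fun _ => z) (fun x => avgLR F s A z x * Rᶜ.indicator 1 x) :=
      cwMean_nonneg fun x => mul_nonneg (avgLR_nonneg _ _ _ _ _) (hind _ x)
    have h5 : 0 ≤ cwMean 0 (fun _ => z) (R.indicator 1) := cwMean_nonneg (hind R)
    rw [e]
    have h6 := mul_le_mul_of_nonneg_right h3 h4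
    have h7 := mul_le_mul_of_nonneg_right hg1 h5
    have h8 := mul_le_mul_of_nonneg_left ((sub_le_sub_left h2 1).trans h1) hg0.le
    linarith
  have hmeas : MeasurableSet {z : ℝ | |z - w| ≤ κ} :=
    (isClosed_le (by fun_prop) continuous_const).measurableSet
  have hΦi := integrable_mixWeight_mul_cwMean hn hβ Φ
  have hlow : g * (1 - ε) * (b * ((1 - C₂ * Real.exp (-(a n * κ))) * D)) ≤
      ∫ z, mixWeight β n z * cwMean 0 (fun _ => z) Φ := by
    calc g * (1 - ε) * (b * ((1 - C₂ * Real.exp (-(a n * κ))) * D))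
        ≤ g * (1 - ε) * ∫ z in {z | |z - w| ≤ κ}, mixWeight β n z := by
          refine mul_le_mul_of_nonneg_left (le_trans ?_ hm) (mul_nonneg hg0.le (by linarith))
          exact mul_le_mul_of_nonneg_left (by linarith) hb
      _ = ∫ z in {z | |z - w| ≤ κ}, g * (1 - ε) * mixWeight β n z := by
          rw [integral_const_mul]
      _ ≤ ∫ z in {z | |z - w| ≤ κ}, mixWeight β n z * cwMean 0 (fun _ => z) Φ := by
          refine setIntegral_mono_on (hint.const_mul _).integrableOn hΦi.integrableOn hmeas
            fun z hz => ?_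
          rw [mul_comm]
          exact mul_le_mul_of_nonneg_left (hpt z hz) (mixWeight_pos z).le
      _ ≤ _ := setIntegral_le_integral hΦi (Eventually.of_forall fun z =>
          mul_nonneg (mixWeight_pos z).le (cwMean_nonneg hΦ0))
  have hx : 0 ≤ Real.exp (-(a n * κ)) := (Real.exp_pos _).le
  set X := Real.exp (-(a n * κ)) with hX
  have h3 : 0 ≤ g / (1 + (1 + C₁ + C₂) * η) := by positivity
  rcases le_total (1 - (1 + C₁ + C₂) * ε - (1 + C₁ + C₂) * X) 0 with h4 | h4
  · exact (mul_nonpos_of_nonneg_of_nonpos hb (mul_nonpos_of_nonneg_of_nonpos h3 h4)).trans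
      (add_nonneg (cwProb_nonneg _)
        (div_nonneg (Finset.sum_nonneg fun S _ => cwProb_nonneg _) hN.le))
  refine le_trans ?_ ((div_le_div_of_nonneg_right hlow (by positivity)).trans hsum)
  have e : g * (1 - ε) * (b * ((1 - C₂ * X) * D)) / ((1 + C₁ * η) * D) =
      b * (g / (1 + C₁ * η) * ((1 - ε) * (1 - C₂ * X))) := by
    field_simp
  rw [e]
  refine mul_le_mul_of_nonneg_left ?_ hb
  have h1 : 1 - (1 + C₁ + C₂) * ε - (1 + C₁ + C₂) * X ≤ (1 - ε) * (1 - C₂ * X) := by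
    have := mul_nonneg (mul_nonneg hε0 hC₂) hx
    have := mul_nonneg hC₁ hε0
    have := mul_nonneg hC₂ hε0
    have := mul_nonneg hC₁ hx
    linarith
  have h2 : g / (1 + (1 + C₁ + C₂) * η) ≤ g / (1 + C₁ * η) := by
    refine div_le_div_of_nonneg_left hg0.le hC₁η ?_
    have := mul_nonneg hC₂ hη0
    linarith
  exact mul_le_mul h2 h1 h4 (h3.trans h2)

theorem PhaseBounds.lowerControl_one (h : PhaseBounds β 0 a) (hβ : 0 < β) :
    LowerControl β 0 a 1 := by
  refine h.lowerControl_of_mass hβ zero_le_one fun n hn κ => ?_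
  have hmeas : MeasurableSet {z : ℝ | |z - 0| ≤ κ} :=
    (isClosed_le (by fun_prop) continuous_const).measurableSet
  have h1 := integral_add_compl hmeas (integrable_mixWeight hn hβ)
  have e : {z : ℝ | |z - 0| ≤ κ}ᶜ = {z | κ < |(|z| - 0)|} := by
    ext z; simp
  rw [e] at h1
  linarith

theorem PhaseBounds.lowerControl_half (h : PhaseBounds β w a) (hβ : 0 < β) :
    LowerControl β w a (1 / 2) := by
  refine h.lowerControl_of_mass hβ (by norm_num) fun n hn κ => ?_
  have hint := integrable_mixWeight hn hβ
  have hm : MeasurableSet {z : ℝ | κ < |(|z| - w)|} :=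
    (isOpen_lt continuous_const (by fun_prop)).measurableSet
  have hI : MeasurableSet {z : ℝ | |z - w| ≤ κ} :=
    (isClosed_le (by fun_prop) continuous_const).measurableSet
  have h1 := integral_add_compl hm hint
  set I : ℝ → ℝ := {z : ℝ | |z - w| ≤ κ}.indicator (mixWeight β n) with hIdef
  have hIi : Integrable I := hint.indicator hI
  have h2 : ∫ z in {z | κ < |(|z| - w)|}ᶜ, mixWeight β n z ≤ ∫ z, (I z + I (-z)) := by
    rw [← integral_indicator hm.compl]
    refine integral_mono (hint.indicator hm.compl) (hIi.add hIi.comp_neg) fun z => ?_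
    have hp := (mixWeight_pos (β := β) (n := n) z).le
    have hI0 : ∀ y, 0 ≤ I y := fun y => Set.indicator_nonneg (fun y _ => (mixWeight_pos y).le) y
    by_cases hz : z ∈ {z : ℝ | κ < |(|z| - w)|}ᶜ
    · rw [Set.indicator_of_mem hz]
      have hz' : |(|z| - w)| ≤ κ := not_lt.1 hz
      rcases abs_cases z with ⟨e, _⟩ | ⟨e, _⟩ <;> rw [e] at hz'
      · have : I z = mixWeight β n z :=
          Set.indicator_of_mem (show z ∈ {z : ℝ | |z - w| ≤ κ} from hz') _
        linarith [hI0 (-z)]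
      · have : I (-z) = mixWeight β n (-z) :=
          Set.indicator_of_mem (show -z ∈ {z : ℝ | |z - w| ≤ κ} from hz') _
        rw [mixWeight_neg] at this
        linarith [hI0 z]
    · rw [Set.indicator_of_notMem hz]
      exact add_nonneg (hI0 _) (hI0 _)
  rw [integral_add hIi hIi.comp_neg, integral_neg_eq_self I, hIdef, integral_indicator hI] at h2
  linarith

/-! ### Repulsive interactions -/

/-- For `β ≤ 0` the Curie–Weiss model has a bounded density with respect to the uniform measure. -/
lemma exp_mul_le_cwSum_one {n : ℕ} (hn : 1 ≤ n) (hβ : β ≤ 0) :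
    Real.exp (2 * β) * (cwSum 0 (0 : Fin n → ℝ) fun _ => 1) ≤
      cwSum β (0 : Fin n → ℝ) fun _ => 1 := by
  have hn' : (0 : ℝ) < n := by positivity
  have hM : cwMean 0 (0 : Fin n → ℝ) (fun x => mag x ^ 2) ≤ 4 * n := by
    have h := cwMean_sq_sum_sub_condMean_le (β := 0) (μ := (0 : Fin n → ℝ)) hn Finset.univ
    simpa [condMean, mag, blockSum] using h
  have h1 : Real.exp (2 * β) ≤ cwMean 0 (0 : Fin n → ℝ)
      (fun x => Real.exp (2 * β) * (β / (2 * n) * mag x ^ 2 + (1 - 2 * β))) := by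
    rw [cwMean_const_mul, cwMean_add, cwMean_const_mul, cwMean_const]
    refine le_mul_of_one_le_right (Real.exp_pos _).le ?_
    have h2 : β / (2 * n) * (4 * n) ≤ β / (2 * n) * cwMean 0 (0 : Fin n → ℝ) (fun x => mag x ^ 2) :=
      mul_le_mul_of_nonpos_left hM (div_nonpos_of_nonpos_of_nonneg hβ (by positivity))
    have h3 : β / (2 * n) * (4 * n) = 2 * β := by field_simp; ring
    linarith
  have h2 := mul_le_mul_of_nonneg_right h1 (cwSum_one_pos (β := 0) (μ := (0 : Fin n → ℝ))).le
  refine h2.trans ?_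
  rw [mul_comm, ← cwSum_eq_mul_cwMean]
  unfold cwSum
  refine Finset.sum_le_sum fun x _ => ?_
  have h3 := Real.add_one_le_exp (β / (2 * n) * mag x ^ 2 - 2 * β)
  have h4 := mul_le_mul_of_nonneg_left h3 (Real.exp_pos (2 * β)).le
  rw [← Real.exp_add] at h4
  simp only [cwWeight, Pi.zero_apply, zero_mul, Finset.sum_const_zero, add_zero, zero_div,
    Real.exp_zero, one_mul, mul_one]
  rw [show 2 * β + (β / (2 * n) * mag x ^ 2 - 2 * β) = β / (2 * n) * mag x ^ 2 by ring] at h4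
  linarith

lemma cwMean_le_of_nonpos {n : ℕ} (hn : 1 ≤ n) (hβ : β ≤ 0) {F : Config n → ℝ}
    (hF : ∀ x, 0 ≤ F x) : cwMean β 0 F ≤ Real.exp (-(2 * β)) * cwMean 0 (fun _ => 0) F := by
  have h1 := exp_mul_le_cwSum_one hn hβ
  have h0 : 0 < cwSum 0 (0 : Fin n → ℝ) fun _ => 1 := cwSum_one_pos
  have h2 : cwSum β 0 F ≤ cwSum 0 0 F := by
    refine Finset.sum_le_sum fun x _ => mul_le_mul_of_nonneg_right ?_ (hF x)
    refine Real.exp_le_exp.2 ?_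
    have : β / (2 * n) * mag x ^ 2 ≤ 0 :=
      mul_nonpos_of_nonpos_of_nonneg (div_nonpos_of_nonpos_of_nonneg hβ (by positivity))
        (sq_nonneg _)
    simpa using this
  have h3 : 0 ≤ cwSum 0 (0 : Fin n → ℝ) F := cwSum_nonneg hF
  show cwMean β 0 F ≤ Real.exp (-(2 * β)) * cwMean 0 (0 : Fin n → ℝ) F
  rw [cwMean, cwMean, Real.exp_neg, inv_mul_eq_div, div_div, mul_comm _ (Real.exp (2 * β))]
  exact div_le_div₀ h3 h2 (by positivity) h1

theorem nullControl_of_nonpos (hβ : β ≤ 0) : NullControl β 0 fun n => √(n : ℝ) := by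
  refine ⟨Real.exp (-(2 * β)), (Real.exp_pos _).le, fun n hn E κ B hκ hB hE => ?_⟩
  have h1 := cwMean_le_of_nonpos hn hβ (F := E.indicator 1)
    fun x => Set.indicator_nonneg (fun _ _ => zero_le_one) x
  have h2 := hE 0 (by simpa using hκ)
  have h3 := mul_le_mul_of_nonneg_left h2 (Real.exp_pos (-(2 * β))).le
  have h4 : 0 ≤ Real.exp (-(2 * β)) * Real.exp (-(√(n : ℝ) * κ)) := by positivity
  exact (h1.trans h3).trans (by linarith)

lemma abs_exp_neg_half_sq_sub_le (u v : ℝ) :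
    |Real.exp (-(u ^ 2 / 2)) - Real.exp (-(v ^ 2 / 2))| ≤ |u - v| := by
  have hd : ∀ y : ℝ, HasDerivAt (fun y => Real.exp (-(y ^ 2 / 2)))
      (Real.exp (-(y ^ 2 / 2)) * (-y)) y := fun y => by
    refine ((((hasDerivAt_id y).fun_pow 2).div_const 2).fun_neg.exp).congr_deriv ?_
    simp
  have h := Convex.norm_image_sub_le_of_norm_hasDerivWithin_le (C := 1) (s := Set.univ) (x := v)
    (y := u) (fun y _ => (hd y).hasDerivWithinAt)
    (fun y _ => by
      rw [Real.norm_eq_abs, abs_mul, abs_neg, abs_of_pos (Real.exp_pos _), Real.exp_neg,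
        inv_mul_eq_div, div_le_one (Real.exp_pos _)]
      have := Real.add_one_le_exp (y ^ 2 / 2)
      have h2 : |y| ≤ y ^ 2 / 2 + 1 := by
        rw [← sq_abs]; nlinarith [sq_nonneg (|y| - 1)]
      linarith)
    convex_univ (Set.mem_univ _) (Set.mem_univ _)
  simpa using h

/-- For `β ≤ 0` a field on a small block hardly changes the interaction part of the partition
function. The spins of the block are added to the field one at a time. -/
lemma cwSum_exp_blockSum_le {n : ℕ} (hn : 1 ≤ n) (hβ : β ≤ 0) {A : ℝ} (hA : 0 ≤ A)
    (S : Finset (Fin n)) :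
    cwSum β 0 (fun x => Real.exp (A * blockSum S x)) ≤
      Real.cosh A ^ S.card * ((cwSum β (0 : Fin n → ℝ) fun _ => 1) +
        S.card * A * (√(-β / n)) * cwSum 0 (0 : Fin n → ℝ) fun _ => 1) := by
  classical
  have hn' : (0 : ℝ) < n := by positivity
  set r := √(-β / n) with hr
  have hr2 : r ^ 2 = -β / n := Real.sq_sqrt (div_nonneg (by linarith) hn'.le)
  have hr0 : 0 ≤ r := Real.sqrt_nonneg _
  set Z₀ := cwSum 0 (0 : Fin n → ℝ) fun _ => 1 with hZ₀
  have hZ₀' : 0 < Z₀ := cwSum_one_pos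
  induction S using Finset.induction_on with
  | empty => simp [blockSum]
  | insert i S hi ih =>
    set E : Config n → ℝ := fun x => Real.exp (A * blockSum S x) with hE
    have hEf : ∀ x, E (flipAt i x) = E x := by
      intro x
      simp only [hE, blockSum]
      rw [Finset.sum_congr rfl fun j hj => spin_flipAt_of_ne (ne_of_mem_of_not_mem hj hi) x]
    have h1 : cwSum β 0 (fun x => Real.exp (A * blockSum (insert i S) x)) =
        Real.cosh A * cwSum β 0 E + Real.sinh A * cwSum β 0 (fun x => spin x i * E x) := by
      rw [← cwSum_const_mul, ← cwSum_const_mul, ← cwSum_add]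
      congr 1
      funext x
      rw [show blockSum (insert i S) x = spin x i + blockSum S x from Finset.sum_insert hi,
        mul_add, Real.exp_add]
      rcases spin_eq x i with h | h <;> rw [h]
      · rw [mul_one, ← Real.cosh_add_sinh]; ring
      · rw [mul_neg, mul_one, ← Real.cosh_sub_sinh]; ring
    have hE0 : cwSum 0 0 E = Real.cosh A ^ S.card * Z₀ := by
      have := cwMean_zero_exp_blockSum (0 : ℝ) A S
      rw [cwSum_eq_mul_cwMean, mul_comm, ← hZ₀]
      congr 1
      show cwMean 0 (fun _ => (0 : ℝ)) E = _
      simpa [tiltRatio] using this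
    have h2 : cwSum β 0 (fun x => spin x i * E x) ≤ r * cwSum 0 0 E := by
      have hw : ∀ x : Config n, cwWeight β 0 x = Real.exp (-((r * mag x) ^ 2 / 2)) := by
        intro x
        rw [cwWeight, mul_pow, hr2]
        congr 1
        simp
        field_simp
      have hw0 : ∀ x : Config n, cwWeight 0 0 x = 1 := by intro x; simp [cwWeight]
      have h3 : 2 * cwSum β 0 (fun x => spin x i * E x) =
          ∑ x, (cwWeight β 0 x - cwWeight β 0 (flipAt i x)) * (spin x i * E x) := by
        have h4 := sum_flipAt i fun x => cwWeight β 0 x * (spin x i * E x)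
        simp only [spin_flipAt_self, hEf] at h4
        simp only [sub_mul, Finset.sum_sub_distrib]
        have h5 : ∑ x, cwWeight β 0 (flipAt i x) * (spin x i * E x) =
            -∑ x, cwWeight β 0 (flipAt i x) * (-spin x i * E x) := by
          rw [← Finset.sum_neg_distrib]
          exact Finset.sum_congr rfl fun x _ => by ring
        rw [h5, h4, cwSum]
        ring
      have h6 : ∑ x, (cwWeight β 0 x - cwWeight β 0 (flipAt i x)) * (spin x i * E x) ≤
          ∑ x, 2 * r * (cwWeight 0 0 x * E x) := by
        refine Finset.sum_le_sum fun x _ => ?_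
        have h7 : |cwWeight β 0 x - cwWeight β 0 (flipAt i x)| ≤ 2 * r := by
          rw [hw, hw, mag_flipAt]
          refine (abs_exp_neg_half_sq_sub_le _ _).trans (le_of_eq ?_)
          rw [show r * mag x - r * (mag x - 2 * spin x i) = 2 * r * spin x i by ring, abs_mul,
            abs_spin, mul_one, abs_of_nonneg (by positivity)]
        refine (le_abs_self _).trans ?_
        rw [abs_mul, abs_mul, abs_spin, one_mul, hw0, one_mul, abs_of_pos (Real.exp_pos _)]
        exact mul_le_mul_of_nonneg_right h7 (Real.exp_pos _).le
      rw [← Finset.mul_sum] at h6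
      unfold cwSum at h3 ⊢
      linarith
    have hsinh : Real.sinh A ≤ Real.cosh A * A := by
      have h3 := (abs_le.1 (abs_tanh_le A)).2
      rw [abs_of_nonneg hA, Real.tanh_eq_sinh_div_cosh, div_le_iff₀ (Real.cosh_pos A)] at h3
      linarith
    have hsinh0 : 0 ≤ Real.sinh A := Real.sinh_nonneg_iff.2 hA
    rw [h1, Finset.card_insert_of_notMem hi, pow_succ]
    rw [hE0] at h2
    have hc := Real.cosh_pos A
    have h4 := mul_le_mul_of_nonneg_left ih hc.le
    have h5 := mul_le_mul_of_nonneg_left h2 hsinh0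
    have h6 : Real.sinh A * (r * (Real.cosh A ^ S.card * Z₀)) ≤
        Real.cosh A * A * (r * (Real.cosh A ^ S.card * Z₀)) :=
      mul_le_mul_of_nonneg_right hsinh (by positivity)
    push_cast
    refine (add_le_add h4 (h5.trans h6)).trans (le_of_eq ?_)
    ring

theorem lowerControl_of_nonpos (hβ : β ≤ 0) : LowerControl β 0 (fun n => √(n : ℝ)) 1 := by
  set C₁ := Real.exp (-(2 * β)) * √(-β) with hC₁
  set C₂ := Real.exp (-(2 * β)) with hC₂
  have hC₁0 : 0 ≤ C₁ := by positivity
  have hC₂0 : 0 < C₂ := Real.exp_pos _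
  refine ⟨C₁ + C₂, by positivity, fun n hn F s A κ ε hF hcard hA hsA hκ hε0 hε1 hdef R => ?_⟩
  have hn' : (0 : ℝ) < n := by positivity
  have hN : (0 : ℝ) < F.card := by exact_mod_cast hF.card_pos
  set Z := cwSum β (0 : Fin n → ℝ) fun _ => 1 with hZdef
  have hZ : 0 < Z := cwSum_one_pos
  set η := s * A / √(n : ℝ) with hη
  have hη0 : 0 ≤ η := by positivity
  have hind : ∀ (E : Set (Config n)) x, 0 ≤ E.indicator (1 : Config n → ℝ) x := fun E x =>
    Set.indicator_nonneg (fun _ _ => zero_le_one) x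
  have hcA : 0 < Real.cosh A ^ s := pow_pos (Real.cosh_pos A) s
  have hexp : ∀ S ∈ F, cwSum β 0 (fun x => Real.exp (A * blockSum S x)) ≤
      Real.cosh A ^ s * ((1 + C₁ * η) * Z) := by
    intro S hS
    refine (cwSum_exp_blockSum_le hn hβ hA S).trans ?_
    rw [hcard S hS]
    refine mul_le_mul_of_nonneg_left ?_ hcA.le
    have h1 : (cwSum 0 (0 : Fin n → ℝ) fun _ => 1) ≤ C₂ * Z := by
      rw [hC₂, Real.exp_neg, inv_mul_eq_div, le_div_iff₀ (Real.exp_pos _), mul_comm]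
      exact exp_mul_le_cwSum_one hn hβ
    have h2 : s * A * √(-β / n) = √(-β) * η := by
      rw [Real.sqrt_div (by linarith), hη]; ring
    rw [h2, ← hZdef]
    have h3 := mul_le_mul_of_nonneg_left h1 (show 0 ≤ √(-β) * η by positivity)
    rw [hC₁]
    linarith
  have hC₁η : 0 < 1 + C₁ * η := by positivity
  have htilt : tiltRatio A 0 = Real.cosh A := by simp [tiltRatio]
  have hsum : cwMean β 0 (fun x => R.indicator 1 x + avgLR F s A 0 x * Rᶜ.indicator 1 x) /
      (1 + C₁ * η) ≤ cwProb β 0 R + (∑ S ∈ F, cwProb β (blockField A S) Rᶜ) / F.card := by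
    rw [cwMean_add, add_div]
    refine add_le_add ?_ ?_
    · exact div_le_self (cwMean_nonneg (hind R)) (by linarith [mul_nonneg hC₁0 hη0])
    · have e : (fun x => avgLR F s A 0 x * Rᶜ.indicator 1 x) = fun x =>
          (F.card * Real.cosh A ^ s)⁻¹ *
            ∑ S ∈ F, Real.exp (A * blockSum S x) * Rᶜ.indicator 1 x := by
        funext x
        rw [avgLR, htilt, ← Finset.sum_mul]
        ring
      rw [e, cwMean, cwSum_const_mul, cwSum_sum, le_div_iff₀ hN, Finset.mul_sum, Finset.sum_div,
        Finset.sum_div, Finset.sum_mul]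
      refine Finset.sum_le_sum fun S hS => ?_
      rw [cwProb_blockField]
      have h0 : 0 < cwSum β (0 : Fin n → ℝ) fun x => Real.exp (A * blockSum S x) := by
        have := cwSum_one_pos (β := β) (μ := fun i : Fin n => (0 : Fin n → ℝ) i + blockField A S i)
        rw [cwSum_add_blockField] at this
        simpa using this
      have h1 := div_le_div_of_nonneg_left (cwSum_nonneg (β := β) (μ := (0 : Fin n → ℝ))
        fun x => mul_nonneg (Real.exp_pos (A * blockSum S x)).le (hind Rᶜ x)) h0 (hexp S hS)
      refine le_trans (le_of_eq ?_) h1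
      rw [← hZdef]
      field_simp
  have hlow : 1 - C₂ * ε ≤
      cwMean β 0 (fun x => R.indicator 1 x + avgLR F s A 0 x * Rᶜ.indicator 1 x) := by
    have h1 : cwMean β (0 : Fin n → ℝ) (fun x => 1 - max 0 (1 - avgLR F s A 0 x)) ≤
        cwMean β 0 (fun x => R.indicator 1 x + avgLR F s A 0 x * Rᶜ.indicator 1 x) := by
      classical
      refine cwMean_mono fun x => ?_
      by_cases hx : x ∈ R
      · simp [hx]
      · simp only [hx, Set.mem_compl_iff, not_false_iff, Set.indicator_of_mem,
          Set.indicator_of_notMem, Pi.one_apply, mul_one, zero_add]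
        linarith [le_max_right 0 (1 - avgLR F s A 0 x)]
    rw [cwMean_sub, cwMean_const] at h1
    have h2 := cwMean_le_of_nonpos hn hβ (F := fun x => max 0 (1 - avgLR F s A 0 x))
      fun x => le_max_left _ _
    have h3 := mul_le_mul_of_nonneg_left (hdef 0 (by simpa using hκ)) hC₂0.le
    rw [deficit] at h3
    linarith
  have hg1 : Real.exp (-(s * A * κ)) ≤ 1 := Real.exp_le_one_iff.2 (by rw [neg_nonpos]; positivity)
  have hx : 0 ≤ Real.exp (-(√(n : ℝ) * κ)) := (Real.exp_pos _).le
  have h3 : 0 ≤ Real.exp (-(s * A * κ)) / (1 + (C₁ + C₂) * η) := by positivity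
  rw [one_mul]
  rcases le_total (1 - (C₁ + C₂) * ε - (C₁ + C₂) * Real.exp (-(√(n : ℝ) * κ))) 0 with h4 | h4
  · exact (mul_nonpos_of_nonneg_of_nonpos h3 h4).trans (add_nonneg (cwProb_nonneg _)
      (div_nonneg (Finset.sum_nonneg fun S _ => cwProb_nonneg _) hN.le))
  refine le_trans ?_ ((div_le_div_of_nonneg_right hlow hC₁η.le).trans hsum)
  have h5 : Real.exp (-(s * A * κ)) / (1 + (C₁ + C₂) * η) ≤ 1 / (1 + C₁ * η) := by
    refine div_le_div₀ zero_le_one hg1 hC₁η ?_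
    have := mul_nonneg hC₂0.le hη0
    linarith
  have h6 : 1 - (C₁ + C₂) * ε - (C₁ + C₂) * Real.exp (-(√(n : ℝ) * κ)) ≤ 1 - C₂ * ε := by
    have := mul_nonneg hC₁0 hε0
    have := mul_nonneg (add_nonneg hC₁0 hC₂0.le) hx
    linarith
  calc _ ≤ 1 / (1 + C₁ * η) * (1 - C₂ * ε) := mul_le_mul h5 h6 h4 (by positivity)
    _ = _ := by ring

end Phases
end CWDetect

namespace CWDetect

/-! ### Asymptotic scales -/

section Scales

variable {s : ℕ → ℕ} {L a : ℕ → ℝ}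

/-- The scale `√(L / s)` of the signal strength. -/
noncomputable def signalScale (s : ℕ → ℕ) (L : ℕ → ℝ) (n : ℕ) : ℝ := √(L n / s n)

/-- The relations between the log-cardinality `L`, the sparsity `s` and the concentration scale `a`
of the magnetisation that the proofs use. -/
structure Scaling (s : ℕ → ℕ) (L a : ℕ → ℝ) : Prop where
  tendsto_atTop : Tendsto L atTop atTop
  tendsto_div : Tendsto (fun n => L n / s n) atTop (𝓝 0)
  tendsto_window : Tendsto (fun n => √(s n * L n) / a n) atTop (𝓝 0)
  scale : ∀ n, 1 ≤ n → 0 < a n ∧ a n ^ 2 ≤ n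

lemma Scaling.tendsto_signalScale (h : Scaling s L a) :
    Tendsto (signalScale s L) atTop (𝓝 0) := by
  have := (Real.continuous_sqrt.tendsto 0).comp h.tendsto_div
  rwa [Real.sqrt_zero] at this

lemma Scaling.eventually_pos (h : Scaling s L a) (hs : ∀ᶠ n in atTop, 0 < s n) :
    ∀ᶠ n in atTop, 1 ≤ n ∧ (0 : ℝ) < s n ∧ 0 < L n ∧ 0 < signalScale s L n ∧
      s n * signalScale s L n ^ 2 = L n ∧ √(s n * L n) = s n * signalScale s L n := by
  filter_upwards [h.tendsto_atTop.eventually_gt_atTop 0, hs, eventually_ge_atTop 1]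
    with n hL hsn hn
  have hs' : (0 : ℝ) < s n := by exact_mod_cast hsn
  have hv : 0 < L n / s n := div_pos hL hs'
  have h1 : s n * signalScale s L n ^ 2 = L n := by
    rw [signalScale, Real.sq_sqrt hv.le]; field_simp
  refine ⟨hn, hs', hL, Real.sqrt_pos.2 hv, h1, ?_⟩
  rw [show (s n : ℝ) * L n = (s n * signalScale s L n) ^ 2 by rw [← h1]; ring,
    Real.sqrt_sq (show 0 ≤ s n * signalScale s L n from mul_nonneg hs'.le (Real.sqrt_nonneg _))]

lemma Scaling.tendsto_mul_signalScale (h : Scaling s L a) (hs : ∀ᶠ n in atTop, 0 < s n) :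
    Tendsto (fun n => s n * signalScale s L n) atTop atTop := by
  refine tendsto_atTop_mono' _ ?_ h.tendsto_atTop
  filter_upwards [h.eventually_pos hs,
    (h.tendsto_signalScale).eventually (eventually_le_nhds zero_lt_one)] with n hn hv
  obtain ⟨_, h1, _, h3, h4, _⟩ := hn
  rw [← h4]
  nlinarith [mul_pos h1 h3]

/-- There is a window for the mean field that is large on the scale `1 / a` on which it
concentrates but shifts a block sum by less than the signal does. -/
lemma Scaling.exists_window (h : Scaling s L a) (hs : ∀ᶠ n in atTop, 0 < s n) :
    ∃ κ : ℕ → ℝ, (∀ n, 0 ≤ κ n) ∧ Tendsto κ atTop (𝓝 0) ∧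
      Tendsto (fun n => a n * κ n) atTop atTop ∧
      Tendsto (fun n => s n * signalScale s L n * κ n) atTop (𝓝 0) := by
  set p : ℕ → ℝ := fun n => √(s n * L n) / a n with hp
  have hp0 : Tendsto (fun n => √(p n)) atTop (𝓝 0) := by
    have := (Real.continuous_sqrt.tendsto 0).comp h.tendsto_window
    rwa [Real.sqrt_zero] at this
  have hR := h.tendsto_mul_signalScale hs
  have hpos := h.eventually_pos hs
  refine ⟨fun n => √(p n) / (s n * signalScale s L n), fun n =>
    div_nonneg (Real.sqrt_nonneg _) (mul_nonneg (Nat.cast_nonneg _) (Real.sqrt_nonneg _)),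
    hp0.div_atTop hR, ?_, ?_⟩
  · have h1 : Tendsto (fun n => (√(p n))⁻¹) atTop atTop := by
      refine Tendsto.inv_tendsto_nhdsGT_zero (tendsto_nhdsWithin_iff.2 ⟨hp0, ?_⟩)
      filter_upwards [hpos] with n ⟨h0, h1, _, h3, _, h5⟩
      refine Real.sqrt_pos.2 (div_pos ?_ (h.scale n h0).1)
      rw [h5]
      positivity
    refine h1.congr' ?_
    filter_upwards [hpos] with n ⟨h0, h1, _, h3, _, h5⟩
    have ha := (h.scale n h0).1
    have h6 : p n = s n * signalScale s L n / a n := by simp only [hp, h5]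
    have h7 : 0 < p n := by rw [h6]; positivity
    have h8 := Real.mul_self_sqrt h7.le
    have h9 := Real.sqrt_pos.2 h7
    have h10 : (s n : ℝ) * signalScale s L n = a n * (√(p n) * √(p n)) := by
      rw [h8, h6]; field_simp
    rw [h10]
    field_simp
  · refine hp0.congr' ?_
    filter_upwards [hpos] with n ⟨h0, h1, _, h3, _, h5⟩
    field_simp

end Scales

/-! ### The scan test -/

section Scan

variable {n : ℕ} {β : ℝ}

/-- The acceptance region of the scan test over the family `N`: for one of the two phases the
magnetisation is close to its value in that phase, and no block sum of the family exceeds its mean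
in that phase by `t` or more. -/
def acceptRegion (N : Finset (Finset (Fin n))) (s : ℕ) (m κ t : ℝ) : Set (Config n) :=
  {x | ∃ σ : ℝ, (σ = 1 ∨ σ = -1) ∧ |mag x - n * (σ * m)| ≤ 2 * (n * κ) ∧
    ∀ S ∈ N, blockSum S x < t + s * (σ * m)}

lemma exists_sign_mul_abs (z : ℝ) : ∃ σ : ℝ, (σ = 1 ∨ σ = -1) ∧ z = σ * |z| := by
  rcases abs_cases z with ⟨h, _⟩ | ⟨h, _⟩
  · exact ⟨1, Or.inl rfl, by rw [h, one_mul]⟩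
  · exact ⟨-1, Or.inr rfl, by rw [h]; ring⟩

lemma tanh_sign_mul {σ : ℝ} (hσ : σ = 1 ∨ σ = -1) (z : ℝ) :
    Real.tanh (σ * z) = σ * Real.tanh z := by
  rcases hσ with rfl | rfl <;> simp

/-- Error of the first kind under a product measure whose field is close to that of a phase. -/
theorem cwProb_zero_compl_acceptRegion_le (hn : 1 ≤ n) {N : Finset (Finset (Fin n))} {s : ℕ}
    (hN : ∀ S ∈ N, S.card = s) {w m κ t u z : ℝ} (hw : Real.tanh w = m) (hκ : 0 < κ) (hu : 0 ≤ u)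
    (hz : |(|z| - w)| ≤ κ) :
    cwProb 0 (fun _ => z) (acceptRegion N s m κ t)ᶜ ≤ 4 / (n * κ ^ 2) +
      N.card * Real.exp (-(u * t) + u * (s * κ) +
        s * (u ^ 2 / 2 * (1 - m ^ 2 + 2 * κ + 2 * u))) := by
  have hn' : (0 : ℝ) < n := by positivity
  obtain ⟨σ, hσ, hzσ⟩ := exists_sign_mul_abs z
  have hσ2 : σ ^ 2 = 1 := by rcases hσ with rfl | rfl <;> norm_num
  have hσabs : |σ| = 1 := by rcases hσ with rfl | rfl <;> norm_num
  have htz : |Real.tanh z - σ * m| ≤ κ := by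
    rw [hzσ, tanh_sign_mul hσ, ← mul_sub, abs_mul, hσabs, one_mul, ← hw]
    exact (abs_tanh_sub_tanh_le _ _).trans hz
  have htz2 : 1 - Real.tanh z ^ 2 ≤ 1 - m ^ 2 + 2 * κ := by
    have h1 := (abs_le.1 ((abs_tanh_sq_sub_tanh_sq_le |z| w).trans
      (mul_le_mul_of_nonneg_left hz zero_le_two))).1
    have h2 : Real.tanh z ^ 2 = Real.tanh |z| ^ 2 := by
      conv_lhs => rw [hzσ, tanh_sign_mul hσ, mul_pow, hσ2, one_mul]
    rw [hw] at h1
    linarith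
  have hsub : (acceptRegion N s m κ t)ᶜ ⊆
      {x | n * κ ≤ |blockSum Finset.univ x - ∑ i : Fin n, Real.tanh z|} ∪
        ⋃ S ∈ N, {x | t + s * (σ * m) ≤ blockSum S x} := by
    intro x hx
    by_contra hcon
    simp only [Set.mem_union, Set.mem_iUnion, not_or, not_exists, Set.mem_ofPred_eq, not_le,
      Finset.sum_const, Finset.card_univ, Fintype.card_fin, nsmul_eq_mul] at hcon
    refine hx ⟨σ, hσ, ?_, fun S hS => hcon.2 S hS⟩
    have h1 := (abs_sub_le (mag x) (n * Real.tanh z) (n * (σ * m)))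
    have h2 : |n * Real.tanh z - n * (σ * m)| ≤ n * κ := by
      rw [← mul_sub, abs_mul, abs_of_pos hn']
      exact mul_le_mul_of_nonneg_left htz hn'.le
    have h3 : |mag x - n * Real.tanh z| < n * κ := hcon.1
    linarith
  refine (cwProb_mono hsub).trans ((cwProb_union_le _ _).trans (add_le_add ?_ ?_))
  · have h := cwProb_zero_abs_blockSum_ge_le (μ := fun _ : Fin n => z) hn Finset.univ
      (t := n * κ) (by positivity)
    refine h.trans (le_of_eq ?_)
    simp only [Finset.card_univ, Fintype.card_fin]
    field_simp
  · refine (cwProb_biUnion_le _ _).trans ((Finset.sum_le_sum fun S hS =>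
      (cwProb_zero_blockSum_ge_le z _ hu S).trans ?_).trans_eq
        (by rw [Finset.sum_const, nsmul_eq_mul]))
    refine Real.exp_le_exp.2 ?_
    rw [hN S hS]
    have h1 := logCosh_add_le z u
    rw [abs_of_nonneg hu] at h1
    have h2 := mul_le_mul_of_nonneg_left htz2 (show 0 ≤ u ^ 2 / 2 by positivity)
    have h3 := mul_le_mul_of_nonneg_left (abs_le.1 htz).2 hu
    have h4 := mul_le_mul_of_nonneg_left
      (show logCosh (z + u) - logCosh z ≤
        u * (σ * m + κ) + u ^ 2 / 2 * (1 - m ^ 2 + 2 * κ + 2 * u) by linarith)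
      (Nat.cast_nonneg (α := ℝ) s)
    linarith

/-- Error of the second kind: the scan test detects every alternative whose support has a large
intersection with a member of the family. The bound holds at every temperature because block sums
concentrate around sums of conditional means. -/
theorem cwProb_acceptRegion_le (hn : 1 ≤ n) {N : Finset (Finset (Fin n))} {s : ℕ}
    {S S' : Finset (Fin n)} (hS' : S' ∈ N) (hcard : S'.card = s) {μ : Fin n → ℝ}
    {m κ t τ δ d : ℝ} (hm : Real.tanh (β * m) = m) (hκ : 0 ≤ κ) (hμ0 : ∀ i, 0 ≤ μ i)
    (hμ : ∀ i ∈ S, τ ≤ μ i) (hτ : 0 ≤ τ) (hτm : 2 * τ ≤ 1 - m ^ 2)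
    (hinter : (1 - δ) * s ≤ ((S' ∩ S).card : ℝ)) (hd : 0 < d)
    (hdle : d ≤ (1 - δ) * s * (τ * (1 - m ^ 2 - 2 * τ)) - s * (|β| * (2 * κ + 1 / n)) - t) :
    cwProb β μ (acceptRegion N s m κ t) ≤ (4 + 2 * |β|) * s / d ^ 2 := by
  have hn' : (0 : ℝ) < n := by positivity
  rw [← hcard]
  refine (cwProb_mono ?_).trans (cwProb_abs_sum_sub_condMean_ge_le hn S' hd)
  rintro x ⟨σ, hσ, hM, hscan⟩
  have hσ2 : σ ^ 2 = 1 := by rcases hσ with rfl | rfl <;> norm_num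
  set e := |β| * (2 * κ + 1 / n) with he
  have hgain : 0 ≤ τ * (1 - m ^ 2 - 2 * τ) := mul_nonneg hτ (by linarith)
  have hcond : ∀ i, Real.tanh (μ i + σ * (β * m)) - e ≤ condMean β μ i x := by
    intro i
    have h1 := abs_tanh_sub_tanh_le (μ i + β / n * (mag x - spin x i)) (μ i + σ * (β * m))
    have h2 : |μ i + β / n * (mag x - spin x i) - (μ i + σ * (β * m))| ≤ e := by
      have h3 : μ i + β / n * (mag x - spin x i) - (μ i + σ * (β * m)) =
          β / n * ((mag x - n * (σ * m)) - spin x i) := by field_simp; ring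
      have h4 : |(mag x - n * (σ * m)) - spin x i| ≤ 2 * (n * κ) + 1 :=
        (abs_sub _ _).trans (add_le_add hM (abs_spin x i).le)
      rw [h3, abs_mul, abs_div, abs_of_pos hn', he]
      refine (mul_le_mul_of_nonneg_left h4 (by positivity)).trans (le_of_eq ?_)
      field_simp
    have := (abs_le.1 (h1.trans h2)).1
    unfold condMean
    linarith
  have ht : Real.tanh (σ * (β * m)) = σ * m := by rw [tanh_sign_mul hσ, hm]
  have hlow : ∀ i, σ * m - e + (if i ∈ S then τ * (1 - m ^ 2 - 2 * τ) else 0) ≤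
      condMean β μ i x := by
    intro i
    refine le_trans ?_ (hcond i)
    split_ifs with hi
    · have h1 := tanh_strictMono.monotone
        (show σ * (β * m) + τ ≤ μ i + σ * (β * m) by linarith [hμ i hi])
      have h2 := le_tanh_add hτ (σ * (β * m))
      rw [ht, mul_pow, hσ2, one_mul] at h2
      linarith
    · have h1 := tanh_strictMono.monotone
        (show σ * (β * m) ≤ μ i + σ * (β * m) by linarith [hμ0 i])
      rw [ht] at h1
      linarith
  have hsum := Finset.sum_le_sum fun i (_ : i ∈ S') => hlow i
  rw [Finset.sum_add_distrib, Finset.sum_const, nsmul_eq_mul, hcard, ← Finset.sum_filter,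
    Finset.filter_mem_eq_inter, Finset.sum_const, nsmul_eq_mul] at hsum
  have h5 := mul_le_mul_of_nonneg_right hinter hgain
  have h6 := hscan S' hS'
  rw [hcard] at h6
  have h7 : ∑ i ∈ S', (spin x i - condMean β μ i x) =
      blockSum S' x - ∑ i ∈ S', condMean β μ i x := Finset.sum_sub_distrib _ _
  show d ≤ |_|
  rw [h7]
  refine le_trans ?_ (neg_le_abs _)
  linarith

end Scan

/-! ### Risks -/

section Risk

variable {n : ℕ} {β : ℝ}

lemma isingProb_nonneg_le_one (hn : 1 ≤ n) (μ : Fin n → ℝ) (E : Set (Config n)) :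
    0 ≤ isingProb β (curieWeiss n) μ E ∧ isingProb β (curieWeiss n) μ E ≤ 1 := by
  rw [isingProb_curieWeiss hn]
  exact ⟨cwProb_nonneg E, cwProb_le_one E⟩

lemma risk_nonneg (hn : 1 ≤ n) (T : Test n) (C : Finset (Finset (Fin n))) (A : ℝ) :
    0 ≤ risk T C A β (curieWeiss n) :=
  add_nonneg (isingProb_nonneg_le_one hn _ _).1
    (Real.iSup_nonneg fun _ => (isingProb_nonneg_le_one hn _ _).1)

lemma risk_le_of_le (hn : 1 ≤ n) {T : Test n} {C : Finset (Finset (Fin n))} {A B₁ B₂ : ℝ}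
    (hB₂ : 0 ≤ B₂) (h₁ : cwProb β 0 {x | T x = 1} ≤ B₁)
    (h₂ : ∀ μ ∈ alternatives C A, cwProb β μ {x | T x = 0} ≤ B₂) :
    risk T C A β (curieWeiss n) ≤ B₁ + B₂ := by
  refine add_le_add (by rwa [isingProb_curieWeiss hn]) (Real.iSup_le (fun μ => ?_) hB₂)
  rw [isingProb_curieWeiss hn]
  exact h₂ μ.1 μ.2

lemma risk_le_two (hn : 1 ≤ n) (T : Test n) (C : Finset (Finset (Fin n))) (A : ℝ) :
    risk T C A β (curieWeiss n) ≤ 2 := by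
  have := risk_le_of_le (β := β) (T := T) (C := C) (A := A) hn zero_le_one (cwProb_le_one _)
    fun μ _ => cwProb_le_one _
  linarith

lemma blockField_mem_alternatives {C : Finset (Finset (Fin n))} {S : Finset (Fin n)} {A A' : ℝ}
    (hS : S ∈ C) (hA' : 0 < A') (hA : A ≤ A') : blockField A' S ∈ alternatives C A := by
  classical
  have hsupp : supp (blockField A' S) = S := by
    ext i
    by_cases hi : i ∈ S <;> simp [supp, blockField, hi, hA'.ne']
  refine ⟨fun i => ?_, by rwa [hsupp], fun i hi => ?_⟩
  · unfold blockField
    split_ifs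
    exacts [hA'.le, le_rfl]
  · rw [hsupp] at hi
    simpa [blockField, hi] using hA

/-- The worst case over the alternatives is at least the average over block fields. -/
lemma cwProb_add_average_le_risk (hn : 1 ≤ n) (T : Test n) {C F : Finset (Finset (Fin n))}
    (hF : F ⊆ C) (hne : F.Nonempty) {A A' : ℝ} (hA' : 0 < A') (hA : A ≤ A') :
    cwProb β 0 {x | T x = 1} + (∑ S ∈ F, cwProb β (blockField A' S) {x | T x = 1}ᶜ) / F.card ≤
      risk T C A β (curieWeiss n) := by
  have hN : (0 : ℝ) < F.card := by exact_mod_cast hne.card_pos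
  have hT : {x | T x = 1}ᶜ = {x | T x = 0} := by
    ext x
    have : ∀ y : Fin 2, ¬ y = 1 ↔ y = 0 := by decide
    exact this (T x)
  refine add_le_add (by rw [isingProb_curieWeiss hn]) ?_
  rw [div_le_iff₀ hN, mul_comm, ← nsmul_eq_mul]
  refine Finset.sum_le_card_nsmul _ _ _ fun S hS => ?_
  rw [hT, ← isingProb_curieWeiss hn]
  exact le_ciSup (f := fun μ : alternatives C A =>
      isingProb β (curieWeiss n) μ.1 {x | T x = 0})
    ⟨1, by rintro _ ⟨μ, rfl⟩; exact (isingProb_nonneg_le_one hn _ _).2⟩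
    ⟨_, blockField_mem_alternatives (hF hS) hA' hA⟩

lemma isBoundedUnder_cwRisk (T : ∀ n, Test n) (C : ∀ n, Finset (Finset (Fin n))) (A : ℕ → ℝ) :
    IsBoundedUnder (· ≤ ·) atTop (cwRisk T C A β) :=
  isBoundedUnder_of_eventually_le (a := 2)
    ((eventually_ge_atTop 1).mono fun _ hn => risk_le_two hn _ _ _)

end Risk

/-! ### Upper bounds -/

section Upper

/-- If the covering number is not zero, it is attained. -/
lemma exists_net {n : ℕ} {C : Finset (Finset (Fin n))} {ε : ℝ} (h : coveringNumber C ε ≠ 0) :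
    ∃ N ⊆ C, N.card = coveringNumber C ε ∧ ∀ S ∈ C, ∃ S' ∈ N, gam S' S ≤ ε := by
  have hne : {k | ∃ N ⊆ C, N.card = k ∧ ∀ S ∈ C, ∃ S' ∈ N, gam S' S ≤ ε}.Nonempty :=
    Nat.nonempty_of_pos_sInf (Nat.pos_of_ne_zero h)
  exact Nat.sInf_mem hne

lemma le_card_inter_of_gam_le {n s : ℕ} {S S' : Finset (Fin n)} {ε : ℝ} (hs : 0 < s)
    (hS : S.card = s) (hS' : S'.card = s) (h : gam S' S ≤ ε) :
    (1 - ε / √2) * s ≤ ((S' ∩ S).card : ℝ) := by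
  have hs' : (0 : ℝ) < s := by exact_mod_cast hs
  have h2 : (0 : ℝ) < √2 := by positivity
  rw [gam, hS, hS', Real.sqrt_mul_self hs'.le, mul_comm, ← le_div_iff₀ h2] at h
  rw [← le_div_iff₀ hs']
  linarith

/-- The scan test over an optimal net is powerful if the null hypothesis is controlled and
`A ≥ c √(L / s)` for a constant `c` with `c² (1 - m²) > 2`. -/
theorem exists_powerful {β m c : ℝ} {a : ℕ → ℝ} (hnull : NullControl β (β * m) a)
    (hm : Real.tanh (β * m) = m) {s : ℕ → ℕ} {C : ∀ n : ℕ, Finset (Finset (Fin n))}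
    {A ε L : ℕ → ℝ} (hcard : ∀ n, ∀ S ∈ C n, S.card = s n) (hε : Tendsto ε atTop (𝓝 0))
    (hL : ∀ n, L n = Real.log (coveringNumber (C n) (ε n))) (hsc : Scaling s L a)
    (hs : ∀ᶠ n in atTop, 0 < s n) (hc0 : 0 < c) (hc : 2 < c ^ 2 * (1 - m ^ 2))
    (hA : ∀ᶠ n in atTop, c * signalScale s L n ≤ A n) :
    ∃ T : ∀ n, Test n, Powerful T C A β := by
  classical
  set q := 1 - m ^ 2 with hq
  have hq0 : 0 < q := by rw [hq, ← hm]; linarith [tanh_sq_lt_one (β * m)]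
  -- the threshold lies between the null fluctuations and the signal
  obtain ⟨ρ, hρ1, hρ2⟩ : ∃ ρ, √(2 * q) < ρ ∧ ρ < c * q := by
    refine exists_between ((Real.sqrt_lt' (by positivity)).2 ?_)
    nlinarith
  have hρ0 : 0 < ρ := (Real.sqrt_nonneg _).trans_lt hρ1
  have hρq : 2 * q < ρ ^ 2 := (Real.sqrt_lt' hρ0).1 hρ1
  obtain ⟨κ, hκ0, hκ, haκ, hsκ⟩ := hsc.exists_window hs
  set v := signalScale s L with hv
  have hv0 := hsc.tendsto_signalScale
  have hpos : ∀ᶠ n in atTop, 1 ≤ n ∧ (0 : ℝ) < s n ∧ 0 < L n ∧ 0 < v n ∧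
      s n * v n ^ 2 = L n ∧ √(s n * L n) = s n * v n := hsc.eventually_pos hs
  obtain ⟨C₀, hC₀, hnull⟩ := hnull
  have hnet : ∀ n, ∃ N : Finset (Finset (Fin n)), coveringNumber (C n) (ε n) ≠ 0 →
      N ⊆ C n ∧ N.card = coveringNumber (C n) (ε n) ∧
        ∀ S ∈ C n, ∃ S' ∈ N, gam S' S ≤ ε n := by
    intro n
    by_cases h : coveringNumber (C n) (ε n) = 0
    · exact ⟨∅, fun h' => absurd h h'⟩
    · obtain ⟨N, hN⟩ := exists_net h
      exact ⟨N, fun _ => hN⟩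
  choose N hN using hnet
  set t : ℕ → ℝ := fun n => ρ * (s n * v n) with ht
  refine ⟨fun n x => if x ∈ acceptRegion (N n) (s n) m (κ n) (t n) then 0 else 1, ?_⟩
  set T : ∀ n, Test n :=
    fun n x => if x ∈ acceptRegion (N n) (s n) m (κ n) (t n) then 0 else 1 with hT
  -- exponent of the union bound under the null hypothesis
  set X : ℕ → ℝ := fun n => L n * (1 - ρ ^ 2 / q +
    ρ ^ 2 / (2 * q ^ 2) * (q + 2 * κ n + 2 * (ρ / q * v n))) + ρ / q * (s n * v n * κ n) with hX
  have hXt : Tendsto X atTop atBot := by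
    have h1 : Tendsto (fun n => 1 - ρ ^ 2 / q +
        ρ ^ 2 / (2 * q ^ 2) * (q + 2 * κ n + 2 * (ρ / q * v n))) atTop
        (𝓝 (1 - ρ ^ 2 / q + ρ ^ 2 / (2 * q ^ 2) * (q + 2 * 0 + 2 * (ρ / q * 0)))) :=
      ((((hκ.const_mul 2).const_add q).add ((hv0.const_mul (ρ / q)).const_mul 2)).const_mul
        _).const_add _
    have h2 : 1 - ρ ^ 2 / q + ρ ^ 2 / (2 * q ^ 2) * (q + 2 * 0 + 2 * (ρ / q * 0)) < 0 := by
      have e : 1 - ρ ^ 2 / q + ρ ^ 2 / (2 * q ^ 2) * (q + 2 * 0 + 2 * (ρ / q * 0)) =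
          (2 * q - ρ ^ 2) / (2 * q) := by field_simp; ring
      rw [e]
      exact div_neg_of_neg_of_pos (by linarith) (by linarith)
    exact (hsc.tendsto_atTop.atTop_mul_neg h2 h1).atBot_add (hsκ.const_mul (ρ / q))
  set η₀ := (c * q - ρ) / 2 with hη₀
  have hη₀0 : 0 < η₀ := by rw [hη₀]; linarith
  set b : ℕ → ℝ := fun n => (C₀ * (4 / (a n * κ n) ^ 2 + Real.exp (X n)) +
    C₀ * Real.exp (-(a n * κ n))) + (4 + 2 * |β|) / η₀ ^ 2 / L n with hb
  have hbt : Tendsto b atTop (𝓝 0) := by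
    have h1 : Tendsto (fun n => 4 / (a n * κ n) ^ 2) atTop (𝓝 0) :=
      ((tendsto_pow_atTop two_ne_zero).comp haκ).const_div_atTop 4
    have h2 := Real.tendsto_exp_atBot.comp hXt
    have h3 := Real.tendsto_exp_neg_atTop_nhds_zero.comp haκ
    have h4 := hsc.tendsto_atTop.const_div_atTop ((4 + 2 * |β|) / η₀ ^ 2)
    have := (((h1.add h2).const_mul C₀).add (h3.const_mul C₀)).add h4
    simpa using this
  -- the drift of the block sums under the alternatives
  have hdrift : ∀ᶠ n in atTop, η₀ * (s n * v n) ≤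
      (1 - ε n / √2) * s n * (c * v n * (q - 2 * (c * v n))) -
        s n * (|β| * (2 * κ n + 1 / n)) - t n := by
    have hκv : Tendsto (fun n => s n * v n * κ n / L n) atTop (𝓝 0) :=
      hsκ.div_atTop hsc.tendsto_atTop
    have h1 : Tendsto (fun n => (1 - ε n / √2) * (c * (q - 2 * (c * v n))) -
        3 * |β| * (s n * v n * κ n / L n) - ρ) atTop
        (𝓝 ((1 - 0 / √2) * (c * (q - 2 * (c * 0))) - 3 * |β| * 0 - ρ)) :=
      ((((hε.div_const _).const_sub 1).mul
        ((((hv0.const_mul c).const_mul 2).const_sub q).const_mul c)).sub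
        (hκv.const_mul _)).sub_const ρ
    have h2 : η₀ < (1 - 0 / √2) * (c * (q - 2 * (c * 0))) - 3 * |β| * 0 - ρ := by
      rw [hη₀]; simp; linarith
    filter_upwards [h1.eventually (eventually_gt_nhds h2), hpos,
      haκ.eventually_ge_atTop 1, hκ.eventually (eventually_le_nhds zero_lt_one)]
      with n hlt ⟨hn, hs0, hL0, hv0, hsv, _⟩ h3 h4
    have hn' : (0 : ℝ) < n := by positivity
    have h5 : 1 / (n : ℝ) ≤ κ n := by
      rw [div_le_iff₀ hn']
      have h6 : 1 ≤ a n ^ 2 * κ n ^ 2 := by rw [← mul_pow]; nlinarith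
      have h7 := mul_le_mul_of_nonneg_right (hsc.scale n hn).2 (sq_nonneg (κ n))
      have h8 : κ n ^ 2 ≤ κ n := by nlinarith [hκ0 n]
      have h9 := mul_le_mul_of_nonneg_left h8 hn'.le
      linarith
    have h6 := mul_le_mul_of_nonneg_right hlt.le (mul_pos hs0 hv0).le
    have h7 : s n * v n * κ n / L n * (s n * v n) = s n * κ n := by
      rw [← hsv]; field_simp
    have h8 : s n * (|β| * (2 * κ n + 1 / n)) ≤ 3 * |β| * (s n * κ n) := by
      have : |β| * (2 * κ n + 1 / n) ≤ |β| * (3 * κ n) :=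
        mul_le_mul_of_nonneg_left (by linarith) (abs_nonneg β)
      have := mul_le_mul_of_nonneg_left this hs0.le
      linarith
    have h9 : ((1 - ε n / √2) * (c * (q - 2 * (c * v n))) -
        3 * |β| * (s n * v n * κ n / L n) - ρ) * (s n * v n) =
        (1 - ε n / √2) * s n * (c * v n * (q - 2 * (c * v n))) -
        3 * |β| * (s n * v n * κ n / L n * (s n * v n)) - t n := by
      rw [ht]; ring
    rw [h9, h7] at h6
    linarith
  have hle : ∀ᶠ n in atTop, cwRisk T C A β n ≤ b n := by
    have hτ : Tendsto (fun n => 2 * (c * v n)) atTop (𝓝 (2 * (c * 0))) :=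
      (hv0.const_mul c).const_mul 2
    filter_upwards [hpos, hdrift, hA, haκ.eventually_ge_atTop 1,
      hτ.eventually (eventually_le_nhds (by simpa using hq0))]
      with n ⟨hn, hs0, hL0, hv0, hsv, _⟩ hd hAn haκ1 hτn
    have hn' : (0 : ℝ) < n := by positivity
    have ha0 := (hsc.scale n hn).1
    have hκn : 0 < κ n := by
      rcases (hκ0 n).eq_or_lt with h | h
      · rw [← h, mul_zero] at haκ1; linarith
      · exact h
    have hcov : coveringNumber (C n) (ε n) ≠ 0 := by
      intro h
      have := hL n
      rw [h] at this
      simp at this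
      linarith
    obtain ⟨hNC, hNcard, hNcov⟩ := hN n hcov
    have hT1 : {x | T n x = 1} = (acceptRegion (N n) (s n) m (κ n) (t n))ᶜ := by
      ext x
      by_cases hx : x ∈ acceptRegion (N n) (s n) m (κ n) (t n) <;> simp [hT, hx]
    have hT0 : {x | T n x = 0} = acceptRegion (N n) (s n) m (κ n) (t n) := by
      ext x
      by_cases hx : x ∈ acceptRegion (N n) (s n) m (κ n) (t n) <;> simp [hT, hx]
    refine risk_le_of_le hn (by positivity) ?_ fun μ hμ => ?_
    · rw [hT1]
      refine hnull n hn _ (κ n) _ (hκ0 n) (by positivity) fun z hz => ?_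
      refine (cwProb_zero_compl_acceptRegion_le (u := ρ / q * v n) hn
        (fun S hS => hcard n S (hNC hS)) hm hκn (by positivity) hz).trans (add_le_add ?_ ?_)
      · refine div_le_div_of_nonneg_left (by norm_num) (by positivity) ?_
        rw [mul_pow]
        exact mul_le_mul_of_nonneg_right (hsc.scale n hn).2 (sq_nonneg _)
      · have hcardL : ((N n).card : ℝ) = Real.exp (L n) := by
          rw [hNcard, hL n, Real.exp_log (by exact_mod_cast Nat.pos_of_ne_zero hcov)]
        rw [hcardL, ← Real.exp_add]
        refine Real.exp_le_exp.2 (le_of_eq ?_)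
        simp only [hX, ht]
        rw [← hsv, ← hq]
        field_simp
        ring
    · rw [hT0]
      obtain ⟨hμ0, hμS, hμA⟩ := hμ
      obtain ⟨S', hS', hgam⟩ := hNcov _ hμS
      have hS'card := hcard n S' (hNC hS')
      refine (cwProb_acceptRegion_le (d := η₀ * (s n * v n)) hn hS' hS'card hm (hκ0 n) hμ0
        (fun i hi => hAn.trans (hμA i hi)) (by positivity) hτn
        (le_card_inter_of_gam_le (by exact_mod_cast hs0) (hcard n _ hμS) hS'card hgam)
        (by positivity) hd).trans (le_of_eq ?_)
      rw [← hsv]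
      field_simp
  refine Tendsto.limsup_eq
    (tendsto_of_tendsto_of_tendsto_of_le_of_le' tendsto_const_nhds hbt ?_ hle)
  filter_upwards [eventually_ge_atTop 1] with n hn
  exact risk_nonneg hn _ _ _

end Upper

/-! ### Lower bounds -/

section Lower

/-- If `tanh A ≤ c √(L / s)` for a constant `c` with `c² (1 - m²) < 2`, the risk of every test is
eventually at least `b - e`. The bound is uniform in the tests, so that it also applies along
subsequences on which the signal is weak. -/
theorem eventually_le_risk {β w m b c : ℝ} {a : ℕ → ℝ} (hLC : LowerControl β w a b)
    (hw : Real.tanh w = m) {s : ℕ → ℕ} {C F : ∀ n : ℕ, Finset (Finset (Fin n))}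
    {A L : ℕ → ℝ} (hcard : ∀ n, ∀ S ∈ C n, S.card = s n) (hF : ∀ n, F n ⊆ C n)
    (hdisj : ∀ n, (F n : Set (Finset (Fin n))).PairwiseDisjoint id)
    (hL : ∀ n, L n = Real.log ((F n).card : ℝ)) (hsc : Scaling s L a)
    (hs : ∀ᶠ n in atTop, 0 < s n) (hc0 : 0 < c) (hc : c ^ 2 * (1 - m ^ 2) < 2)
    {e : ℝ} (he : 0 < e) :
    ∀ᶠ n in atTop, Real.tanh (A n) ≤ c * signalScale s L n → ∀ T : Test n,
      b - e ≤ risk T (C n) (A n) β (curieWeiss n) := by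
  set q := 1 - m ^ 2 with hq
  have hq0 : 0 < q := by rw [hq, ← hw]; linarith [tanh_sq_lt_one w]
  -- the lower bound is proved for block fields of strength `c' v`, which dominates `A` by `hcc'`
  obtain ⟨c', hcc', hc'⟩ : ∃ c', c < c' ∧ c' < √(2 / q) := by
    refine exists_between (Real.lt_sqrt_of_sq_lt ?_)
    rwa [lt_div_iff₀ hq0]
  have hc'0 : 0 < c' := hc0.trans hcc'
  have hc'q : c' ^ 2 * q < 2 := by
    have := (Real.lt_sqrt hc'0.le).1 hc'
    rwa [lt_div_iff₀ hq0] at this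
  -- the truncation level `δ s v` costs at most half of the gap in the exponent
  set δ := (1 - c' ^ 2 * q / 2) / (2 * c') with hδ
  have hδ0 : 0 < δ := div_pos (by linarith) (by linarith)
  obtain ⟨κ, hκ0, hκ, haκ, hsκ⟩ := hsc.exists_window hs
  set v := signalScale s L with hv
  have hv0 := hsc.tendsto_signalScale
  have hpos : ∀ᶠ n in atTop, 1 ≤ n ∧ (0 : ℝ) < s n ∧ 0 < L n ∧ 0 < v n ∧
      s n * v n ^ 2 = L n ∧ √(s n * L n) = s n * v n := hsc.eventually_pos hs
  obtain ⟨C₀, hC₀, hLC⟩ := hLC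
  -- the bound for the square of the deficit
  set X : ℕ → ℝ := fun n =>
    L n * (-1 + c' * δ + c' ^ 2 / 2 * (q + 2 * κ n + 4 * (c' * v n))) with hX
  have hXt : Tendsto X atTop atBot := by
    have h1 : Tendsto (fun n => -1 + c' * δ + c' ^ 2 / 2 * (q + 2 * κ n + 4 * (c' * v n))) atTop
        (𝓝 (-1 + c' * δ + c' ^ 2 / 2 * (q + 2 * 0 + 4 * (c' * 0)))) :=
      ((((hκ.const_mul 2).const_add q).add ((hv0.const_mul c').const_mul 4)).const_mul
        _).const_add _
    refine hsc.tendsto_atTop.atTop_mul_neg ?_ h1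
    have : c' * δ = (1 - c' ^ 2 * q / 2) / 2 := by rw [hδ]; field_simp
    rw [this]
    linarith
  set E : ℕ → ℝ := fun n => √(8 / δ ^ 2 / L n + Real.exp (X n)) with hE
  have hEt : Tendsto E atTop (𝓝 0) := by
    have h1 := (hsc.tendsto_atTop.const_div_atTop (8 / δ ^ 2)).add (Real.tendsto_exp_atBot.comp hXt)
    have h2 := (Real.continuous_sqrt.tendsto _).comp h1
    rw [add_zero, Real.sqrt_zero] at h2
    exact h2
  have hwin : Tendsto (fun n => s n * (c' * v n) / a n) atTop (𝓝 0) := by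
    have := hsc.tendsto_window.const_mul c'
    rw [mul_zero] at this
    refine this.congr' ?_
    filter_upwards [hpos] with n ⟨_, _, _, _, _, h⟩
    rw [h]; ring
  have hlim : Tendsto (fun n => b * (Real.exp (-(s n * (c' * v n) * κ n)) /
      (1 + C₀ * (s n * (c' * v n) / a n)) *
        (1 - C₀ * E n - C₀ * Real.exp (-(a n * κ n))))) atTop
      (𝓝 (b * (Real.exp (-(c' * 0)) / (1 + C₀ * 0) * (1 - C₀ * 0 - C₀ * 0)))) := by
    have h1 : Tendsto (fun n => Real.exp (-(s n * (c' * v n) * κ n))) atTop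
        (𝓝 (Real.exp (-(c' * 0)))) := by
      refine (Real.continuous_exp.tendsto _).comp ?_
      refine ((hsκ.const_mul c').neg).congr fun n => ?_
      ring
    have h3 := Real.tendsto_exp_neg_atTop_nhds_zero.comp haκ
    exact ((h1.div ((hwin.const_mul C₀).const_add 1) (by simp)).mul
      (((hEt.const_mul C₀).const_sub 1).sub (h3.const_mul C₀))).const_mul b
  have hlim2 : b - e < b * (Real.exp (-(c' * 0)) / (1 + C₀ * 0) * (1 - C₀ * 0 - C₀ * 0)) := by
    simp [he]
  have hcv : Tendsto (fun n => c' * (1 - 2 * (c' * v n))) atTop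
      (𝓝 (c' * (1 - 2 * (c' * 0)))) :=
    (((hv0.const_mul c').const_mul 2).const_sub 1).const_mul c'
  filter_upwards [hpos, hlim.eventually (eventually_gt_nhds hlim2),
    hwin.eventually (eventually_le_nhds zero_lt_one),
    hEt.eventually (eventually_le_nhds zero_lt_one),
    hcv.eventually (eventually_gt_nhds (by simpa using hcc'))]
    with n ⟨hn, hs0, hL0, hv0, hsv, _⟩ hbound hwin1 hE1 hcvn hAn T
  have ha0 := (hsc.scale n hn).1
  have hA'0 : 0 < c' * v n := mul_pos hc'0 hv0
  have hAA' : A n ≤ c' * v n := by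
    refine tanh_strictMono.le_iff_le.1 (hAn.trans ?_)
    have h1 := le_tanh_add hA'0.le 0
    simp only [Real.tanh_zero, zero_add] at h1
    have h2 := mul_le_mul_of_nonneg_right hcvn.le hv0.le
    nlinarith
  have hFne : (F n).Nonempty := by
    rw [Finset.nonempty_iff_ne_empty]
    intro h
    have := hL n
    rw [h] at this
    simp at this
    linarith
  refine hbound.le.trans ((hLC n hn (F n) (s n) (c' * v n) (κ n) (E n) hFne
    (fun S hS => hcard n S (hF n hS)) hA'0.le ((div_le_one ha0).1 hwin1) (hκ0 n)
    (Real.sqrt_nonneg _) hE1 (fun z hz => ?_) {x | T x = 1}).trans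
    (cwProb_add_average_le_risk hn T (hF n) hFne hA'0 hAA'))
  refine Real.le_sqrt_of_sq_le ((deficit_sq_le (d := δ * (s n * v n)) hn z hFne
    (fun S hS => hcard n S (hF n hS)) (hdisj n) hA'0.le (by positivity)).trans
    (add_le_add (le_of_eq ?_) (Real.exp_le_exp.2 ?_)))
  · rw [← hsv]
    field_simp
  · have h1 := (abs_le.1 (abs_tanh_sq_sub_tanh_sq_le (z + c' * v n) w)).1
    have h2 : |z + c' * v n - w| ≤ κ n + c' * v n := by
      rw [show z + c' * v n - w = (z - w) + c' * v n by ring]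
      exact (abs_add_le _ _).trans (by rw [abs_of_pos hA'0]; linarith)
    have h3 : 1 - Real.tanh (z + c' * v n) ^ 2 + 2 * (c' * v n) ≤
        q + 2 * κ n + 4 * (c' * v n) := by
      rw [hw] at h1
      linarith
    have h4 := mul_le_mul_of_nonneg_left h3
      (show 0 ≤ s n * ((c' * v n) ^ 2 / 2) by positivity)
    rw [← hL n]
    simp only [hX]
    rw [← hsv]
    nlinarith

end Lower

/-! ### The three temperature regimes -/

section Regimes

variable {s : ℕ → ℕ} {L A : ℕ → ℝ}

lemma ComplexityCond.tendsto_atTop (h : ComplexityCond s L) (hL : ∀ n, 0 ≤ L n) :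
    Tendsto L atTop atTop := by
  have h1 : Tendsto (fun n : ℕ => ‖Real.log n‖) atTop atTop :=
    tendsto_norm_atTop_atTop.comp (Real.tendsto_log_atTop.comp tendsto_natCast_atTop_atTop)
  have h2 := h.1.tendsto_norm_atTop_iff.2 h1
  exact h2.congr fun n => Real.norm_of_nonneg (hL n)

lemma ComplexityCond.eventually_pos (h : ComplexityCond s L) (hL : ∀ n, 0 ≤ L n) :
    ∀ᶠ n in atTop, 0 < s n := by
  filter_upwards [(h.tendsto_atTop hL).eventually_gt_atTop 0, h.2.1.def zero_lt_one] with n h1 h2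
  rcases Nat.eq_zero_or_pos (s n) with h3 | h3
  · simp [h3] at h2
    linarith
  · exact h3

lemma ComplexityCond.scaling (h : ComplexityCond s L) (hL : ∀ n, 0 ≤ L n) {b : ℕ → ℝ}
    (hb : ∀ n, 1 ≤ n → 0 < √(b n) ∧ √(b n) ^ 2 ≤ n) (hb0 : ∀ n, 0 ≤ b n)
    (hs : (fun n : ℕ => (s n : ℝ)) =o[atTop] fun n : ℕ => b n / Real.log n) :
    Scaling s L fun n => √(b n) := by
  refine ⟨h.tendsto_atTop hL, h.2.1.tendsto_div_nhds_zero, ?_, hb⟩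
  have h1 : (fun n => s n * L n) =o[atTop] b := by
    refine (hs.mul_isBigO h.1.1).congr' EventuallyEq.rfl ?_
    filter_upwards [eventually_gt_atTop 1] with n hn
    have : 0 < Real.log n := Real.log_pos (by exact_mod_cast hn)
    field_simp
  have h2 := (Real.continuous_sqrt.tendsto _).comp h1.tendsto_div_nhds_zero
  rw [Real.sqrt_zero] at h2
  exact h2.congr fun n => Real.sqrt_div' _ (hb0 n)

lemma signalRatio_eq (n : ℕ) :
    signalRatio s A L n = ((Real.tanh (A n) / signalScale s L n : ℝ) : EReal) := by
  rw [signalRatio, signalScale, Real.sqrt_div' _ (Nat.cast_nonneg _), div_div_eq_mul_div,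
    mul_comm]

lemma tanh_le_of_signalRatio_lt {n : ℕ} {c : ℝ} (hv : 0 < signalScale s L n)
    (h : signalRatio s A L n < (c : EReal)) : Real.tanh (A n) ≤ c * signalScale s L n := by
  rw [signalRatio_eq, EReal.coe_lt_coe_iff, div_lt_iff₀ hv] at h
  exact h.le

lemma le_of_lt_signalRatio {n : ℕ} {c : ℝ} (hc : 0 < c) (hv : 0 < signalScale s L n)
    (h : (c : EReal) < signalRatio s A L n) : c * signalScale s L n ≤ A n := by
  rw [signalRatio_eq, EReal.coe_lt_coe_iff, lt_div_iff₀ hv] at h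
  have h0 : 0 < Real.tanh (A n) := (mul_pos hc hv).trans h
  have h1 : 0 ≤ A n := by
    by_contra hneg
    have := tanh_strictMono (not_le.1 hneg)
    rw [Real.tanh_zero] at this
    linarith
  have h2 := (abs_le.1 (abs_tanh_le (A n))).2
  rw [abs_of_nonneg h1] at h2
  linarith

lemma sq_sqrt_two_mul_cosh_mul (w : ℝ) :
    (√2 * Real.cosh w) ^ 2 * (1 - Real.tanh w ^ 2) = 2 := by
  have h := (Real.cosh_pos w).ne'
  rw [mul_pow, Real.sq_sqrt zero_le_two, Real.tanh_eq_sinh_div_cosh]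
  field_simp
  linarith [Real.cosh_sq w]

/-- The upper bound in a regime in which the null hypothesis is controlled. -/
theorem exists_powerful_of_lt_liminf {β m : ℝ} {a : ℕ → ℝ} (hnull : NullControl β (β * m) a)
    (hm : Real.tanh (β * m) = m) {C : ∀ n : ℕ, Finset (Finset (Fin n))} {ε : ℕ → ℝ}
    (hcard : ∀ n, ∀ S ∈ C n, S.card = s n) (hε : Tendsto ε atTop (𝓝 0))
    (hL : ∀ n, L n = Real.log (coveringNumber (C n) (ε n))) (hsc : Scaling s L a)
    (hs : ∀ᶠ n in atTop, 0 < s n)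
    (h : ((√2 * Real.cosh (β * m) : ℝ) : EReal) < liminf (signalRatio s A L) atTop) :
    ∃ T : ∀ n, Test n, Powerful T C A β := by
  obtain ⟨c, hc1, hc2⟩ := EReal.lt_iff_exists_real_btwn.1 h
  have hc1' := EReal.coe_lt_coe_iff.1 hc1
  have hk : 0 < √2 * Real.cosh (β * m) := mul_pos (by positivity) (Real.cosh_pos _)
  have hc0 : 0 < c := hk.trans hc1'
  refine exists_powerful hnull hm hcard hε hL hsc hs hc0 ?_ ?_
  · have h1 := sq_sqrt_two_mul_cosh_mul (β * m)
    rw [hm] at h1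
    have h2 : 0 < 1 - m ^ 2 := by rw [← hm]; linarith [tanh_sq_lt_one (β * m)]
    have h3 : (√2 * Real.cosh (β * m)) ^ 2 < c ^ 2 := pow_lt_pow_left₀ hc1' hk.le two_ne_zero
    have := mul_lt_mul_of_pos_right h3 h2
    linarith
  · filter_upwards [eventually_lt_of_lt_liminf hc2, hsc.eventually_pos hs] with n h1 h2
    exact le_of_lt_signalRatio hc0 h2.2.2.2.1 h1

/-- The lower bounds in a regime in which the risk is controlled from below by `b`. -/
theorem lower_bounds {β m b : ℝ} {a : ℕ → ℝ} (hLC : LowerControl β (β * m) a b) (hb : 0 < b)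
    (hm : Real.tanh (β * m) = m) {C F : ∀ n : ℕ, Finset (Finset (Fin n))}
    (hcard : ∀ n, ∀ S ∈ C n, S.card = s n) (hF : ∀ n, F n ⊆ C n)
    (hdisj : ∀ n, (F n : Set (Finset (Fin n))).PairwiseDisjoint id)
    (hL : ∀ n, L n = Real.log ((F n).card : ℝ)) (hsc : Scaling s L a)
    (hs : ∀ᶠ n in atTop, 0 < s n) :
    (liminf (signalRatio s A L) atTop < ((√2 * Real.cosh (β * m) : ℝ) : EReal) →
      ∀ T : ∀ n, Test n, ¬ Powerful T C A β) ∧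
    (limsup (signalRatio s A L) atTop < ((√2 * Real.cosh (β * m) : ℝ) : EReal) →
      ∀ T : ∀ n, Test n, b ≤ liminf (cwRisk T C A β) atTop) := by
  set k := √2 * Real.cosh (β * m) with hk
  have hk0 : 0 < k := mul_pos (by positivity) (Real.cosh_pos _)
  have key : ∀ y : ℝ, y < k → ∀ e : ℝ, 0 < e → ∀ᶠ n in atTop,
      signalRatio s A L n < (y : EReal) → ∀ T : Test n,
        b - e ≤ risk T (C n) (A n) β (curieWeiss n) := by
    intro y hy e he
    have hc0 : 0 < max y (k / 2) := lt_max_of_lt_right (by linarith)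
    have hck : max y (k / 2) < k := max_lt hy (by linarith)
    have hc : max y (k / 2) ^ 2 * (1 - m ^ 2) < 2 := by
      have h1 := sq_sqrt_two_mul_cosh_mul (β * m)
      rw [hm] at h1
      have h2 : 0 < 1 - m ^ 2 := by rw [← hm]; linarith [tanh_sq_lt_one (β * m)]
      have h3 := mul_lt_mul_of_pos_right (pow_lt_pow_left₀ hck hc0.le two_ne_zero) h2
      linarith
    filter_upwards [eventually_le_risk (A := A) hLC hm hcard hF hdisj hL hsc hs hc0 hc he,
      hsc.eventually_pos hs] with n h1 h2 h3
    refine h1 (tanh_le_of_signalRatio_lt h2.2.2.2.1 (h3.trans_le ?_))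
    exact EReal.coe_le_coe_iff.2 (le_max_left _ _)
  constructor
  · intro h T hT
    obtain ⟨y, hy1, hy2⟩ := EReal.lt_iff_exists_real_btwn.1 h
    have h1 := (frequently_lt_of_liminf_lt (by isBoundedDefault) hy1).and_eventually
      (key y (EReal.coe_lt_coe_iff.1 hy2) (b / 2) (by linarith))
    have h2 : ∃ᶠ n in atTop, b / 2 ≤ cwRisk T C A β n := by
      refine h1.mono fun n hn => ?_
      have := hn.2 hn.1 (T n)
      unfold cwRisk
      linarith
    have h3 := le_limsup_of_frequently_le h2 (isBoundedUnder_cwRisk T C A)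
    rw [hT] at h3
    linarith
  · intro h T
    obtain ⟨y, hy1, hy2⟩ := EReal.lt_iff_exists_real_btwn.1 h
    refine le_of_forall_pos_sub_le fun e he => ?_
    refine le_liminf_of_le (isBoundedUnder_cwRisk T C A).isCoboundedUnder_ge ?_
    filter_upwards [eventually_lt_of_limsup_lt hy1,
      key y (EReal.coe_lt_coe_iff.1 hy2) e he] with n h1 h2
    exact h2 h1 (T n)

lemma controls_of_lt_one {β : ℝ} (hβ : β < 1) :
    NullControl β (β * 0) (fun n => √(n : ℝ)) ∧ LowerControl β (β * 0) (fun n => √(n : ℝ)) 1 := by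
  rw [mul_zero]
  rcases le_or_gt β 0 with h | h
  · exact ⟨nullControl_of_nonpos h, lowerControl_of_nonpos h⟩
  · exact ⟨(phaseBounds_of_lt_one h hβ).nullControl h,
      (phaseBounds_of_lt_one h hβ).lowerControl_one h⟩

lemma controls_one :
    NullControl 1 (1 * 0) (fun n => √√(n : ℝ)) ∧ LowerControl 1 (1 * 0) (fun n => √√(n : ℝ)) 1 := by
  rw [mul_zero]
  exact ⟨phaseBounds_one.nullControl one_pos, phaseBounds_one.lowerControl_one one_pos⟩

end Regimes

end CWDetect

theorem theorem1 :
    -- for β > 1 the equation m = tanh (β m) has a unique positive root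
    (∀ β : ℝ, 1 < β → ∃! m : ℝ, CWDetect.IsPosRoot β m) ∧
    -- s is the sparsity, C the class of candidate supports, A the signal strength
    ∀ (s : ℕ → ℕ) (C : ∀ n : ℕ, Finset (Finset (Fin n))) (A : ℕ → ℝ),
      (∀ n, ∀ S ∈ C n, S.card = s n) →
      -- upper bounds
      (∀ (ε L : ℕ → ℝ), Tendsto ε atTop (𝓝 0) →
        (∀ n, L n = Real.log (CWDetect.coveringNumber (C n) (ε n))) →
        CWDetect.ComplexityCond s L →
        (∀ β : ℝ, β < 1 → CWDetect.SparseLog s →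
          ((√2 : ℝ) : EReal) < liminf (CWDetect.signalRatio s A L) atTop →
          ∃ T : ∀ n, CWDetect.Test n, CWDetect.Powerful T C A β) ∧
        (CWDetect.SparseSqrtLog s →
          ((√2 : ℝ) : EReal) < liminf (CWDetect.signalRatio s A L) atTop →
          ∃ T : ∀ n, CWDetect.Test n, CWDetect.Powerful T C A 1) ∧
        (∀ β m : ℝ, 1 < β → CWDetect.IsPosRoot β m → CWDetect.SparseLog s →
          ((√2 * Real.cosh (β * m) : ℝ) : EReal) <
            liminf (CWDetect.signalRatio s A L) atTop →
          ∃ T : ∀ n, CWDetect.Test n, CWDetect.Powerful T C A β)) ∧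
      -- lower bounds
      (∀ (C' : ∀ n : ℕ, Finset (Finset (Fin n))) (L : ℕ → ℝ),
        (∀ n, C' n ⊆ C n) →
        (∀ n, (C' n : Set (Finset (Fin n))).PairwiseDisjoint id) →
        (∀ n, L n = Real.log ((C' n).card : ℝ)) →
        CWDetect.ComplexityCond s L →
        (∀ β : ℝ, β < 1 → CWDetect.SparseLog s →
          (liminf (CWDetect.signalRatio s A L) atTop < ((√2 : ℝ) : EReal) →
            ∀ T : ∀ n, CWDetect.Test n, ¬ CWDetect.Powerful T C A β) ∧
          (limsup (CWDetect.signalRatio s A L) atTop < ((√2 : ℝ) : EReal) →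
            ∀ T : ∀ n, CWDetect.Test n, CWDetect.Powerless T C A β)) ∧
        (CWDetect.SparseSqrtLog s →
          (liminf (CWDetect.signalRatio s A L) atTop < ((√2 : ℝ) : EReal) →
            ∀ T : ∀ n, CWDetect.Test n, ¬ CWDetect.Powerful T C A 1) ∧
          (limsup (CWDetect.signalRatio s A L) atTop < ((√2 : ℝ) : EReal) →
            ∀ T : ∀ n, CWDetect.Test n, CWDetect.Powerless T C A 1)) ∧
        (∀ β m : ℝ, 1 < β → CWDetect.IsPosRoot β m → CWDetect.SparseLog s →
          (liminf (CWDetect.signalRatio s A L) atTop <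
              ((√2 * Real.cosh (β * m) : ℝ) : EReal) →
            ∀ T : ∀ n, CWDetect.Test n, ¬ CWDetect.Powerful T C A β) ∧
          (limsup (CWDetect.signalRatio s A L) atTop <
              ((√2 * Real.cosh (β * m) : ℝ) : EReal) →
            ∀ T : ∀ n, CWDetect.Test n, CWDetect.NotPowerful T C A β))) := by
  refine ⟨fun β hβ => CWDetect.existsUnique_isPosRoot hβ, fun s C A hcard => ⟨?_, ?_⟩⟩
  · intro ε L hε hL hcc
    have hL0 : ∀ n, 0 ≤ L n := fun n => by rw [hL n]; exact Real.log_natCast_nonneg _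
    have hs := hcc.eventually_pos hL0
    refine ⟨fun β hβ hsp h => ?_, fun hsp h => ?_, fun β m hβ hm hsp h => ?_⟩
    · exact CWDetect.exists_powerful_of_lt_liminf (CWDetect.controls_of_lt_one hβ).1 (by simp)
        hcard hε hL (hcc.scaling hL0 CWDetect.sqrt_scale (fun n => Nat.cast_nonneg n) hsp) hs
        (by simpa using h)
    · exact CWDetect.exists_powerful_of_lt_liminf CWDetect.controls_one.1 (by simp)
        hcard hε hL (hcc.scaling hL0 CWDetect.phaseBounds_one.2.1
          (fun n => Real.sqrt_nonneg _) hsp) hs (by simpa using h)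
    · exact CWDetect.exists_powerful_of_lt_liminf
        ((hm.phaseBounds hβ).nullControl (by linarith)) hm.tanh_eq
        hcard hε hL (hcc.scaling hL0 CWDetect.sqrt_scale (fun n => Nat.cast_nonneg n) hsp) hs h
  · intro C' L hC' hdisj hL hcc
    have hL0 : ∀ n, 0 ≤ L n := fun n => by rw [hL n]; exact Real.log_natCast_nonneg _
    have hs := hcc.eventually_pos hL0
    refine ⟨fun β hβ hsp => ?_, fun hsp => ?_, fun β m hβ hm hsp => ?_⟩
    · have h := CWDetect.lower_bounds (A := A) (CWDetect.controls_of_lt_one hβ).2 one_pos (by simp)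
        hcard hC' hdisj hL
        (hcc.scaling hL0 CWDetect.sqrt_scale (fun n => Nat.cast_nonneg n) hsp) hs
      simpa [CWDetect.Powerless] using h
    · have h := CWDetect.lower_bounds (A := A) CWDetect.controls_one.2 one_pos (by simp)
        hcard hC' hdisj hL (hcc.scaling hL0 CWDetect.phaseBounds_one.2.1
          (fun n => Real.sqrt_nonneg _) hsp) hs
      simpa [CWDetect.Powerless] using h
    · have h := CWDetect.lower_bounds (A := A)
        ((hm.phaseBounds hβ).lowerControl_half (by linarith)) one_half_pos hm.tanh_eq
        hcard hC' hdisj hL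
        (hcc.scaling hL0 CWDetect.sqrt_scale (fun n => Nat.cast_nonneg n) hsp) hs
      exact ⟨h.1, fun h' T => one_half_pos.trans_le (h.2 h' T)⟩
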